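/- **Setting.** Let $(\mathcal A,\rho)$ be a metric space with a Borel probability measure $\nu$, and let $B_h(a)=\{b:\rho(a,b)\le h\}$. Let $\mathcal X$ be a context space, $\Pi$ a finite set of (measurable) policies $\pi:\mathcal X\to\mathcal A$, and $\mathcal D$ a distribution over pairs $(x,\ell)$ of a context $x\in\mathcal X$ and a loss function $\ell:\mathcal A\to[0,1]$. In each of $T$ rounds nature draws $(x_t,\ell_t)\sim\mathcal D$ independently of the past, the learner sees $x_t$, chooses $a_t\in\mathcal A$ and observes $\ell_t(a_t)$. The marginal of $\mathcal D$ on $\mathcal X$ is known to the learner. For $h>0$ let $\mathrm{Smooth}_h(a)$ be the uniform distribution on $B_h(a)$, i.e. the distribution with $\nu$-density $K_h(a)(b)=\mathbf 1\{\rho(a,b)\le h\}/\nu(B_h(a))$, and put $$\lambda_h(\pi)=\mathbb E_{(x,\ell)\sim\mathcal D}\,\mathbb E_{a\sim \mathrm{Smooth}_h(\pi(x))}[\ell(a)],\qquad \mathrm{Bench}(\Pi_h)=\min_{\pi\in\Pi}\lambda_h(\pi),$$ $$\mathrm{Regret}(T,\Pi_h)=\mathbb E\Big[\sum_{t=1}^T\ell_t(a_t)\Big]-T\cdot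 \mathrm{Bench}(\Pi_h),\qquad \kappa_h=\sup_{a,b}K_h(a)(b).$$ **Smoothing coefficient.** Let $\Pi_{h,\epsilon}=\{\pi\in\Pi:\lambda_h(\pi)\le \mathrm{Bench}(\Pi_h)+\epsilon\}$, let $\mathcal N_\delta(S)$ be the largest cardinality of a subset of $S\subseteq\mathcal A$ whose distinct points are at distance at least $\delta$, and let $$M_h(\epsilon,\delta)=\mathbb E_{x\sim\mathcal D}\big[\mathcal N_\delta(\{\pi(x):\pi\in\Pi_{h,\epsilon}\})\big],\qquad \theta_h(\epsilon_0)=\sup_{\epsilon\ge\epsilon_0}\frac{M_h(12\epsilon,h)}{\epsilon}.$$ **Algorithm** (SmoothPolicyElimination with parameter $h$). Put $\delta_T=5\lceil\log(T|\Pi|\log_2T)\rceil$, $r_m=2^{-m}$, $\mu_m=\min\{1/2,r_m\}$, $\Pi^{(1)}=\Pi$. In epoch $m=1,2,\dots$ let $V_m=\mathbb E_{x\sim\mathcal D}\,\nu\big(\bigcup_{\pi\in\Pi^{(m)}}B_h(\pi(x))\big)$, let the batch size be $\tilde n_m=\lceil 320\,\kappa_hV_m/r_m^2\rceil$ and the epoch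 length $n_m=\tilde n_m\delta_T$. Choose a distribution $Q_m$ on $\Pi^{(m)}$ that minimizes $$\max_{\pi\in\Pi^{(m)}}\mathbb E_{x\sim\mathcal D}\,\mathbb E_{a\sim \mathrm{Smooth}_h(\pi(x))}\Big[\frac1{q_m(a\mid x)}\Big],\qquad q_m(a\mid x)=\mu_m+(1-\mu_m)\,\mathbb E_{\pi\sim Q_m}K_h(\pi(x))(a).$$ In each round $t$ of the epoch sample $a_t$ from the density $q_m(\cdot\mid x_t)$. After the epoch, split it into $\delta_T$ consecutive batches of length $\tilde n_m$; for $\pi\in\Pi^{(m)}$ let $\hat L_m(\pi)$ be the median over the batches of the batch averages of $K_h(\pi(x_t))(a_t)\,\ell_t(a_t)/q_m(a_t\mid x_t)$, and let $\Pi^{(m+1)}=\{\pi\in\Pi^{(m)}:\hat L_m(\pi)\le\min_{\pi'\in\Pi^{(m)}}\hat L_m(\pi')+3r_m\}$. The algorithm stops after round $T$. **Theorem 1.** Suppose that $|\Pi|\log_2T>1$. (a) (Unit interval.) There is an absolute constant $C$ such that for $\mathcal A=[0,1]$ with $\rho(a,b)=|a-b|$ and Lebesgue measure $\nu$ (here $\kappa_h=1/\min\{h,1\}$)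 and every $h>0$, SmoothPolicyElimination with parameter $h$ has $$\mathrm{Regret}(T,\Pi_h)\le C\inf_{0<\epsilon_0\le1}\Big(T\epsilon_0+\theta_h(\epsilon_0)\,\log(|\Pi|\log_2T)\,\log(1/\epsilon_0)\Big).$$ (b) (General form.) Let $\alpha$ be a real number. There is a constant $C$ depending only on $\alpha$ such that the same bound holds for every $h>0$ and every $(\mathcal A,\rho,\nu)$ of diameter $1$ for which there is $d$ with $0<\nu(B_{2r}(a))\le2^d\nu(B_r(a))$ for all $a\in\mathcal A$, $r>0$, and for which $\nu(B_{2r}(a))\le\alpha\,\nu(B_r(a'))$ for all $a,a'\in\mathcal A$, $r>0$. -/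

import Mathlib

open MeasureTheory ProbabilityTheory

namespace SmoothBandit

noncomputable section

/-! ### The action space -/

/-- `ν` is doubling with exponent `d` on the metric space `A`, and `A` has diameter one. -/
structure IsDoublingSpace {A : Type*} [MetricSpace A] [MeasurableSpace A]
    (ν : Measure A) (d : ℝ) : Prop where
  pos : ∀ (a : A) (r : ℝ), 0 < r → 0 < ν.real (Metric.closedBall a (2 * r))
  doubling : ∀ (a : A) (r : ℝ), 0 < r →
    ν.real (Metric.closedBall a (2 * r)) ≤ (2 : ℝ) ^ d * ν.real (Metric.closedBall a r)
  diam_eq_one : Metric.diam (Set.univ : Set A) = 1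

/-- Uniformity of ball volumes: `ν (B(a, 2r)) / ν (B(a', r)) ≤ α` for all centres and radii. -/
def HasUniformBalls {A : Type*} [MetricSpace A] [MeasurableSpace A]
    (ν : Measure A) (α : ℝ) : Prop :=
  ∀ (a a' : A) (r : ℝ), 0 < r →
    ν.real (Metric.closedBall a (2 * r)) ≤ α * ν.real (Metric.closedBall a' r)

/-- Density, with respect to `ν`, of the uniform distribution over the closed ball `B(a, h)`. -/
def smooth {A : Type*} [MetricSpace A] [MeasurableSpace A]
    (ν : Measure A) (h : ℝ) (a b : A) : ℝ :=
  (Metric.closedBall a h).indicator (fun _ => (ν.real (Metric.closedBall a h))⁻¹) b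

/-- The supremum `κ_h` of the smoothing density. -/
def kappa {A : Type*} [MetricSpace A] [MeasurableSpace A] (ν : Measure A) (h : ℝ) : ℝ :=
  ⨆ p : A × A, |smooth ν h p.1 p.2|

/-- The `δ`-packing number of `S`: the largest cardinality of a subset of `S` whose distinct points
are at distance at least `δ` (only used for finite `S`). -/
def packingNumber {A : Type*} [MetricSpace A] (δ : ℝ) (S : Set A) : ℕ :=
  sSup {n : ℕ | ∃ F : Finset A, (F : Set A) ⊆ S ∧
    (F : Set A).Pairwise (fun a b => δ ≤ dist a b) ∧ F.card = n}

/-! ### The bandit problem -/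

/-- A distribution over pairs (context, loss function `A → [0,1]`). The random loss function is
`loss y`, where `y` ranges over a measurable space of labels and `loss` is jointly measurable. -/
structure Problem (X Y A : Type*) [MeasurableSpace X] [MeasurableSpace Y] [MeasurableSpace A] where
  law : Measure (X × Y)
  isProb : IsProbabilityMeasure law
  loss : Y → A → ℝ
  measurable_loss : Measurable (Function.uncurry loss)
  loss_mem : ∀ y a, loss y a ∈ Set.Icc (0 : ℝ) 1

section Quantities

variable {X Y A : Type*} [MeasurableSpace X] [MeasurableSpace Y] [MetricSpace A]
  [MeasurableSpace A]

/-- The smoothed loss `λ_h(π)`. -/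
def smoothedLoss (ν : Measure A) (h : ℝ) (D : Problem X Y A) (π : X → A) : ℝ :=
  ∫ z, ∫ a, smooth ν h (π z.1) a * D.loss z.2 a ∂ν ∂D.law

/-- The benchmark: the smallest smoothed loss over the policy set. -/
def bench (ν : Measure A) (h : ℝ) (D : Problem X Y A) (Pol : Finset (X → A)) : ℝ :=
  ⨅ π : {π : X → A // π ∈ Pol}, smoothedLoss ν h D π.1

/-- The `ε`-optimal policies `Π_{h,ε}`. -/
def nearOptimal (ν : Measure A) (h : ℝ) (D : Problem X Y A) (Pol : Finset (X → A)) (ε : ℝ) :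
    Set (X → A) :=
  {π | π ∈ Pol ∧ smoothedLoss ν h D π ≤ bench ν h D Pol + ε}

/-- The expected packing number `M_h(ε, δ)`. -/
def expectedPacking (ν : Measure A) (h : ℝ) (D : Problem X Y A) (Pol : Finset (X → A))
    (ε δ : ℝ) : ℝ :=
  ∫ x, (packingNumber δ ((fun π : X → A => π x) '' nearOptimal ν h D Pol ε) : ℝ) ∂D.law.fst

/-- The smoothing coefficient `θ_h(ε₀)`. -/
def smoothingCoeff (ν : Measure A) (h : ℝ) (D : Problem X Y A) (Pol : Finset (X → A))
    (ε₀ : ℝ) : ℝ :=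
  ⨆ ε : Set.Ici ε₀, expectedPacking ν h D Pol (12 * (ε : ℝ)) h / (ε : ℝ)

end Quantities

/-! ### The algorithm `SmoothPolicyElimination` -/

/-- The median of a finite family (the mean of the two middle order statistics; these coincide
when `k` is odd). -/
def median {k : ℕ} (v : Fin k → ℝ) : ℝ :=
  if hk : 0 < k then
    (v (Tuple.sort v ⟨(k - 1) / 2, by omega⟩) + v (Tuple.sort v ⟨k / 2, by omega⟩)) / 2
  else 0

/-- What the learner sees in one round. -/
structure Round (X A : Type*) where
  context : X
  action : A
  lossValue : ℝ

/-- The input of the algorithm: base measure on actions, law of the contexts, bandwidth `h`,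
(value of) the density bound `κ`, number of rounds `T`, finite policy set, and a rule that returns,
for an epoch `m` and a set of active policies, a weight for each policy. -/
structure Config (X A : Type*) [MeasurableSpace X] [MeasurableSpace A] where
  base : Measure A
  ctxLaw : Measure X
  bandwidth : ℝ
  kap : ℝ
  horizon : ℕ
  policies : Finset (X → A)
  solver : ℕ → Finset (X → A) → (X → A) → ℝ

/-- The memory of the algorithm: current epoch, first round of this epoch, active policies. -/
structure EpochState (X A : Type*) where
  epoch : ℕ
  start : ℕ
  active : Finset (X → A)

/-- The radius `r_m = 2^{-m}`. -/
def radius (m : ℕ) : ℝ := (1 / 2 : ℝ) ^ m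

/-- The exploration probability `μ_m = min {1/2, r_m}`. -/
def exploreProb (m : ℕ) : ℝ := min (1 / 2) (radius m)

/-- `Q` is a probability distribution over the finite policy set `S`. -/
def IsDistributionOn {X A : Type*} (S : Finset (X → A)) (Q : (X → A) → ℝ) : Prop :=
  (∀ π ∈ S, 0 ≤ Q π) ∧ ∑ π ∈ S, Q π = 1

namespace Config

variable {X A : Type*} [MeasurableSpace X] [MetricSpace A] [MeasurableSpace A]

/-- The number of batches `δ_T = 5 ⌈log (T |Π| log₂ T)⌉`. -/
def numBatches (c : Config X A) : ℕ :=
  5 * ⌈Real.log ((c.horizon : ℝ) * (c.policies.card : ℝ) * Real.logb 2 (c.horizon : ℝ))⌉₊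

/-- The characteristic volume of the policy set `S`. -/
def charVolume (c : Config X A) (S : Finset (X → A)) : ℝ :=
  ∫ x, c.base.real (⋃ π ∈ S, Metric.closedBall (π x) c.bandwidth) ∂c.ctxLaw

/-- The batch size `320 κ V_m / r_m²`, rounded up. -/
def batchSize (c : Config X A) (m : ℕ) (S : Finset (X → A)) : ℕ :=
  ⌈320 * c.kap * c.charVolume S / radius m ^ 2⌉₊

/-- The epoch length. -/
def epochLength (c : Config X A) (m : ℕ) (S : Finset (X → A)) : ℕ :=
  c.batchSize m S * c.numBatches

/-- The density `q(a | x) = μ + (1 - μ) E_{π ∼ Q} Smooth_{π,h}(a | x)` with respect to the base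
measure. -/
def actionDensity (c : Config X A) (μ : ℝ) (S : Finset (X → A)) (Q : (X → A) → ℝ)
    (x : X) (a : A) : ℝ :=
  μ + (1 - μ) * ∑ π ∈ S, Q π * smooth c.base c.bandwidth (π x) a

/-- `E_x E_{a ∼ Smooth_h(π(x))} [1 / q(a | x)]`. -/
def variance (c : Config X A) (μ : ℝ) (S : Finset (X → A)) (Q : (X → A) → ℝ) (π : X → A) : ℝ :=
  ∫ x, ∫ a, smooth c.base c.bandwidth (π x) a * (1 / c.actionDensity μ S Q x a) ∂c.base ∂c.ctxLaw

/-- `Q` is a distribution over `S` that minimizes the largest `variance` over `π ∈ S`. -/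
def IsOptimal (c : Config X A) (μ : ℝ) (S : Finset (X → A)) (Q : (X → A) → ℝ) : Prop :=
  IsDistributionOn S Q ∧ ∀ Q' : (X → A) → ℝ, IsDistributionOn S Q' →
    ⨆ π : {π : X → A // π ∈ S}, c.variance μ S Q π.1 ≤
      ⨆ π : {π : X → A // π ∈ S}, c.variance μ S Q' π.1

/-- The rule `solver` solves the optimization problem in every epoch, for every possible set of
active policies; ties may be broken arbitrarily. -/
def SolverIsOptimal (c : Config X A) : Prop :=
  ∀ (m : ℕ) (S : Finset (X → A)), 1 ≤ m → S ⊆ c.policies → S.Nonempty →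
    c.IsOptimal (exploreProb m) S (c.solver m S)

/-- The density `q_m(a | x)` from which actions are sampled in epoch `m`, when the active policies
are `S`. -/
def epochDensity (c : Config X A) (m : ℕ) (S : Finset (X → A)) (x : X) (a : A) : ℝ :=
  c.actionDensity (exploreProb m) S (c.solver m S) x a

/-- The importance weighted loss estimate of `π` from one round. -/
def ipsEstimate (c : Config X A) (m : ℕ) (S : Finset (X → A)) (o : Round X A) (π : X → A) : ℝ :=
  smooth c.base c.bandwidth (π o.context) o.action * o.lossValue /
    c.epochDensity m S o.context o.action

/-- The average of the estimates over batch `i` (counted from `0`) of an epoch. -/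
def batchMean (c : Config X A) (obs : ℕ → Round X A) (s : EpochState X A) (i : ℕ) (π : X → A) : ℝ :=
  (∑ j ∈ Finset.range (c.batchSize s.epoch s.active),
    c.ipsEstimate s.epoch s.active
      (obs (s.start + i * c.batchSize s.epoch s.active + j)) π) /
    (c.batchSize s.epoch s.active : ℝ)

/-- The median-of-means loss estimate of an epoch. -/
def lossEstimate (c : Config X A) (obs : ℕ → Round X A) (s : EpochState X A) (π : X → A) : ℝ :=
  median (fun i : Fin c.numBatches => c.batchMean obs s (i : ℕ) π)

open Classical in
/-- The policies of the current epoch whose estimate is at most `3 r_m` above the smallest one. -/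
def survivors (c : Config X A) (obs : ℕ → Round X A) (s : EpochState X A) : Finset (X → A) :=
  s.active.filter (fun π => ∀ π' ∈ s.active,
    c.lossEstimate obs s π ≤ c.lossEstimate obs s π' + 3 * radius s.epoch)

/-- The memory of the algorithm before round `t` (rounds are counted from `0`, epochs from `1`).
It is updated when the last round of an epoch is over, and depends on earlier rounds only. -/
def state (c : Config X A) (obs : ℕ → Round X A) : ℕ → EpochState X A
  | 0 => ⟨1, 0, c.policies⟩
  | t + 1 =>
    if t + 1 < (c.state obs t).start + c.epochLength (c.state obs t).epoch (c.state obs t).active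
    then c.state obs t
    else ⟨(c.state obs t).epoch + 1, t + 1, c.survivors obs (c.state obs t)⟩

/-- The density from which the algorithm samples its action in round `t` on context `x`. -/
def playDensity (c : Config X A) (obs : ℕ → Round X A) (t : ℕ) (x : X) (a : A) : ℝ :=
  c.epochDensity (c.state obs t).epoch (c.state obs t).active x a

end Config

/-! ### The interaction and the regret -/

section Interaction

variable {X Y A Ω : Type*} [MeasurableSpace X] [MeasurableSpace Y] [MetricSpace A]
  [MeasurableSpace A] [MeasurableSpace Ω]

/-- What the learner sees along the outcome `ω`. -/
def observations (D : Problem X Y A) (x : ℕ → Ω → X) (y : ℕ → Ω → Y) (a : ℕ → Ω → A) (ω : Ω) :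
    ℕ → Round X A :=
  fun t => ⟨x t ω, a t ω, D.loss (y t ω) (a t ω)⟩

/-- The σ-algebra generated by everything that happens before round `t`. -/
abbrev past (x : ℕ → Ω → X) (y : ℕ → Ω → Y) (a : ℕ → Ω → A) (t : ℕ) : MeasurableSpace Ω :=
  ⨆ s : Fin t, MeasurableSpace.comap
    (fun ω => (x (s : ℕ) ω, y (s : ℕ) ω, a (s : ℕ) ω)) inferInstance

/-- The σ-algebra generated by the context and the loss function of round `t`. -/
abbrev nature (x : ℕ → Ω → X) (y : ℕ → Ω → Y) (t : ℕ) : MeasurableSpace Ω :=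
  MeasurableSpace.comap (fun ω => (x t ω, y t ω)) inferInstance

/-- The contexts `x t`, loss functions `D.loss (y t)` and actions `a t` come from running the
algorithm with input `c` on the problem `D`: in each round nature draws a fresh pair from `D`,
and given the past and this pair, the action has the density chosen by the algorithm. -/
structure IsRun (c : Config X A) (D : Problem X Y A) (P : Measure Ω)
    (x : ℕ → Ω → X) (y : ℕ → Ω → Y) (a : ℕ → Ω → A) : Prop where
  measurable_context : ∀ t, Measurable (x t)
  measurable_label : ∀ t, Measurable (y t)
  measurable_action : ∀ t, Measurable (a t)
  law_nature : ∀ t < c.horizon, P.map (fun ω => (x t ω, y t ω)) = D.law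
  indep_past : ∀ t < c.horizon, Indep (past x y a t) (nature x y t) P
  law_action : ∀ t < c.horizon, ∀ U : Set A, MeasurableSet U →
    P[(a t ⁻¹' U).indicator (fun _ => (1 : ℝ)) | past x y a t ⊔ nature x y t] =ᵐ[P]
      fun ω => ∫ b in U, c.playDensity (observations D x y a ω) t (x t ω) b ∂c.base

/-- The expected smoothed regret after `T` rounds. -/
def regret (ν : Measure A) (h : ℝ) (D : Problem X Y A) (Pol : Finset (X → A)) (T : ℕ)
    (P : Measure Ω) (y : ℕ → Ω → Y) (a : ℕ → Ω → A) : ℝ :=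
  (∫ ω, ∑ t ∈ Finset.range T, D.loss (y t ω) (a t ω) ∂P) - (T : ℝ) * bench ν h D Pol

end Interaction

/-- `inf_{0 < ε₀ ≤ 1} T ε₀ + θ_h(ε₀) log (|Π| log₂ T) log (1 / ε₀)`. -/
def rate {X Y A : Type*} [MeasurableSpace X] [MeasurableSpace Y] [MetricSpace A]
    [MeasurableSpace A] (ν : Measure A) (h : ℝ) (D : Problem X Y A) (Pol : Finset (X → A))
    (T : ℕ) : ℝ :=
  ⨅ ε₀ : Set.Ioc (0 : ℝ) 1,
    ((T : ℝ) * (ε₀ : ℝ) + smoothingCoeff ν h D Pol (ε₀ : ℝ) *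
      Real.log ((Pol.card : ℝ) * Real.logb 2 (T : ℝ)) * Real.log (1 / (ε₀ : ℝ)))

end

end SmoothBandit

/-! Write `λ` for the smoothed loss, `λ*` for its minimum, `k` for the number of batches, `p = |Π|`
and `L = log (p log₂ T)`. In each epoch the losses of the active policies are estimated to accuracy
`r_m`; policies visibly worse than the best are discarded. The regret is governed by the length of
an epoch, which is proportional to the variance of the estimates.

Variance. The mixture that maximizes the expected log-density satisfies a first-order condition
(`exists_mixture`) that bounds the moment of every component by that of the mixture itself. The
latter is at most twice the volume `V_m` of the union of balls, because the density ratio is at most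
`1 / (1 - μ) ≤ 2` there and zero elsewhere. The minimizing `Q_m` can only be better
(`variance_le_of_isOptimal`), so one estimate has second moment at most `2 κ V_m`. A largest
`h`-packing of the chosen actions is also a covering, and hence `κ V_m ≤ α M_h`
(`kappa_mul_volume_union_balls_le`).

Concentration. Given the past, samples within an epoch are independent with a fixed law
(`map_restrict_sample`). By Chebyshev a batch mean is off by more than `r_m` with probability at
most `1/160`; a wrong median needs half of the batches wrong, which has probability at most `6^{-k}`
(`measureReal_inter_lossEstimate_le`).

Elimination. When all estimates are accurate, an optimal policy survives and every active policy is
within `12 r_m` of `λ*` (`active_nearOptimal`). A round then costs at most `13 r_m`, and an epoch of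
length of order `k α M_h(12 r_m, h) / r_m²` costs of order `k α f_m` with `f_m = M_h(12 r_m, h) /
r_m`. Rounds of radius at most `ε₀` contribute a term of order `T ε₀`.

Removing `log T`. Here `k` is of order `log T + L`, while the target only has `L log (1/ε₀)`. If
`log T` is not of order `L`, then `p` is a small power of `T`. Either `1/ε₀` is also a small power
and the sum is below `T ε₀`, or `log T` is of order `log (1/ε₀)`. In the second case `f_m ≤ p 2^m`
and `2^M ≤ θ`, where `M` is the last epoch with `r_m ≥ ε₀`, show that the sum over epochs is of
order `θ L` (`batches_mul_sum_le`). -/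

namespace SmoothBandit

set_option linter.unusedSectionVars false

noncomputable section

/-! ### Smoothing densities under two-sided bounds on ball volumes -/

section Smooth

variable {A : Type*} [MetricSpace A] [MeasurableSpace A] {ν : Measure A} {h κ α : ℝ}

/-- `1 / κ` bounds the volume of the balls of radius `h` from below, and `α / κ` bounds the volume
of the balls of radius `2 h` from above. -/
structure BallBounds (ν : Measure A) (h κ α : ℝ) : Prop where
  radius_pos : 0 < h
  one_le : ∀ a, 1 ≤ κ * ν.real (Metric.closedBall a h)
  double_le : ∀ a, κ * ν.real (Metric.closedBall a (2 * h)) ≤ α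

namespace BallBounds

theorem kappa_pos (hb : BallBounds ν h κ α) (a : A) : 0 < κ := by
  by_contra hκ
  have := hb.one_le a
  nlinarith [measureReal_nonneg (μ := ν) (s := Metric.closedBall a h)]

theorem volume_pos (hb : BallBounds ν h κ α) (a : A) : 0 < ν.real (Metric.closedBall a h) := by
  have h1 := hb.one_le a
  have h2 := hb.kappa_pos a
  by_contra h3
  nlinarith

theorem one_le_alpha [IsFiniteMeasure ν] (hb : BallBounds ν h κ α) (a : A) : 1 ≤ α := by
  refine (hb.one_le a).trans ((mul_le_mul_of_nonneg_left ?_ (hb.kappa_pos a).le).trans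
    (hb.double_le a))
  exact measureReal_mono (Metric.closedBall_subset_closedBall (by linarith [hb.radius_pos]))

end BallBounds

theorem smooth_nonneg (ν : Measure A) (h : ℝ) (a b : A) : 0 ≤ smooth ν h a b :=
  Set.indicator_nonneg (fun _ _ => inv_nonneg.2 measureReal_nonneg) _

theorem smooth_le (hb : BallBounds ν h κ α) (a b : A) : smooth ν h a b ≤ κ := by
  refine Set.indicator_le' (fun _ _ => ?_) (fun _ _ => (hb.kappa_pos a).le) _
  rw [inv_le_iff_one_le_mul₀ (hb.volume_pos a)]
  exact hb.one_le a

theorem abs_smooth_le (hb : BallBounds ν h κ α) (a b : A) : |smooth ν h a b| ≤ κ := by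
  rw [abs_of_nonneg (smooth_nonneg _ _ _ _)]
  exact smooth_le hb a b

theorem integral_smooth [BorelSpace A] (hb : BallBounds ν h κ α) (a : A) :
    ∫ b, smooth ν h a b ∂ν = 1 := by
  unfold smooth
  rw [integral_indicator Metric.isClosed_closedBall.measurableSet]
  simp [mul_inv_cancel₀ (hb.volume_pos a).ne']

/-- Centre and action vary jointly. The ball is a section of the closed set `dist ≤ h`, so its
volume depends measurably on the centre. -/
theorem measurable_smooth [BorelSpace A] [SecondCountableTopology A] [SFinite ν] :
    Measurable (fun p : A × A => smooth ν h p.1 p.2) := by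
  have hs : MeasurableSet {p : A × A | dist p.2 p.1 ≤ h} :=
    measurableSet_le (by fun_prop) measurable_const
  have hv : Measurable (fun a : A => ν.real (Metric.closedBall a h)) :=
    (measurable_measure_prodMk_left hs).ennreal_toReal
  have : (fun p : A × A => smooth ν h p.1 p.2) =
      {p : A × A | dist p.2 p.1 ≤ h}.indicator
        (fun p => (ν.real (Metric.closedBall p.1 h))⁻¹) := by
    ext p
    by_cases hp : dist p.2 p.1 ≤ h
    · rw [Set.indicator_of_mem (s := {p : A × A | dist p.2 p.1 ≤ h}) hp, smooth,
        Set.indicator_of_mem (Metric.mem_closedBall.2 hp)]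
    · rw [Set.indicator_of_notMem (s := {p : A × A | dist p.2 p.1 ≤ h}) hp, smooth,
        Set.indicator_of_notMem fun h' => hp (Metric.mem_closedBall.1 h')]
  rw [this]
  exact ((hv.comp measurable_fst).inv).indicator hs

end Smooth

/-! ### The optimization problem -/

section Optimization

variable {Z : Type*} [MeasurableSpace Z] {M : Measure Z} {ι : Type*} [Fintype ι]

theorem integrable_of_abs_le [IsFiniteMeasure M] {f : Z → ℝ} (hf : Measurable f) {C : ℝ}
    (hC : ∀ z, |f z| ≤ C) : Integrable f M :=
  Integrable.of_bound hf.aestronglyMeasurable C (Filter.Eventually.of_forall hC)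

/-- There is a mixture of densities with respect to which every component has a small
`χ²`-type moment: the mixture that maximizes the expected logarithm. -/
theorem exists_mixture [IsProbabilityMeasure M] [Nonempty ι] {k : ι → Z → ℝ} {κ μ : ℝ}
    (hk : ∀ i, Measurable (k i)) (hk0 : ∀ i z, 0 ≤ k i z) (hkκ : ∀ i z, k i z ≤ κ)
    (hμ0 : 0 < μ) (hμ1 : μ < 1) :
    ∃ w ∈ stdSimplex ℝ ι, ∀ i,
      ∫ z, k i z * (1 / (μ + (1 - μ) * ∑ j, w j * k j z)) ∂M ≤
        ∫ z, (∑ j, w j * k j z) * (1 / (μ + (1 - μ) * ∑ j, w j * k j z)) ∂M := by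
  classical
  set q : (ι → ℝ) → Z → ℝ := fun w z => μ + (1 - μ) * ∑ j, w j * k j z with hq
  have hmix0 : ∀ w ∈ stdSimplex ℝ ι, ∀ z, 0 ≤ ∑ j, w j * k j z := fun w hw z =>
    Finset.sum_nonneg fun j _ => mul_nonneg (hw.1 j) (hk0 j z)
  have hmixκ : ∀ w ∈ stdSimplex ℝ ι, ∀ z, ∑ j, w j * k j z ≤ κ := fun w hw z => by
    calc ∑ j, w j * k j z ≤ ∑ j, w j * κ :=
          Finset.sum_le_sum fun j _ => mul_le_mul_of_nonneg_left (hkκ j z) (hw.1 j)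
      _ = κ := by rw [← Finset.sum_mul, hw.2, one_mul]
  have hmixm : ∀ w : ι → ℝ, Measurable fun z => ∑ j, w j * k j z := fun w => by fun_prop
  have hqm : ∀ w, Measurable (q w) := fun w => by
    have := hmixm w
    fun_prop
  have hqμ : ∀ w ∈ stdSimplex ℝ ι, ∀ z, μ ≤ q w z := fun w hw z => by
    have := hmix0 w hw z
    have : 0 ≤ (1 - μ) * ∑ j, w j * k j z := mul_nonneg (by linarith) this
    simp only [hq]; linarith
  have hqκ : ∀ w ∈ stdSimplex ℝ ι, ∀ z, q w z ≤ μ + (1 - μ) * κ := fun w hw z => by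
    have := mul_le_mul_of_nonneg_left (hmixκ w hw z) (by linarith : 0 ≤ 1 - μ)
    simp only [hq]; linarith
  -- The floor `μ` and the ceiling `μ + (1 - μ) κ` bound the logarithm uniformly, so dominated
  -- convergence gives continuity of the objective on the compact simplex.
  have hlogb : ∀ w ∈ stdSimplex ℝ ι, ∀ z,
      |Real.log (q w z)| ≤ max |Real.log μ| |Real.log (μ + (1 - μ) * κ)| := fun w hw z => by
    have h1 := Real.log_le_log hμ0 (hqμ w hw z)
    have h2 := Real.log_le_log (hμ0.trans_le (hqμ w hw z)) (hqκ w hw z)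
    exact abs_le_max_abs_abs h1 h2
  have hcont : ContinuousOn (fun w => ∫ z, Real.log (q w z) ∂M) (stdSimplex ℝ ι) := by
    refine continuousOn_of_dominated (bound := fun _ => max |Real.log μ| |Real.log (μ + (1 - μ) * κ)|)
      (fun w _ => (Real.measurable_log.comp (hqm w)).aestronglyMeasurable)
      (fun w hw => Filter.Eventually.of_forall (hlogb w hw)) (integrable_const _)
      (Filter.Eventually.of_forall fun z => ?_)
    refine ContinuousOn.log ?_ fun w hw => (hμ0.trans_le (hqμ w hw z)).ne'
    simp only [hq]
    fun_prop
  obtain ⟨w, hw, hmax⟩ := (isCompact_stdSimplex ℝ ι).exists_isMaxOn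
    ⟨_, single_mem_stdSimplex ℝ (Classical.arbitrary ι)⟩ hcont
  refine ⟨w, hw, fun i => ?_⟩
  have hκ0 : 0 ≤ κ := by
    obtain ⟨z⟩ : Nonempty Z := M.nonempty_of_neZero
    exact (hk0 i z).trans (hkκ i z)
  have hint : ∀ v ∈ stdSimplex ℝ ι, ∀ f : Z → ℝ, Measurable f → (∀ z, |f z| ≤ κ) →
      Integrable (fun z => f z * (1 / q v z)) M := fun v hv f hf hfκ => by
    refine integrable_of_abs_le (C := κ * (1 / μ)) (hf.mul ((hqm v).const_div 1)) fun z => ?_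
    rw [abs_mul, abs_of_pos (one_div_pos.2 (hμ0.trans_le (hqμ v hv z)))]
    exact mul_le_mul (hfκ z) (one_div_le_one_div_of_le hμ0 (hqμ v hv z))
      (one_div_pos.2 (hμ0.trans_le (hqμ v hv z))).le hκ0
  have hdiffκ : ∀ z, |k i z - ∑ j, w j * k j z| ≤ κ := fun z => by
    rw [abs_le]
    constructor <;> linarith [hk0 i z, hkκ i z, hmix0 w hw z, hmixκ w hw z]
  have hdiffm : Measurable fun z => k i z - ∑ j, w j * k j z := (hk i).sub (hmixm w)
  -- the first-order condition, along the segment from `w` to the vertex `i`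
  have key : ∀ s : ℝ, 0 < s → s ≤ 1 →
      ∫ z, (k i z - ∑ j, w j * k j z) * (1 / q w z) ∂M ≤ s * (κ * κ / (μ * μ)) := by
    intro s hs0 hs1
    set v : ι → ℝ := (1 - s) • w + s • Pi.single i 1 with hv
    have hvS : v ∈ stdSimplex ℝ ι :=
      convex_stdSimplex ℝ ι hw (single_mem_stdSimplex ℝ i) (by linarith) hs0.le (by ring)
    have hmixv : ∀ z, ∑ j, v j * k j z =
        (∑ j, w j * k j z) + s * (k i z - ∑ j, w j * k j z) := fun z => by
      simp only [hv, Pi.add_apply, Pi.smul_apply, smul_eq_mul, add_mul, Finset.sum_add_distrib]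
      simp only [mul_assoc, ← Finset.mul_sum, Pi.single_apply, ite_mul, one_mul, zero_mul,
        Finset.sum_ite_eq', Finset.mem_univ, if_true]
      ring
    have hqv : ∀ z, q v z - q w z = (1 - μ) * s * (k i z - ∑ j, w j * k j z) := fun z => by
      simp only [hq, hmixv]; ring
    have hle : ∫ z, Real.log (q v z) ∂M ≤ ∫ z, Real.log (q w z) ∂M := hmax hvS
    have hlogi : ∀ u ∈ stdSimplex ℝ ι, Integrable (fun z => Real.log (q u z)) M := fun u hu =>
      integrable_of_abs_le (Real.measurable_log.comp (hqm u)) (hlogb u hu)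
    -- Concavity of the logarithm in the form `log q_v - log q_w ≥ 1 - q_w / q_v`, integrated;
    -- maximality of `w` makes the right-hand integral nonpositive.
    have h1 : ∫ z, (1 - μ) * s * ((k i z - ∑ j, w j * k j z) * (1 / q v z)) ∂M ≤ 0 := by
      calc _ ≤ ∫ z, (Real.log (q v z) - Real.log (q w z)) ∂M := by
            refine integral_mono ((hint v hvS _ hdiffm hdiffκ).const_mul _)
              ((hlogi v hvS).sub (hlogi w hw)) fun z => ?_
            have hqv0 := hμ0.trans_le (hqμ v hvS z)
            have hqw0 := hμ0.trans_le (hqμ w hw z)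
            have := Real.log_le_sub_one_of_pos (div_pos hqw0 hqv0)
            rw [Real.log_div hqw0.ne' hqv0.ne'] at this
            have e : (1 - μ) * s * ((k i z - ∑ j, w j * k j z) * (1 / q v z)) =
                1 - q w z / q v z := by
              rw [← mul_assoc, ← hqv]
              field_simp
            simp only [e]
            linarith
        _ ≤ 0 := by
            rw [integral_sub (hlogi v hvS) (hlogi w hw)]
            linarith
    rw [integral_const_mul] at h1
    have h2 : ∫ z, (k i z - ∑ j, w j * k j z) * (1 / q v z) ∂M ≤ 0 := by
      by_contra h3
      have := mul_pos (mul_pos (by linarith : 0 < 1 - μ) hs0) (not_le.1 h3)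
      linarith
    -- The inequality has `q_v` in the denominator; replacing it by `q_w` costs a term of order `s`,
    -- since both densities are at least `μ`.
    have h3 : ∫ z, ((k i z - ∑ j, w j * k j z) * (1 / q w z) -
        (k i z - ∑ j, w j * k j z) * (1 / q v z)) ∂M ≤ ∫ _, s * (κ * κ / (μ * μ)) ∂M := by
      refine integral_mono ((hint w hw _ hdiffm hdiffκ).sub (hint v hvS _ hdiffm hdiffκ))
        (integrable_const _) fun z => ?_
      have hqv0 := hqμ v hvS z
      have hqw0 := hqμ w hw z
      have hqv1 := hμ0.trans_le hqv0
      have hqw1 := hμ0.trans_le hqw0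
      have e : (k i z - ∑ j, w j * k j z) * (1 / q w z) -
          (k i z - ∑ j, w j * k j z) * (1 / q v z) =
          ((1 - μ) * s * ((k i z - ∑ j, w j * k j z) * (k i z - ∑ j, w j * k j z))) /
            (q w z * q v z) := by
        have := hqv z
        field_simp
        rw [this]
        ring
      simp only [e]
      have hsq : (k i z - ∑ j, w j * k j z) * (k i z - ∑ j, w j * k j z) ≤ κ * κ := by
        rw [← abs_mul_abs_self]
        exact mul_self_le_mul_self (abs_nonneg _) (hdiffκ z)
      rw [← mul_div_assoc]
      refine div_le_div₀ (by positivity) ?_ (by positivity)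
        (mul_le_mul hqw0 hqv0 hμ0.le hqw1.le)
      have : (1 - μ) * s ≤ s := by nlinarith
      exact mul_le_mul this hsq (mul_self_nonneg _) hs0.le
    rw [integral_sub (hint w hw _ hdiffm hdiffκ) (hint v hvS _ hdiffm hdiffκ)] at h3
    simp only [integral_const, probReal_univ, smul_eq_mul, one_mul] at h3
    linarith
  -- Letting `s` tend to zero. If the integral `I` were positive, `s = min 1 (I / (2 (B + 1)))`
  -- would contradict `key`.
  have hfin : ∫ z, (k i z - ∑ j, w j * k j z) * (1 / q w z) ∂M ≤ 0 := by
    by_contra hcon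
    push Not at hcon
    set I := ∫ z, (k i z - ∑ j, w j * k j z) * (1 / q w z) ∂M
    set B := κ * κ / (μ * μ) with hB
    have hB0 : 0 ≤ B := by positivity
    have := key (min 1 (I / (2 * (B + 1)))) (by positivity) (min_le_left _ _)
    have h2 : min 1 (I / (2 * (B + 1))) * B ≤ I / (2 * (B + 1)) * B :=
      mul_le_mul_of_nonneg_right (min_le_right _ _) hB0
    have h3 : I / (2 * (B + 1)) * B < I := by
      rw [div_mul_eq_mul_div, div_lt_iff₀ (by positivity)]
      nlinarith
    linarith
  have hki : ∀ z, |k i z| ≤ κ := fun z => by rw [abs_of_nonneg (hk0 i z)]; exact hkκ i z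
  have hmi : ∀ z, |∑ j, w j * k j z| ≤ κ := fun z => by
    rw [abs_of_nonneg (hmix0 w hw z)]; exact hmixκ w hw z
  simp only [sub_mul] at hfin
  rw [integral_sub (hint w hw _ (hk i) hki) (hint w hw _ (hmixm w) hmi)] at hfin
  linarith

end Optimization

/-! ### Packing numbers -/

section Packing

variable {A : Type*} [MetricSpace A] {δ : ℝ} {S : Set A}

theorem bddAbove_packing (hS : S.Finite) : BddAbove {n : ℕ | ∃ F : Finset A, (F : Set A) ⊆ S ∧
    (F : Set A).Pairwise (fun a b => δ ≤ dist a b) ∧ F.card = n} := by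
  refine ⟨hS.toFinset.card, ?_⟩
  rintro n ⟨F, hF, -, rfl⟩
  exact Finset.card_le_card fun a ha => hS.mem_toFinset.2 (hF ha)

theorem card_le_packingNumber (hS : S.Finite) {F : Finset A} (hF : (F : Set A) ⊆ S)
    (hδ : (F : Set A).Pairwise (fun a b => δ ≤ dist a b)) : F.card ≤ packingNumber δ S :=
  le_csSup (bddAbove_packing hS) ⟨F, hF, hδ, rfl⟩

theorem exists_card_eq_packingNumber (hS : S.Finite) : ∃ F : Finset A, (F : Set A) ⊆ S ∧
    (F : Set A).Pairwise (fun a b => δ ≤ dist a b) ∧ F.card = packingNumber δ S :=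
  by
  have hne : {n : ℕ | ∃ F : Finset A, (F : Set A) ⊆ S ∧
      (F : Set A).Pairwise (fun a b => δ ≤ dist a b) ∧ F.card = n}.Nonempty :=
    ⟨0, ∅, by simp⟩
  exact Nat.sSup_mem hne (bddAbove_packing hS)

theorem one_le_packingNumber (hS : S.Finite) (hne : S.Nonempty) : 1 ≤ packingNumber δ S := by
  obtain ⟨a, ha⟩ := hne
  simpa using card_le_packingNumber (δ := δ) hS (F := {a}) (by simpa using ha) (by simp)

/-- A largest packing is a covering. -/
theorem exists_packing_covering (hδ : 0 < δ) (hS : S.Finite) : ∃ F : Finset A, (F : Set A) ⊆ S ∧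
    F.card = packingNumber δ S ∧ ∀ a ∈ S, ∃ b ∈ F, dist a b < δ := by
  classical
  obtain ⟨F, hF, hp, hc⟩ := exists_card_eq_packingNumber (δ := δ) hS
  refine ⟨F, hF, hc, fun a ha => ?_⟩
  by_contra! hcon
  have haF : a ∉ F := fun h => by
    have := hcon a h
    rw [dist_self] at this
    linarith
  -- An uncovered point could be added to the packing, against maximality.
  have := card_le_packingNumber (δ := δ) hS (F := insert a F)
    (by simpa [Set.insert_subset_iff] using ⟨ha, hF⟩) (by
      rw [Finset.coe_insert]
      refine hp.insert fun b hb _ => ⟨hcon b hb, ?_⟩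
      rw [dist_comm]
      exact hcon b hb)
  rw [Finset.card_insert_of_notMem haF] at this
  omega

variable {X : Type*} {N : Finset (X → A)}

theorem finite_image_eval (N : Finset (X → A)) (x : X) :
    ((fun π : X → A => π x) '' (N : Set (X → A))).Finite :=
  N.finite_toSet.image _

theorem packingNumber_image_le (N : Finset (X → A)) (x : X) :
    packingNumber δ ((fun π : X → A => π x) '' (N : Set (X → A))) ≤ N.card := by
  classical
  obtain ⟨F, hF, -, hc⟩ := exists_card_eq_packingNumber (δ := δ) (finite_image_eval N x)
  rw [← hc]
  refine (Finset.card_le_card (t := N.image fun π => π x) fun a ha => ?_).trans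
    Finset.card_image_le
  obtain ⟨π, hπ, rfl⟩ := hF ha
  exact Finset.mem_image_of_mem _ hπ

/-- Separated points are replaced by separated policies: one policy is chosen for each point, and
conversely `δ > 0` forces separated policies to take distinct values. The right side ranges over
finitely many subsets of policies independent of `x`, which is what measurability in `x` needs. -/
theorem le_packingNumber_image_iff (hδ : 0 < δ) (x : X) (n : ℕ) :
    n ≤ packingNumber δ ((fun π : X → A => π x) '' (N : Set (X → A))) ↔
      ∃ G ∈ N.powerset, n ≤ G.card ∧ ∀ π ∈ G, ∀ π' ∈ G, π ≠ π' → δ ≤ dist (π x) (π' x) := by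
  classical
  constructor
  · intro hn
    obtain ⟨F, hF, hp, hc⟩ := exists_card_eq_packingNumber (δ := δ) (finite_image_eval N x)
    choose g hgN hgx using fun a : F => hF a.2
    have hinj : Function.Injective g := fun a b hab => by
      have h1 := hgx a
      have h2 := hgx b
      simp only at h1 h2
      exact Subtype.ext (by rw [← h1, ← h2, hab])
    refine ⟨F.attach.image g, ?_, ?_, ?_⟩
    · rw [Finset.mem_powerset, Finset.image_subset_iff]
      exact fun a _ => hgN a
    · rw [Finset.card_image_of_injective _ hinj, Finset.card_attach, hc]
      exact hn
    · simp only [Finset.mem_image, Finset.mem_attach, true_and, forall_exists_index,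
        forall_apply_eq_imp_iff]
      intro a b hab
      have h1 := hgx a
      have h2 := hgx b
      simp only at h1 h2
      rw [h1, h2]
      exact hp a.2 b.2 fun h => hab (by rw [Subtype.ext h])
  · rintro ⟨G, hG, hn, hp⟩
    have hinj : Set.InjOn (fun π : X → A => π x) G := fun π hπ π' hπ' hab => by
      by_contra hne
      have := hp π hπ π' hπ' hne
      simp only at hab
      rw [hab, dist_self] at this
      linarith
    rw [← Finset.card_image_of_injOn hinj] at hn
    refine hn.trans (card_le_packingNumber (finite_image_eval N x) ?_ ?_)
    · rw [Finset.coe_image]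
      exact Set.image_mono (by simpa using hG)
    · rw [Finset.coe_image]
      rintro _ ⟨π, hπ, rfl⟩ _ ⟨π', hπ', rfl⟩ hne
      exact hp π hπ π' hπ' fun h => hne (by rw [h])

theorem measurable_packingNumber_image [MeasurableSpace X] [MeasurableSpace A] [BorelSpace A]
    [SecondCountableTopology A] (hδ : 0 < δ) (hN : ∀ π ∈ N, Measurable π) :
    Measurable fun x => packingNumber δ ((fun π : X → A => π x) '' (N : Set (X → A))) := by
  refine measurable_of_Ici fun n => ?_
  have : (fun x => packingNumber δ ((fun π : X → A => π x) '' (N : Set (X → A)))) ⁻¹' Set.Ici n =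
      ⋃ G ∈ N.powerset, {x | n ≤ G.card ∧
        ∀ π ∈ G, ∀ π' ∈ G, π ≠ π' → δ ≤ dist (π x) (π' x)} := by
    ext x
    simp only [Set.mem_preimage, Set.mem_Ici, le_packingNumber_image_iff hδ, Set.mem_iUnion,
      Set.mem_ofPred_eq, exists_prop]
  rw [this]
  refine Finset.measurableSet_biUnion _ fun G hG => (MeasurableSet.const _).inter ?_
  rw [Finset.mem_powerset] at hG
  have : {x | ∀ π ∈ G, ∀ π' ∈ G, π ≠ π' → δ ≤ dist (π x) (π' x)} =
      ⋂ π ∈ G, ⋂ π' ∈ G, ⋂ _ : π ≠ π', {x | δ ≤ dist (π x) (π' x)} := by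
    ext x; simp
  change MeasurableSet {x | ∀ π ∈ G, ∀ π' ∈ G, π ≠ π' → δ ≤ dist (π x) (π' x)}
  rw [this]
  refine Finset.measurableSet_biInter _ fun π hπ => Finset.measurableSet_biInter _ fun π' hπ' =>
    MeasurableSet.iInter fun _ => ?_
  exact measurableSet_le measurable_const ((hN π (hG hπ)).dist (hN π' (hG hπ')))

end Packing

/-! ### Quantities of a policy set -/

section PolicySets

variable {X Y A : Type*} [MeasurableSpace X] [MeasurableSpace Y] [MetricSpace A]
  [MeasurableSpace A] [BorelSpace A] [SecondCountableTopology A]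
  {ν : Measure A} [IsProbabilityMeasure ν] {h κ α : ℝ} {S : Finset (X → A)}

theorem measurable_smooth_policy {π : X → A} (hπ : Measurable π) :
    Measurable fun p : X × A => smooth ν h (π p.1) p.2 :=
  measurable_smooth.comp ((hπ.comp measurable_fst).prodMk measurable_snd)

theorem measurableSet_union_balls (hS : ∀ π ∈ S, Measurable π) (h : ℝ) :
    MeasurableSet {p : X × A | p.2 ∈ ⋃ π ∈ S, Metric.closedBall (π p.1) h} := by
  have : {p : X × A | p.2 ∈ ⋃ π ∈ S, Metric.closedBall (π p.1) h} =
      ⋃ π ∈ S, {p : X × A | dist p.2 (π p.1) ≤ h} := by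
    ext p; simp
  rw [this]
  exact Finset.measurableSet_biUnion _ fun π hπ => measurableSet_le
    (measurable_snd.dist ((hS π hπ).comp measurable_fst)) measurable_const

theorem measurable_volume_union_balls (hS : ∀ π ∈ S, Measurable π) (h : ℝ) :
    Measurable fun x => ν.real (⋃ π ∈ S, Metric.closedBall (π x) h) :=
  (measurable_measure_prodMk_left (ν := ν) (measurableSet_union_balls hS h)).ennreal_toReal

/-- The union contains at least one ball. This lower bound later absorbs the rounding up of the
batch size. -/
theorem one_le_kappa_mul_charVolume {c : Config X A} [IsProbabilityMeasure c.base]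
    [IsProbabilityMeasure c.ctxLaw] (hb : BallBounds c.base c.bandwidth κ α)
    (hS : ∀ π ∈ S, Measurable π) (hne : S.Nonempty) : 1 ≤ κ * c.charVolume S := by
  obtain ⟨π, hπ⟩ := hne
  unfold Config.charVolume
  rw [← integral_const_mul]
  calc (1 : ℝ) = ∫ _, 1 ∂c.ctxLaw := by simp
    _ ≤ _ := by
      refine integral_mono (integrable_const _) ((integrable_of_abs_le (C := 1)
        (measurable_volume_union_balls hS _) fun x => ?_).const_mul _) fun x => ?_
      · rw [abs_of_nonneg measureReal_nonneg]
        exact measureReal_le_one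
      · refine (hb.one_le (π x)).trans (mul_le_mul_of_nonneg_left ?_ (hb.kappa_pos (π x)).le)
        exact measureReal_mono (Set.subset_biUnion_of_mem
          (u := fun π : X → A => Metric.closedBall (π x) c.bandwidth) hπ) (measure_ne_top _ _)

/-- A largest `h`-packing of the values of `N` covers them at distance `h`, so balls of radius `2 h`
about its points cover the union; each has volume at most `α / κ`. -/
theorem kappa_mul_volume_union_balls_le (hb : BallBounds ν h κ α) {N : Finset (X → A)}
    (hSN : S ⊆ N) (hne : N.Nonempty) (x : X) :
    κ * ν.real (⋃ π ∈ S, Metric.closedBall (π x) h) ≤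
      α * packingNumber h ((fun π : X → A => π x) '' (N : Set (X → A))) := by
  obtain ⟨F, hF, hc, hcov⟩ := exists_packing_covering hb.radius_pos (finite_image_eval N x)
  obtain ⟨π₀, -⟩ := hne
  have hκ := hb.kappa_pos (π₀ x)
  have hsub : (⋃ π ∈ S, Metric.closedBall (π x) h) ⊆ ⋃ b ∈ F, Metric.closedBall b (2 * h) := by
    refine Set.iUnion₂_subset fun π hπ a ha => ?_
    obtain ⟨b, hbF, hdb⟩ := hcov (π x) ⟨π, hSN hπ, rfl⟩
    refine Set.mem_biUnion hbF ?_
    rw [Metric.mem_closedBall] at ha ⊢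
    linarith [dist_triangle a (π x) b]
  calc κ * ν.real (⋃ π ∈ S, Metric.closedBall (π x) h)
      ≤ κ * ∑ b ∈ F, ν.real (Metric.closedBall b (2 * h)) :=
        mul_le_mul_of_nonneg_left ((measureReal_mono hsub (measure_ne_top _ _)).trans
          (measureReal_biUnion_finset_le _ _)) hκ.le
    _ = ∑ b ∈ F, κ * ν.real (Metric.closedBall b (2 * h)) := Finset.mul_sum _ _ _
    _ ≤ ∑ _b ∈ F, α := Finset.sum_le_sum fun b _ => hb.double_le b
    _ = _ := by rw [Finset.sum_const, hc, nsmul_eq_mul, mul_comm]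

variable {D : Problem X Y A} {Pol : Finset (X → A)}

theorem exists_coe_eq_nearOptimal (ν : Measure A) (h : ℝ) (D : Problem X Y A)
    (Pol : Finset (X → A)) (ε : ℝ) :
    ∃ N : Finset (X → A), (N : Set (X → A)) = nearOptimal ν h D Pol ε ∧ N ⊆ Pol := by
  classical
  refine ⟨Pol.filter fun π => smoothedLoss ν h D π ≤ bench ν h D Pol + ε, ?_,
    Finset.filter_subset _ _⟩
  ext π
  simp [nearOptimal]

theorem bench_le_smoothedLoss {π : X → A} (hπ : π ∈ Pol) :
    bench ν h D Pol ≤ smoothedLoss ν h D π :=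
  ciInf_le (Set.finite_range fun π : {π : X → A // π ∈ Pol} => smoothedLoss ν h D π.1).bddBelow
    ⟨π, hπ⟩

theorem exists_smoothedLoss_eq_bench (hne : Pol.Nonempty) :
    ∃ π ∈ Pol, smoothedLoss ν h D π = bench ν h D Pol := by
  have : Nonempty {π : X → A // π ∈ Pol} := hne.to_subtype
  obtain ⟨π, hπ⟩ := exists_eq_ciInf_of_finite
    (f := fun π : {π : X → A // π ∈ Pol} => smoothedLoss ν h D π.1)
  exact ⟨π.1, π.2, hπ⟩

theorem nonempty_of_coe_eq_nearOptimal {ε : ℝ} (hε : 0 ≤ ε) (hne : Pol.Nonempty)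
    {N : Finset (X → A)} (hN : (N : Set (X → A)) = nearOptimal ν h D Pol ε) : N.Nonempty := by
  obtain ⟨π, hπ, he⟩ := exists_smoothedLoss_eq_bench (ν := ν) (h := h) (D := D) hne
  refine ⟨π, ?_⟩
  rw [← Finset.mem_coe, hN]
  exact ⟨hπ, by rw [he]; linarith⟩

theorem integrable_packingNumber {ρ : Measure X} [IsProbabilityMeasure ρ] {δ : ℝ} (hδ : 0 < δ)
    {N : Finset (X → A)} (hN : ∀ π ∈ N, Measurable π) :
    Integrable (fun x =>
      (packingNumber δ ((fun π : X → A => π x) '' (N : Set (X → A))) : ℝ)) ρ := by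
  refine integrable_of_abs_le (C := N.card)
    ((measurable_from_top (f := fun n : ℕ => (n : ℝ))).comp
      (measurable_packingNumber_image hδ hN)) fun x => ?_
  rw [abs_of_nonneg (Nat.cast_nonneg _)]
  exact_mod_cast packingNumber_image_le N x

theorem expectedPacking_le_card (hPol : ∀ π ∈ Pol, Measurable π) (hh : 0 < h) (ε : ℝ) :
    expectedPacking ν h D Pol ε h ≤ Pol.card := by
  have := D.isProb
  obtain ⟨N, hN, hNP⟩ := exists_coe_eq_nearOptimal ν h D Pol ε
  unfold expectedPacking
  rw [← hN]
  calc _ ≤ ∫ _, (Pol.card : ℝ) ∂D.law.fst := by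
        refine integral_mono (integrable_packingNumber hh fun π hπ => hPol π (hNP hπ))
          (integrable_const _) fun x => ?_
        exact Nat.cast_le.2 ((packingNumber_image_le N x).trans (Finset.card_le_card hNP))
    _ = _ := by simp

theorem one_le_expectedPacking (hPol : ∀ π ∈ Pol, Measurable π) (hh : 0 < h)
    (hne : Pol.Nonempty) {ε : ℝ} (hε : 0 ≤ ε) : 1 ≤ expectedPacking ν h D Pol ε h := by
  have := D.isProb
  obtain ⟨N, hN, hNP⟩ := exists_coe_eq_nearOptimal ν h D Pol ε
  have hNne := nonempty_of_coe_eq_nearOptimal hε hne hN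
  unfold expectedPacking
  rw [← hN]
  calc (1 : ℝ) = ∫ _, 1 ∂D.law.fst := by simp
    _ ≤ _ := by
        refine integral_mono (integrable_const _)
          (integrable_packingNumber hh fun π hπ => hPol π (hNP hπ)) fun x => ?_
        exact Nat.one_le_cast.2 (one_le_packingNumber (finite_image_eval N x)
          (Set.Nonempty.image _ (by simpa using hNne)))

theorem kappa_mul_charVolume_le {c : Config X A} [IsProbabilityMeasure c.base]
    (hc : c.ctxLaw = D.law.fst) (hb : BallBounds c.base c.bandwidth κ α)
    (hPol : ∀ π ∈ Pol, Measurable π) (hne : Pol.Nonempty) {ε : ℝ} (hε : 0 ≤ ε)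
    (hS : ∀ π ∈ S, π ∈ nearOptimal c.base c.bandwidth D Pol ε) :
    κ * c.charVolume S ≤ α * expectedPacking c.base c.bandwidth D Pol ε c.bandwidth := by
  have := D.isProb
  obtain ⟨N, hN, hNP⟩ := exists_coe_eq_nearOptimal c.base c.bandwidth D Pol ε
  have hNne := nonempty_of_coe_eq_nearOptimal hε hne hN
  have hSN : S ⊆ N := fun π hπ => by
    have := hS π hπ
    rwa [← hN] at this
  unfold expectedPacking Config.charVolume
  rw [← hN, hc, ← integral_const_mul, ← integral_const_mul]
  refine integral_mono ((integrable_of_abs_le (C := 1) (measurable_volume_union_balls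
      (fun π hπ => hPol π (hNP (hSN hπ))) _) fun x => ?_).const_mul _)
    ((integrable_packingNumber hb.radius_pos fun π hπ => hPol π (hNP hπ)).const_mul _) fun x => ?_
  · rw [abs_of_nonneg measureReal_nonneg]
    exact measureReal_le_one
  · exact kappa_mul_volume_union_balls_le hb hSN hNne x

/-- The real supremum dominates its terms only if the family is bounded above; `|Π| / ε₀` is a
bound. -/
theorem expectedPacking_div_le_smoothingCoeff (hPol : ∀ π ∈ Pol, Measurable π) (hh : 0 < h)
    {ε₀ ε : ℝ} (h0 : 0 < ε₀) (hε : ε₀ ≤ ε) :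
    expectedPacking ν h D Pol (12 * ε) h / ε ≤ smoothingCoeff ν h D Pol ε₀ := by
  refine le_ciSup (f := fun ε : Set.Ici ε₀ =>
    expectedPacking ν h D Pol (12 * (ε : ℝ)) h / (ε : ℝ)) ⟨Pol.card / ε₀, ?_⟩ ⟨ε, hε⟩
  rintro _ ⟨e, rfl⟩
  exact div_le_div₀ (Nat.cast_nonneg _) (expectedPacking_le_card hPol hh _) h0 e.2

/-! ### The action density -/

section Density

variable {c : Config X A} {Q : (X → A) → ℝ} {μ : ℝ}

theorem measurable_actionDensity [IsProbabilityMeasure c.base] (hS : ∀ π ∈ S, Measurable π) :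
    Measurable fun p : X × A => c.actionDensity μ S Q p.1 p.2 := by
  unfold Config.actionDensity
  refine measurable_const.add (measurable_const.mul (Finset.measurable_sum _ fun π hπ => ?_))
  exact measurable_const.mul (measurable_smooth_policy (hS π hπ))

theorem le_actionDensity (hQ : IsDistributionOn S Q) (hμ : μ ≤ 1) (x : X) (a : A) :
    μ ≤ c.actionDensity μ S Q x a := by
  have : 0 ≤ (1 - μ) * ∑ π ∈ S, Q π * smooth c.base c.bandwidth (π x) a :=
    mul_nonneg (by linarith) (Finset.sum_nonneg fun π hπ =>
      mul_nonneg (hQ.1 π hπ) (smooth_nonneg _ _ _ _))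
  unfold Config.actionDensity
  linarith

theorem actionDensity_le (hb : BallBounds c.base c.bandwidth κ α) (hQ : IsDistributionOn S Q)
    (hμ0 : 0 ≤ μ) (hμ : μ ≤ 1) (x : X) (a : A) :
    c.actionDensity μ S Q x a ≤ 1 + κ := by
  have h1 : ∑ π ∈ S, Q π * smooth c.base c.bandwidth (π x) a ≤ κ := by
    calc _ ≤ ∑ π ∈ S, Q π * κ :=
          Finset.sum_le_sum fun π hπ => mul_le_mul_of_nonneg_left (smooth_le hb _ _) (hQ.1 π hπ)
      _ = κ := by rw [← Finset.sum_mul, hQ.2, one_mul]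
  have h2 := hb.kappa_pos a
  unfold Config.actionDensity
  nlinarith

/-- Fubini, to write the objective as a single integral over the product space on which
`exists_mixture` is applied. -/
theorem variance_eq [IsProbabilityMeasure c.base] [IsProbabilityMeasure c.ctxLaw]
    (hb : BallBounds c.base c.bandwidth κ α)
    (hS : ∀ π ∈ S, Measurable π) (hQ : IsDistributionOn S Q) (hμ0 : 0 < μ) (hμ : μ ≤ 1)
    {π : X → A} (hπ : Measurable π) :
    c.variance μ S Q π = ∫ p, smooth c.base c.bandwidth (π p.1) p.2 *
      (1 / c.actionDensity μ S Q p.1 p.2) ∂(c.ctxLaw.prod c.base) := by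
  unfold Config.variance
  refine (integral_prod (f := fun p : X × A => smooth c.base c.bandwidth (π p.1) p.2 *
      (1 / c.actionDensity μ S Q p.1 p.2)) (integrable_of_abs_le (C := κ * (1 / μ))
      ((measurable_smooth_policy hπ).mul ((measurable_actionDensity hS).const_div 1))
      fun p => ?_)).symm
  have hq := le_actionDensity (c := c) hQ hμ p.1 p.2
  rw [abs_mul, abs_of_pos (one_div_pos.2 (hμ0.trans_le hq))]
  exact mul_le_mul (abs_smooth_le hb _ _) (one_div_le_one_div_of_le hμ0 hq)
    (one_div_pos.2 (hμ0.trans_le hq)).le (hb.kappa_pos p.2).le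

/-- The log-optimal mixture is a competitor for `Q`. Its largest variance is at most the integral of
`mix / q`, which is at most `2` on the union of the balls and vanishes outside. -/
theorem variance_le_of_isOptimal [IsProbabilityMeasure c.base] [IsProbabilityMeasure c.ctxLaw]
    (hb : BallBounds c.base c.bandwidth κ α) (hS : ∀ π ∈ S, Measurable π)
    (hQ : c.IsOptimal μ S Q) (hμ0 : 0 < μ) (hμ : μ ≤ 1 / 2) {π : X → A} (hπ : π ∈ S) :
    c.variance μ S Q π ≤ 2 * c.charVolume S := by
  classical
  have hne : Nonempty {π : X → A // π ∈ S} := ⟨⟨π, hπ⟩⟩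
  set M := c.ctxLaw.prod c.base with hM
  obtain ⟨w, hw, hopt⟩ := exists_mixture (M := M)
    (k := fun (i : {π : X → A // π ∈ S}) (p : X × A) => smooth c.base c.bandwidth (i.1 p.1) p.2)
    (κ := κ) (μ := μ) (fun i => measurable_smooth_policy (hS i.1 i.2))
    (fun i p => smooth_nonneg _ _ _ _) (fun i p => smooth_le hb _ _) hμ0 (by linarith)
  -- The weights live on the subtype of active policies and are extended by zero.
  set Q' : (X → A) → ℝ := fun π => if h : π ∈ S then w ⟨π, h⟩ else 0 with hQ'
  have hsum : ∀ f : (X → A) → ℝ, ∑ π ∈ S, Q' π * f π = ∑ i : {π : X → A // π ∈ S}, w i * f i.1 := by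
    intro f
    rw [← Finset.sum_coe_sort S]
    refine Finset.sum_congr rfl fun i _ => ?_
    simp [hQ', i.2]
  have hQd : IsDistributionOn S Q' := by
    refine ⟨fun π hπ => ?_, ?_⟩
    · simp only [hQ', hπ, dif_pos]
      exact hw.1 _
    · have := hsum fun _ => 1
      simp only [mul_one] at this
      rw [this, hw.2]
  have hq : ∀ p : X × A, c.actionDensity μ S Q' p.1 p.2 = μ + (1 - μ) *
      ∑ j : {π : X → A // π ∈ S}, w j * smooth c.base c.bandwidth (j.1 p.1) p.2 := fun p => by
    unfold Config.actionDensity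
    rw [hsum fun π => smooth c.base c.bandwidth (π p.1) p.2]
  set U : Set (X × A) := {p : X × A | p.2 ∈ ⋃ π ∈ S, Metric.closedBall (π p.1) c.bandwidth} with hU
  have hUm : MeasurableSet U := measurableSet_union_balls hS _
  have hvol : ∫ p, U.indicator (fun _ => (2 : ℝ)) p ∂M = 2 * c.charVolume S := by
    rw [integral_indicator hUm, integral_const, smul_eq_mul, mul_comm,
      measureReal_restrict_apply_univ, hM, measureReal_def, Measure.prod_apply hUm]
    congr 1
    unfold Config.charVolume
    rw [integral_eq_lintegral_of_nonneg_ae (Filter.Eventually.of_forall fun x => measureReal_nonneg)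
      (measurable_volume_union_balls hS _).aestronglyMeasurable]
    congr 1
    refine lintegral_congr fun x => ?_
    rw [ofReal_measureReal (measure_ne_top _ _)]
    rfl
  have hmix : ∫ p, (∑ j : {π : X → A // π ∈ S}, w j * smooth c.base c.bandwidth (j.1 p.1) p.2) *
      (1 / (μ + (1 - μ) *
        ∑ j : {π : X → A // π ∈ S}, w j * smooth c.base c.bandwidth (j.1 p.1) p.2)) ∂M ≤
      2 * c.charVolume S := by
    rw [← hvol]
    refine integral_mono_of_nonneg (Filter.Eventually.of_forall fun p => ?_)
      ((integrable_const _).indicator hUm) (Filter.Eventually.of_forall fun p => ?_)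
    · have : 0 ≤ ∑ j : {π : X → A // π ∈ S}, w j * smooth c.base c.bandwidth (j.1 p.1) p.2 :=
        Finset.sum_nonneg fun j _ => mul_nonneg (hw.1 j) (smooth_nonneg _ _ _ _)
      have h1 : (0 : ℝ) ≤ 1 - μ := by linarith
      simp only [Pi.zero_apply]
      positivity
    · have hnn : 0 ≤ ∑ j : {π : X → A // π ∈ S}, w j * smooth c.base c.bandwidth (j.1 p.1) p.2 :=
        Finset.sum_nonneg fun j _ => mul_nonneg (hw.1 j) (smooth_nonneg _ _ _ _)
      by_cases hp : p ∈ U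
      · rw [Set.indicator_of_mem hp]
        simp only
        have h1 : 0 < μ + (1 - μ) *
            ∑ j : {π : X → A // π ∈ S}, w j * smooth c.base c.bandwidth (j.1 p.1) p.2 := by
          have : (0 : ℝ) ≤ 1 - μ := by linarith
          positivity
        rw [mul_one_div, div_le_iff₀ h1]
        -- Here `μ ≤ 1/2` gives `mix ≤ 2 (1 - μ) mix ≤ 2 q`.
        nlinarith
      · rw [Set.indicator_of_notMem hp]
        have : ∑ j : {π : X → A // π ∈ S}, w j * smooth c.base c.bandwidth (j.1 p.1) p.2 = 0 := by
          refine Finset.sum_eq_zero fun j _ => ?_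
          have : p.2 ∉ Metric.closedBall (j.1 p.1) c.bandwidth := fun hmem =>
            hp (Set.mem_biUnion j.2 hmem)
          simp [smooth, Set.indicator_of_notMem this]
        simp only [this]
        simp
  calc c.variance μ S Q π
      ≤ ⨆ π : {π : X → A // π ∈ S}, c.variance μ S Q π.1 :=
        le_ciSup (f := fun π : {π : X → A // π ∈ S} => c.variance μ S Q π.1)
          (Set.finite_range _).bddAbove ⟨π, hπ⟩
    _ ≤ ⨆ π : {π : X → A // π ∈ S}, c.variance μ S Q' π.1 := hQ.2 Q' hQd
    _ ≤ 2 * c.charVolume S := ciSup_le fun i => by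
        rw [variance_eq hb hS hQd hμ0 (by linarith) (hS i.1 i.2)]
        simp only [hq]
        exact (hopt i).trans hmix

end Density

end PolicySets

/-! ### Medians -/

/-- If the median is far from `b`, then so are at least half of the values. -/
theorem le_two_mul_card_of_lt_abs_median_sub {k : ℕ} {v : Fin k → ℝ} {b r : ℝ}
    (h : r < |median v - b|) (hk : 0 < k) :
    k ≤ 2 * (Finset.univ.filter fun i => r < |v i - b|).card := by
  have hmono : Monotone (v ∘ Tuple.sort v) := Tuple.monotone_sort v
  have hmed : median v = (v (Tuple.sort v ⟨(k - 1) / 2, by omega⟩) +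
      v (Tuple.sort v ⟨k / 2, by omega⟩)) / 2 := by
    simp [median, hk]
  have hle : v (Tuple.sort v ⟨(k - 1) / 2, by omega⟩) ≤ v (Tuple.sort v ⟨k / 2, by omega⟩) :=
    hmono (by simp only [Fin.mk_le_mk]; omega)
  have hcard : ∀ J : Finset (Fin k), (∀ j ∈ J, r < |v (Tuple.sort v j) - b|) →
      J.card ≤ (Finset.univ.filter fun i => r < |v i - b|).card := fun J hJ => by
    refine Finset.card_le_card_of_injOn (Tuple.sort v) (fun j hj => ?_)
      (Tuple.sort v).injective.injOn
    simpa using hJ j hj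
  rcases lt_abs.1 h with h1 | h1
  -- The median is at most the upper middle value, so the `k - k/2` order statistics from there on
  -- exceed `b + r`. The other case uses the `(k - 1)/2 + 1` smallest ones.
  · have := hcard (Finset.Ici ⟨k / 2, by omega⟩) fun j hj => by
      have : v (Tuple.sort v ⟨k / 2, by omega⟩) ≤ v (Tuple.sort v j) :=
        hmono (Finset.mem_Ici.1 hj)
      rw [lt_abs]
      left; linarith
    rw [Fin.card_Ici] at this
    simp only at this
    omega
  · have := hcard (Finset.Iic ⟨(k - 1) / 2, by omega⟩) fun j hj => by
      have : v (Tuple.sort v j) ≤ v (Tuple.sort v ⟨(k - 1) / 2, by omega⟩) :=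
        hmono (Finset.mem_Iic.1 hj)
      rw [lt_abs]
      right; linarith
    rw [Fin.card_Iic] at this
    simp only at this
    omega

/-! ### The course of the epochs -/

theorem radius_pos (m : ℕ) : 0 < radius m := by unfold radius; positivity

theorem exploreProb_pos (m : ℕ) : 0 < exploreProb m := lt_min (by norm_num) (radius_pos m)

theorem exploreProb_le_half (m : ℕ) : exploreProb m ≤ 1 / 2 := min_le_left _ _

theorem exploreProb_le_radius (m : ℕ) : exploreProb m ≤ radius m := min_le_right _ _

theorem radius_succ (m : ℕ) : radius m = 2 * radius (m + 1) := by
  unfold radius; rw [pow_succ]; ring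

namespace Config

variable {X A : Type*} [MeasurableSpace X] [MetricSpace A] [MeasurableSpace A]
  (c : Config X A) (obs : ℕ → Round X A)

/-- The length of the epoch that is under way in the state `s`. -/
def stateLength (s : EpochState X A) : ℕ := c.epochLength s.epoch s.active

theorem survivors_subset (s : EpochState X A) : c.survivors obs s ⊆ s.active :=
  Finset.filter_subset _ _

theorem state_succ_of_lt {t : ℕ}
    (h : t + 1 < (c.state obs t).start + c.stateLength (c.state obs t)) :
    c.state obs (t + 1) = c.state obs t := by
  rw [state]; exact if_pos h

theorem state_succ_of_le {t : ℕ}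
    (h : (c.state obs t).start + c.stateLength (c.state obs t) ≤ t + 1) :
    c.state obs (t + 1) =
      ⟨(c.state obs t).epoch + 1, t + 1, c.survivors obs (c.state obs t)⟩ := by
  rw [state]; exact if_neg (not_lt.2 h)

theorem state_succ_cases (t : ℕ) :
    (t + 1 < (c.state obs t).start + c.stateLength (c.state obs t) ∧
      c.state obs (t + 1) = c.state obs t) ∨
    ((c.state obs t).start + c.stateLength (c.state obs t) ≤ t + 1 ∧ c.state obs (t + 1) =
      ⟨(c.state obs t).epoch + 1, t + 1, c.survivors obs (c.state obs t)⟩) := by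
  rcases lt_or_ge (t + 1) ((c.state obs t).start + c.stateLength (c.state obs t)) with h | h
  · exact Or.inl ⟨h, c.state_succ_of_lt obs h⟩
  · exact Or.inr ⟨h, c.state_succ_of_le obs h⟩

theorem state_active_subset (t : ℕ) : (c.state obs t).active ⊆ c.policies := by
  induction t with
  | zero => exact Finset.Subset.refl _
  | succ t ih =>
    rcases c.state_succ_cases obs t with ⟨-, h⟩ | ⟨-, h⟩ <;> rw [h]
    · exact ih
    · exact (c.survivors_subset obs _).trans ih

theorem state_start_le (t : ℕ) : (c.state obs t).start ≤ t := by
  induction t with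
  | zero => exact le_rfl
  | succ t ih =>
    rcases c.state_succ_cases obs t with ⟨-, h⟩ | ⟨-, h⟩ <;> rw [h]
    exact ih.trans (Nat.le_succ t)

theorem one_le_state_epoch (t : ℕ) : 1 ≤ (c.state obs t).epoch := by
  induction t with
  | zero => exact le_rfl
  | succ t ih =>
    rcases c.state_succ_cases obs t with ⟨-, h⟩ | ⟨-, h⟩ <;> rw [h]
    · exact ih
    · exact Nat.le_add_left _ _

theorem state_epoch_le (t : ℕ) : (c.state obs t).epoch ≤ t + 1 := by
  induction t with
  | zero => exact le_rfl
  | succ t ih =>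
    rcases c.state_succ_cases obs t with ⟨-, h⟩ | ⟨-, h⟩ <;> rw [h]
    · exact ih.trans (Nat.le_succ _)
    · exact Nat.succ_le_succ ih

/-- Without the assumption on the length it would fail: an epoch of length zero is still left only
after one round. -/
theorem lt_state_start_add (t : ℕ) (hlen : 1 ≤ c.stateLength (c.state obs t)) :
    t < (c.state obs t).start + c.stateLength (c.state obs t) := by
  cases t with
  | zero => omega
  | succ t =>
    rcases c.state_succ_cases obs t with ⟨hlt, h⟩ | ⟨-, h⟩
    · rw [h]; exact hlt
    · rw [h] at hlen ⊢
      simp only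
      omega

/-- Moves an event about the current epoch back to its first round, where it is measurable with
respect to the past of the whole epoch. -/
theorem state_start_eq (t : ℕ) : c.state obs (c.state obs t).start = c.state obs t := by
  induction t with
  | zero => rfl
  | succ t ih =>
    rcases c.state_succ_cases obs t with ⟨-, h⟩ | ⟨-, h⟩
    · rw [h]; exact ih
    · have : (c.state obs (t + 1)).start = t + 1 := by rw [h]
      rw [this]

theorem state_add_eq {t : ℕ} (hs : (c.state obs t).start = t) (j : ℕ)
    (hj : j < c.stateLength (c.state obs t)) : c.state obs (t + j) = c.state obs t := by
  induction j with
  | zero => rfl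
  | succ j ih =>
    have h := ih (by omega)
    rw [← h, ← add_assoc]
    refine c.state_succ_of_lt obs ?_
    rw [h, hs]
    omega

/-- The counter increases at every change of state, so it identifies the state along a run. -/
theorem state_epoch_mono_and_eq {t t' : ℕ} (ht : t ≤ t') :
    (c.state obs t).epoch ≤ (c.state obs t').epoch ∧
      ((c.state obs t).epoch = (c.state obs t').epoch → c.state obs t = c.state obs t') := by
  induction t', ht using Nat.le_induction with
  | base => exact ⟨le_rfl, fun _ => rfl⟩
  | succ t' _ ih =>
    rcases c.state_succ_cases obs t' with ⟨-, h⟩ | ⟨-, h⟩ <;> rw [h]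
    · exact ih
    · simp only
      exact ⟨by omega, fun h => by omega⟩

theorem state_eq_of_epoch_eq {t t' : ℕ} (h : (c.state obs t).epoch = (c.state obs t').epoch) :
    c.state obs t = c.state obs t' := by
  rcases le_total t t' with ht | ht
  · exact (c.state_epoch_mono_and_eq obs ht).2 h
  · exact ((c.state_epoch_mono_and_eq obs ht).2 h.symm).symm

/-- An epoch of length at most `b` contributes at most `b` rounds. -/
theorem card_filter_epoch_le {T m : ℕ} {b : ℝ} (hb0 : 0 ≤ b)
    (hlen : ∀ t < T, 1 ≤ c.stateLength (c.state obs t))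
    (hb : ∀ t < T, (c.state obs t).epoch = m → (c.stateLength (c.state obs t) : ℝ) ≤ b) :
    (((Finset.range T).filter fun t => (c.state obs t).epoch = m).card : ℝ) ≤ b := by
  rcases ((Finset.range T).filter fun t => (c.state obs t).epoch = m).eq_empty_or_nonempty
    with he | ⟨t', ht'⟩
  · rw [he]; simpa using hb0
  · rw [Finset.mem_filter, Finset.mem_range] at ht'
    refine le_trans ?_ (hb t' ht'.1 ht'.2)
    have : ((Finset.range T).filter fun t => (c.state obs t).epoch = m) ⊆
        Finset.Ico (c.state obs t').start
          ((c.state obs t').start + c.stateLength (c.state obs t')) := by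
      intro t ht
      rw [Finset.mem_filter, Finset.mem_range] at ht
      have he := c.state_eq_of_epoch_eq obs (ht.2.trans ht'.2.symm)
      rw [Finset.mem_Ico, ← he]
      exact ⟨c.state_start_le obs t, c.lt_state_start_add obs t (hlen t ht.1)⟩
    have := Finset.card_le_card this
    rw [Nat.card_Ico, Nat.add_sub_cancel_left] at this
    exact_mod_cast this

/-- Epochs after `M` are charged `ε` per round, whatever their length; the others are charged by
their length. In particular an epoch cut off by the horizon needs no separate treatment. -/
theorem sum_radius_le {T M : ℕ} {ε : ℝ} {b : ℕ → ℝ} (hb0 : ∀ m, 0 ≤ b m) (hε0 : 0 ≤ ε)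
    (hε : ∀ m, M < m → radius m ≤ ε)
    (hlen : ∀ t < T, 1 ≤ c.stateLength (c.state obs t))
    (hb : ∀ t < T, (c.stateLength (c.state obs t) : ℝ) ≤ b (c.state obs t).epoch) :
    ∑ t ∈ Finset.range T, radius (c.state obs t).epoch ≤
      T * ε + ∑ m ∈ Finset.Icc 1 M, radius m * b m := by
  calc ∑ t ∈ Finset.range T, radius (c.state obs t).epoch
      ≤ ∑ t ∈ Finset.range T, (ε + ∑ m ∈ Finset.Icc 1 M,
          if (c.state obs t).epoch = m then radius m else 0) := by
        refine Finset.sum_le_sum fun t _ => ?_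
        rw [Finset.sum_ite_eq]
        split_ifs with h
        · linarith
        · rw [add_zero]
          refine hε _ ?_
          have := c.one_le_state_epoch obs t
          by_contra hcon
          exact h (Finset.mem_Icc.2 ⟨this, not_lt.1 hcon⟩)
    _ = T * ε + ∑ m ∈ Finset.Icc 1 M, radius m *
          (((Finset.range T).filter fun t => (c.state obs t).epoch = m).card : ℝ) := by
        rw [Finset.sum_add_distrib, Finset.sum_comm]
        congr 1
        · simp
        · refine Finset.sum_congr rfl fun m _ => ?_
          rw [← Finset.sum_filter, Finset.sum_const, nsmul_eq_mul, mul_comm]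
    _ ≤ _ := by
        gcongr with m hm
        · exact (radius_pos m).le
        · exact c.card_filter_epoch_le obs (hb0 m) hlen fun t ht he => he ▸ hb t ht

end Config

/-! ### Measurability of the median -/

section

/-- There are finitely many sorting permutations. The set where a given one is used is cut out by
coordinate inequalities, together with the tie-breaking rule of `Tuple.sort`, and on it an order
statistic is a coordinate. -/
theorem measurable_median (k : ℕ) : Measurable (median : (Fin k → ℝ) → ℝ) := by
  have hsort : ∀ σ : Equiv.Perm (Fin k), MeasurableSet {v : Fin k → ℝ | σ = Tuple.sort v} := by
    intro σ
    have : {v : Fin k → ℝ | σ = Tuple.sort v} =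
        (⋂ i, ⋂ j, ⋂ _ : i ≤ j, {v : Fin k → ℝ | v (σ i) ≤ v (σ j)}) ∩
        ⋂ i, ⋂ j, ⋂ _ : i < j, ⋂ _ : ¬ σ i < σ j, {v : Fin k → ℝ | v (σ i) = v (σ j)}ᶜ := by
      ext v
      simp only [Set.mem_ofPred_eq, Tuple.eq_sort_iff, Monotone, Function.comp_apply,
        Set.mem_inter_iff, Set.mem_iInter, Set.mem_compl_iff]
      grind
    rw [this]
    refine MeasurableSet.inter ?_ ?_
    · exact MeasurableSet.iInter fun i => MeasurableSet.iInter fun j => MeasurableSet.iInter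
        fun _ => measurableSet_le (measurable_pi_apply _) (measurable_pi_apply _)
    · exact MeasurableSet.iInter fun i => MeasurableSet.iInter fun j => MeasurableSet.iInter
        fun _ => MeasurableSet.iInter fun _ =>
          (measurableSet_eq_fun (measurable_pi_apply (σ i)) (measurable_pi_apply (σ j))).compl
  have happly : ∀ i, Measurable fun v : Fin k → ℝ => v (Tuple.sort v i) := by
    intro i
    have : (fun v : Fin k → ℝ => v (Tuple.sort v i)) = fun v => ∑ σ : Equiv.Perm (Fin k),
        {v : Fin k → ℝ | σ = Tuple.sort v}.indicator (fun v => v (σ i)) v := by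
      ext v
      rw [Finset.sum_eq_single (Tuple.sort v)]
      · rw [Set.indicator_of_mem (by rfl)]
      · intro σ _ hσ
        exact Set.indicator_of_notMem (s := {v : Fin k → ℝ | σ = Tuple.sort v}) hσ _
      · simp
    rw [this]
    exact Finset.measurable_sum _ fun σ _ => (measurable_pi_apply _).indicator (hsort σ)
  unfold median
  by_cases hk : 0 < k
  · simp only [hk, dif_pos]
    exact ((happly _).add (happly _)).div_const 2
  · simp only [hk, dif_neg, not_false_iff]
    exact measurable_const

variable {X Y A Ω : Type*} [MeasurableSpace X] [MeasurableSpace Y] [MetricSpace A]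
  [MeasurableSpace A] [BorelSpace A] [SecondCountableTopology A] [mΩ : MeasurableSpace Ω]

/-! ### One round of the interaction -/

/-- Context, label and action of round `t`. -/
def sample (x : ℕ → Ω → X) (y : ℕ → Ω → Y) (a : ℕ → Ω → A) (t : ℕ) (ω : Ω) : (X × Y) × A :=
  ((x t ω, y t ω), a t ω)

/-- The importance weighted loss estimate of `π`, as a function of context, label and action. -/
def estimate (c : Config X A) (D : Problem X Y A) (m : ℕ) (S : Finset (X → A)) (π : X → A)
    (z : (X × Y) × A) : ℝ :=
  c.ipsEstimate m S ⟨z.1.1, z.2, D.loss z.1.2 z.2⟩ π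

/-- The law of context, label and action in a round of epoch `m` with active policies `S`. -/
def sampleLaw (c : Config X A) (D : Problem X Y A) (m : ℕ) (S : Finset (X → A)) :
    Measure ((X × Y) × A) :=
  (D.law.prod c.base).withDensity fun z => ENNReal.ofReal (c.epochDensity m S z.1.1 z.2)

theorem estimate_eq (c : Config X A) (D : Problem X Y A) (m : ℕ) (S : Finset (X → A))
    (π : X → A) : estimate c D m S π = fun z => smooth c.base c.bandwidth (π z.1.1) z.2 *
      D.loss z.1.2 z.2 / c.epochDensity m S z.1.1 z.2 := by
  ext z
  rw [estimate, Config.ipsEstimate]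

/-! ### Estimates and states are functions of the past -/

section Measurability

variable {c : Config X A} {D : Problem X Y A} {x : ℕ → Ω → X} {y : ℕ → Ω → Y} {a : ℕ → Ω → A}
  {P : Measure Ω}

theorem past_mono {t t' : ℕ} (h : t ≤ t') : past x y a t ≤ past x y a t' :=
  iSup_le fun s => le_iSup (fun s : Fin t' => MeasurableSpace.comap
    (fun ω => (x (s : ℕ) ω, y (s : ℕ) ω, a (s : ℕ) ω)) inferInstance) ⟨s, s.2.trans_le h⟩

theorem measurable_past_sample {s t : ℕ} (h : s < t) :
    Measurable[past x y a t] (sample x y a s) := by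
  have h1 : Measurable[past x y a t] (fun ω => (x s ω, y s ω, a s ω)) :=
    Measurable.mono (comap_measurable _) (le_iSup (fun s : Fin t => MeasurableSpace.comap
      (fun ω => (x (s : ℕ) ω, y (s : ℕ) ω, a (s : ℕ) ω)) inferInstance) ⟨s, h⟩) le_rfl
  have h2 : Measurable fun p : X × Y × A => (((p.1, p.2.1), p.2.2) : (X × Y) × A) := by fun_prop
  exact h2.comp h1

theorem measurable_estimate [IsProbabilityMeasure c.base] (hc : ∀ π ∈ c.policies, Measurable π)
    {m : ℕ} {S : Finset (X → A)} (hS : S ⊆ c.policies) {π : X → A} (hπ : π ∈ c.policies) :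
    Measurable (estimate c D m S π) := by
  have h1 : Measurable fun z : (X × Y) × A => (z.1.1, z.2) := by fun_prop
  have h2 : Measurable fun z : (X × Y) × A => D.loss z.1.2 z.2 :=
    D.measurable_loss.comp (measurable_fst.snd.prodMk measurable_snd)
  have h3 : Measurable fun z : (X × Y) × A => smooth c.base c.bandwidth (π z.1.1) z.2 :=
    (measurable_smooth_policy (hc π hπ)).comp h1
  have h4 : Measurable fun p : X × A => c.epochDensity m S p.1 p.2 :=
    measurable_actionDensity fun π hπ => hc π (hS hπ)
  have h5 := h4.comp h1
  simp only [Function.comp_def] at h5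
  simp only [estimate_eq]
  exact (h3.mul h2).div h5

theorem batchMean_observations (s : EpochState X A) (i : ℕ) (π : X → A) (ω : Ω) :
    c.batchMean (observations D x y a ω) s i π =
      (∑ j ∈ Finset.range (c.batchSize s.epoch s.active), estimate c D s.epoch s.active π
        (sample x y a (s.start + i * c.batchSize s.epoch s.active + j) ω)) /
        (c.batchSize s.epoch s.active : ℝ) := rfl

/-- The σ-algebra on `Ω` is arbitrary and only the samples before `t` are assumed measurable, so the
result applies to the σ-algebra of the past as well. -/
theorem measurable_batchMean [IsProbabilityMeasure c.base]
    (hc : ∀ π ∈ c.policies, Measurable π) {t : ℕ} (hz : ∀ j < t, Measurable (sample x y a j))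
    {s : EpochState X A} (hS : s.active ⊆ c.policies) {π : X → A} (hπ : π ∈ c.policies) {i : ℕ}
    (ht : s.start + (i + 1) * c.batchSize s.epoch s.active ≤ t) :
    Measurable fun ω => c.batchMean (observations D x y a ω) s i π := by
  simp only [batchMean_observations]
  refine (Finset.measurable_sum _ fun j hj => ?_).div_const _
  refine (measurable_estimate hc hS hπ).comp (hz _ ?_)
  rw [Finset.mem_range] at hj
  rw [add_mul] at ht
  omega

theorem measurable_lossEstimate [IsProbabilityMeasure c.base]
    (hc : ∀ π ∈ c.policies, Measurable π) {t : ℕ} (hz : ∀ j < t, Measurable (sample x y a j))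
    {s : EpochState X A} (hS : s.active ⊆ c.policies) {π : X → A} (hπ : π ∈ c.policies)
    (ht : s.start + c.stateLength s ≤ t) :
    Measurable fun ω => c.lossEstimate (observations D x y a ω) s π := by
  unfold Config.lossEstimate
  refine (measurable_median _).comp (measurable_pi_lambda _ fun i => ?_)
  refine measurable_batchMean hc hz hS hπ (le_trans ?_ ht)
  have : ((i : ℕ) + 1) * c.batchSize s.epoch s.active ≤
      c.numBatches * c.batchSize s.epoch s.active := Nat.mul_le_mul_right _ i.2
  unfold Config.stateLength Config.epochLength
  rw [mul_comm (c.batchSize _ _)]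
  omega

-- An event about a finite set of policies is a finite combination of comparisons of estimates. The
-- state `s` is fixed here; its randomness is handled by splitting over possible states.
open Classical in
theorem measurableSet_survivors_eq [IsProbabilityMeasure c.base]
    (hc : ∀ π ∈ c.policies, Measurable π) {t : ℕ} (hz : ∀ j < t, Measurable (sample x y a j))
    {s : EpochState X A} (hS : s.active ⊆ c.policies)
    (ht : s.start + c.stateLength s ≤ t) (S : Finset (X → A)) :
    MeasurableSet {ω | c.survivors (observations D x y a ω) s = S} := by
  let R : (X → A) → Set Ω := fun π => ⋂ π' ∈ s.active,
    {ω | c.lossEstimate (observations D x y a ω) s π ≤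
      c.lossEstimate (observations D x y a ω) s π' + 3 * radius s.epoch}
  have hR : ∀ π ∈ s.active, MeasurableSet (R π) := fun π hπ =>
    Finset.measurableSet_biInter _ fun π' hπ' =>
      measurableSet_le (measurable_lossEstimate hc hz hS (hS hπ) ht)
        ((measurable_lossEstimate hc hz hS (hS hπ') ht).add_const _)
  have : {ω | c.survivors (observations D x y a ω) s = S} =
      {_ω | S ⊆ s.active} ∩ ⋂ π ∈ s.active, if π ∈ S then R π else (R π)ᶜ := by
    ext ω
    simp only [Set.mem_ofPred_eq, Set.mem_inter_iff, Set.mem_iInter, Config.survivors,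
      Finset.ext_iff, Finset.mem_filter]
    constructor
    · intro h
      refine ⟨fun π hπ => ((h π).2 hπ).1, fun π hπ => ?_⟩
      split_ifs with hπS
      · simpa [R] using ((h π).2 hπS).2
      · intro hmem
        exact hπS ((h π).1 ⟨hπ, by simpa [R] using hmem⟩)
    · rintro ⟨h1, h2⟩ π
      constructor
      · rintro ⟨hπ, h⟩
        by_contra hπS
        have := h2 π hπ
        rw [if_neg hπS] at this
        exact this (by simpa [R] using h)
      · intro hπS
        have := h2 π (h1 hπS)
        rw [if_pos hπS] at this
        exact ⟨h1 hπS, by simpa [R] using this⟩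
  rw [this]
  refine (MeasurableSet.const _).inter (Finset.measurableSet_biInter _ fun π hπ => ?_)
  split_ifs
  · exact hR π hπ
  · exact (hR π hπ).compl

open Classical in
/-- A finite set that contains all states the algorithm can be in before round `t`. -/
def possibleStates (c : Config X A) (t : ℕ) : Finset (EpochState X A) :=
  (Finset.range (t + 2) ×ˢ Finset.range (t + 1) ×ˢ c.policies.powerset).image
    fun p => ⟨p.1, p.2.1, p.2.2⟩

theorem state_mem_possibleStates (c : Config X A) (obs : ℕ → Round X A) (t : ℕ) :
    c.state obs t ∈ possibleStates c t := by
  classical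
  refine Finset.mem_image.2 ⟨((c.state obs t).epoch, (c.state obs t).start,
    (c.state obs t).active), ?_, rfl⟩
  simp only [Finset.mem_product, Finset.mem_range, Finset.mem_powerset]
  exact ⟨by have := c.state_epoch_le obs t; omega, by have := c.state_start_le obs t; omega,
    c.state_active_subset obs t⟩

theorem active_subset_of_mem_possibleStates {t : ℕ} {s : EpochState X A}
    (hs : s ∈ possibleStates c t) : s.active ⊆ c.policies := by
  classical
  obtain ⟨p, hp, rfl⟩ := Finset.mem_image.1 hs
  simp only [Finset.mem_product, Finset.mem_powerset] at hp
  exact hp.2.2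

/-- Induction on `t`, splitting over the finitely many previous states. An update compares
`survivors` only when the epoch is over by round `t + 1`, so only earlier samples enter. -/
theorem measurableSet_state_eq [IsProbabilityMeasure c.base]
    (hc : ∀ π ∈ c.policies, Measurable π) {t : ℕ}
    (hz : ∀ j < t, Measurable (sample x y a j)) (s : EpochState X A) :
    MeasurableSet {ω | c.state (observations D x y a ω) t = s} := by
  induction t generalizing s with
  | zero => exact MeasurableSet.const ((⟨1, 0, c.policies⟩ : EpochState X A) = s)
  | succ t ih =>
    have : {ω | c.state (observations D x y a ω) (t + 1) = s} =
        ⋃ s' ∈ possibleStates c t, {ω | c.state (observations D x y a ω) t = s'} ∩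
          {ω | (if t + 1 < s'.start + c.stateLength s' then s' else
            ⟨s'.epoch + 1, t + 1, c.survivors (observations D x y a ω) s'⟩) = s} := by
      ext ω
      simp only [Set.mem_ofPred_eq, Set.mem_iUnion, Set.mem_inter_iff, exists_prop]
      constructor
      · intro h
        exact ⟨_, state_mem_possibleStates c _ t, rfl, h⟩
      · rintro ⟨s', -, rfl, h⟩
        exact h
    rw [this]
    refine Finset.measurableSet_biUnion _ fun s' hs' =>
      (ih (fun j hj => hz j (hj.trans (Nat.lt_succ_self t))) s').inter ?_
    split_ifs with hlt
    · exact MeasurableSet.const _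
    · have h2 := measurableSet_survivors_eq (D := D) hc hz
        (active_subset_of_mem_possibleStates hs') (not_lt.1 hlt) s.active
      have : {ω | (⟨s'.epoch + 1, t + 1, c.survivors (observations D x y a ω) s'⟩ :
          EpochState X A) = s} = {_ω | s'.epoch + 1 = s.epoch ∧ t + 1 = s.start} ∩
          {ω | c.survivors (observations D x y a ω) s' = s.active} := by
        ext ω
        cases s
        simp only [EpochState.mk.injEq, Set.mem_ofPred_eq, Set.mem_inter_iff, and_assoc]
      rw [this]
      exact (MeasurableSet.const _).inter h2

theorem measurableSet_past_state_eq [IsProbabilityMeasure c.base]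
    (hc : ∀ π ∈ c.policies, Measurable π) (t : ℕ) (s : EpochState X A) :
    MeasurableSet[past x y a t] {ω | c.state (observations D x y a ω) t = s} :=
  @measurableSet_state_eq _ _ _ _ _ _ _ _ _ _ (past x y a t) c D x y a _ hc t
    (fun _ => measurable_past_sample) s

theorem measurableSet_past_batchMean [IsProbabilityMeasure c.base]
    (hc : ∀ π ∈ c.policies, Measurable π) {s : EpochState X A} (hS : s.active ⊆ c.policies)
    {π : X → A} (hπ : π ∈ c.policies) {i t : ℕ}
    (ht : s.start + (i + 1) * c.batchSize s.epoch s.active ≤ t) (U : Set ℝ)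
    (hU : MeasurableSet U) :
    MeasurableSet[past x y a t] {ω | c.batchMean (observations D x y a ω) s i π ∈ U} :=
  (@measurable_batchMean _ _ _ _ _ _ _ _ _ _ (past x y a t) c D x y a _ hc t
    (fun _ => measurable_past_sample) s hS π hπ i ht) hU

end Measurability

end

/-! ### Standing assumptions and bounds on the sampling density -/

section

variable {X Y A Ω : Type*} [MeasurableSpace X] [MeasurableSpace Y] [MetricSpace A]
  [MeasurableSpace A] [BorelSpace A] [SecondCountableTopology A] [mΩ : MeasurableSpace Ω]

/-- The input of the algorithm fits the problem, and the volumes of balls are controlled. -/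
structure Fits (c : Config X A) (D : Problem X Y A) (α : ℝ) : Prop where
  isProb : IsProbabilityMeasure c.base
  ctxLaw_eq : c.ctxLaw = D.law.fst
  bounds : BallBounds c.base c.bandwidth c.kap α
  measurable_policy : ∀ π ∈ c.policies, Measurable π
  solver_isOptimal : c.SolverIsOptimal

/-- The invariants of the states of the algorithm. -/
structure Admissible (c : Config X A) (s : EpochState X A) : Prop where
  one_le_epoch : 1 ≤ s.epoch
  active_subset : s.active ⊆ c.policies
  active_nonempty : s.active.Nonempty

section Density

variable {c : Config X A} {D : Problem X Y A} {α : ℝ} {s : EpochState X A}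

theorem isDistributionOn_solver (hf : Fits c D α) (hs : Admissible c s) :
    IsDistributionOn s.active (c.solver s.epoch s.active) :=
  (hf.solver_isOptimal s.epoch s.active hs.one_le_epoch hs.active_subset hs.active_nonempty).1

theorem exploreProb_le_epochDensity (hf : Fits c D α) (hs : Admissible c s) (x : X) (a : A) :
    exploreProb s.epoch ≤ c.epochDensity s.epoch s.active x a :=
  le_actionDensity (isDistributionOn_solver hf hs)
    ((exploreProb_le_half _).trans (by norm_num)) x a

theorem epochDensity_pos (hf : Fits c D α) (hs : Admissible c s) (x : X) (a : A) :
    0 < c.epochDensity s.epoch s.active x a :=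
  (exploreProb_pos _).trans_le (exploreProb_le_epochDensity hf hs x a)

theorem epochDensity_le (hf : Fits c D α) (hs : Admissible c s) (x : X) (a : A) :
    c.epochDensity s.epoch s.active x a ≤ 1 + c.kap :=
  actionDensity_le hf.bounds (isDistributionOn_solver hf hs) (exploreProb_pos _).le
    ((exploreProb_le_half _).trans (by norm_num)) x a

theorem abs_epochDensity_le (hf : Fits c D α) (hs : Admissible c s) (x : X) (a : A) :
    |c.epochDensity s.epoch s.active x a| ≤ 1 + c.kap := by
  rw [abs_of_pos (epochDensity_pos hf hs x a)]
  exact epochDensity_le hf hs x a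

theorem measurable_epochDensity (hf : Fits c D α) (hs : s.active ⊆ c.policies) :
    Measurable fun p : X × A => c.epochDensity s.epoch s.active p.1 p.2 := by
  have := hf.isProb
  exact measurable_actionDensity fun π hπ => hf.measurable_policy π (hs hπ)

theorem measurable_epochDensity_sample (hf : Fits c D α) (hs : s.active ⊆ c.policies) :
    Measurable fun z : (X × Y) × A => c.epochDensity s.epoch s.active z.1.1 z.2 := by
  have h := (measurable_epochDensity hf hs).comp
    (measurable_fst.fst.prodMk measurable_snd : Measurable fun z : (X × Y) × A => (z.1.1, z.2))
  simpa only [Function.comp_def] using h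

theorem integrable_epochDensity (hf : Fits c D α) (hs : Admissible c s) (x : X)
    (ρ : Measure A) [IsFiniteMeasure ρ] :
    Integrable (fun a => c.epochDensity s.epoch s.active x a) ρ := by
  have h := (measurable_epochDensity hf hs.active_subset).comp
    (measurable_prodMk_left : Measurable fun a : A => (x, a))
  simp only [Function.comp_def] at h
  exact integrable_of_abs_le h fun a => abs_epochDensity_le hf hs x a

theorem measurable_setIntegral_epochDensity (hf : Fits c D α) (hs : s.active ⊆ c.policies)
    (U : Set A) : Measurable fun x => ∫ a in U, c.epochDensity s.epoch s.active x a ∂c.base := by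
  have := hf.isProb
  exact (StronglyMeasurable.integral_prod_right' (f := fun p : X × A =>
    c.epochDensity s.epoch s.active p.1 p.2)
    (measurable_epochDensity hf hs).stronglyMeasurable).measurable

end Density

/-! ### The law of a sample given the past -/

section StepLaw

variable {c : Config X A} {D : Problem X Y A} {α : ℝ} {s : EpochState X A}
  {x : ℕ → Ω → X} {y : ℕ → Ω → Y} {a : ℕ → Ω → A} {P : Measure Ω} [IsProbabilityMeasure P]

theorem measurable_sample (hr : IsRun c D P x y a) (t : ℕ) : Measurable (sample x y a t) :=
  ((hr.measurable_context t).prodMk (hr.measurable_label t)).prodMk (hr.measurable_action t)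

theorem past_le (hr : IsRun c D P x y a) (t : ℕ) : past x y a t ≤ mΩ :=
  iSup_le fun s => ((hr.measurable_context s).prodMk
    ((hr.measurable_label s).prodMk (hr.measurable_action s))).comap_le

theorem nature_le (hr : IsRun c D P x y a) (t : ℕ) : nature x y t ≤ mΩ :=
  ((hr.measurable_context t).prodMk (hr.measurable_label t)).comap_le

/-- Independence of the past in restricted form: no division by `P E`, hence also valid for null
events. -/
theorem map_restrict_nature (hr : IsRun c D P x y a) {t : ℕ} (ht : t < c.horizon) {E : Set Ω}
    (hE : MeasurableSet[past x y a t] E) :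
    (P.restrict E).map (fun ω => (x t ω, y t ω)) = P E • D.law := by
  have hm : Measurable fun ω => (x t ω, y t ω) :=
    (hr.measurable_context t).prodMk (hr.measurable_label t)
  ext B hB
  rw [Measure.map_apply hm hB, Measure.restrict_apply (hm hB), Measure.smul_apply, smul_eq_mul,
    ← hr.law_nature t ht, Measure.map_apply hm hB, Set.inter_comm]
  exact (Indep_iff _ _ _).1 (hr.indep_past t ht) E _ hE ⟨B, hB, rfl⟩

/-- Given the past, the sample of round `t` follows the law that belongs to the current state. -/
theorem map_restrict_sample (hf : Fits c D α) (hr : IsRun c D P x y a) {t : ℕ}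
    (ht : t < c.horizon) (hs : Admissible c s) {E : Set Ω} (hE : MeasurableSet[past x y a t] E)
    (hEs : ∀ ω ∈ E, c.state (observations D x y a ω) t = s) :
    (P.restrict E).map (sample x y a t) = P E • sampleLaw c D s.epoch s.active := by
  have := hf.isProb
  have := D.isProb
  have hm : Measurable fun ω => (x t ω, y t ω) :=
    (hr.measurable_context t).prodMk (hr.measurable_label t)
  have hEm : MeasurableSet E := past_le hr t _ hE
  have hqz := measurable_epochDensity_sample (Y := Y) hf hs.active_subset
  -- Finite measures on a product agree if they agree on rectangles `B ×ˢ U`.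
  refine Measure.ext_prod fun {B U} hB hU => ?_
  set G : X × Y → ENNReal := fun z =>
    ∫⁻ b in U, ENNReal.ofReal (c.epochDensity s.epoch s.active z.1 b) ∂c.base with hG
  have hGm : Measurable G := by
    have : Measurable fun z : (X × Y) × A =>
      ENNReal.ofReal (c.epochDensity s.epoch s.active z.1.1 z.2) := hqz.ennreal_ofReal
    exact this.lintegral_prod_right'
  -- the law of the sample on rectangles
  have hR : (P E • sampleLaw c D s.epoch s.active) (B ×ˢ U) = P E * ∫⁻ z in B, G z ∂D.law := by
    rw [Measure.smul_apply, smul_eq_mul, sampleLaw, withDensity_apply _ (hB.prod hU),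
      ← Measure.prod_restrict, lintegral_prod _ hqz.ennreal_ofReal.aemeasurable]
  rw [hR]
  set F : Set Ω := E ∩ (fun ω => (x t ω, y t ω)) ⁻¹' B with hF
  have hFm : MeasurableSet[past x y a t ⊔ nature x y t] F :=
    @MeasurableSet.inter _ (_) _ _ (le_sup_left (a := past x y a t) (b := nature x y t) _ hE)
      (le_sup_right (a := past x y a t) (b := nature x y t) _ ⟨B, hB, rfl⟩)
  have hle : past x y a t ⊔ nature x y t ≤ mΩ := sup_le (past_le hr t) (nature_le hr t)
  have hFm' : MeasurableSet F := hle _ hFm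
  have haU : MeasurableSet (a t ⁻¹' U) := hr.measurable_action t hU
  -- The defining property of the conditional expectation on `F`, which is known before the action
  -- is drawn; on `E` the density played is the one of `s`.
  have h1 : P.real (F ∩ a t ⁻¹' U) = ∫ ω in F,
      (∫ b in U, c.epochDensity s.epoch s.active (x t ω) b ∂c.base) ∂P := by
    calc P.real (F ∩ a t ⁻¹' U) = ∫ ω in F, (a t ⁻¹' U).indicator (fun _ => (1 : ℝ)) ω ∂P := by
          rw [integral_indicator haU, setIntegral_const, smul_eq_mul, mul_one,
            measureReal_restrict_apply haU, Set.inter_comm]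
      _ = ∫ ω in F, P[(a t ⁻¹' U).indicator (fun _ => (1 : ℝ)) |
            past x y a t ⊔ nature x y t] ω ∂P :=
          (setIntegral_condExp hle ((integrable_const _).indicator haU) hFm).symm
      _ = ∫ ω in F, (∫ b in U,
            c.playDensity (observations D x y a ω) t (x t ω) b ∂c.base) ∂P :=
          integral_congr_ae (ae_restrict_of_ae (hr.law_action t ht U hU))
      _ = _ := by
          refine setIntegral_congr_fun hFm' fun ω hω => ?_
          simp only [Config.playDensity, hEs ω hω.1]
  have h2 : P (F ∩ a t ⁻¹' U) = ∫⁻ ω in F, G (x t ω, y t ω) ∂P := by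
    rw [← ofReal_measureReal (measure_ne_top _ _), h1, ofReal_integral_eq_lintegral_ofReal]
    · refine lintegral_congr fun ω => ?_
      simp only [hG]
      rw [ofReal_integral_eq_lintegral_ofReal]
      · exact integrable_epochDensity hf hs _ _
      · exact Filter.Eventually.of_forall fun b => (epochDensity_pos hf hs _ b).le
    · refine Integrable.of_bound (C := 1 + c.kap) ?_ (Filter.Eventually.of_forall fun ω => ?_)
      · have h := (measurable_setIntegral_epochDensity hf hs.active_subset U).comp
          (hr.measurable_context t)
        simp only [Function.comp_def] at h
        exact h.aestronglyMeasurable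
      · refine (norm_setIntegral_le_of_norm_le_const (C := 1 + c.kap) (measure_lt_top _ _)
          fun b _ => abs_epochDensity_le hf hs _ b).trans ?_
        have h0 : 0 ≤ 1 + c.kap := (abs_nonneg _).trans (abs_epochDensity_le hf hs (x t ω) (a t ω))
        exact mul_le_of_le_one_right h0 measureReal_le_one
    · exact Filter.Eventually.of_forall fun ω => integral_nonneg fun b =>
        (epochDensity_pos hf hs _ b).le
  have h3 : (P.restrict E).map (sample x y a t) (B ×ˢ U) = P (F ∩ a t ⁻¹' U) := by
    rw [Measure.map_apply (measurable_sample hr t) (hB.prod hU),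
      Measure.restrict_apply (measurable_sample hr t (hB.prod hU))]
    congr 1
    ext ω
    simp only [sample, hF, Set.mem_inter_iff, Set.mem_preimage, Set.mem_prod]
    tauto
  -- What remains depends on the round only through nature, whose law on `E` is `P E • D.law`.
  rw [h3, h2, hF, Set.inter_comm, ← Measure.restrict_restrict (hm hB),
    ← setLIntegral_map hB hGm hm, map_restrict_nature hr ht hE, Measure.restrict_smul,
    lintegral_smul_measure, smul_eq_mul]

end StepLaw

/-! ### Moments of the estimates -/

section Moments

variable {c : Config X A} {D : Problem X Y A} {α : ℝ} {s : EpochState X A} {π : X → A}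

theorem abs_loss_le (D : Problem X Y A) (y : Y) (a : A) : |D.loss y a| ≤ 1 := by
  rw [abs_of_nonneg (D.loss_mem y a).1]
  exact (D.loss_mem y a).2

theorem measurable_loss_sample (D : Problem X Y A) :
    Measurable fun z : (X × Y) × A => D.loss z.1.2 z.2 :=
  D.measurable_loss.comp (measurable_fst.snd.prodMk measurable_snd)

/-- Change of measure to the product law. The factor `q` cancels the importance weights in the
moments below. -/
theorem integral_sampleLaw (hf : Fits c D α) (hs : Admissible c s) (f : (X × Y) × A → ℝ) :
    ∫ z, f z ∂(sampleLaw c D s.epoch s.active) =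
      ∫ z, c.epochDensity s.epoch s.active z.1.1 z.2 * f z ∂(D.law.prod c.base) := by
  rw [sampleLaw, integral_withDensity_eq_integral_toReal_smul
    (measurable_epochDensity_sample hf hs.active_subset).ennreal_ofReal
    (Filter.Eventually.of_forall fun _ => ENNReal.ofReal_lt_top)]
  refine integral_congr_ae (Filter.Eventually.of_forall fun z => ?_)
  simp only [smul_eq_mul, ENNReal.toReal_ofReal (epochDensity_pos hf hs z.1.1 z.2).le]

theorem abs_estimate_le (hf : Fits c D α) (hs : Admissible c s) (z : (X × Y) × A) :
    |estimate c D s.epoch s.active π z| ≤ c.kap / exploreProb s.epoch := by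
  rw [estimate_eq]
  simp only
  rw [abs_div, abs_mul, abs_of_pos (epochDensity_pos hf hs z.1.1 z.2)]
  refine div_le_div₀ (hf.bounds.kappa_pos z.2).le ?_ (exploreProb_pos _)
    (exploreProb_le_epochDensity hf hs z.1.1 z.2)
  calc _ ≤ c.kap * 1 := mul_le_mul (abs_smooth_le hf.bounds _ _) (abs_loss_le D _ _)
        (abs_nonneg _) (hf.bounds.kappa_pos z.2).le
    _ = c.kap := mul_one _

theorem measurable_smooth_sample (hf : Fits c D α) (hπ : Measurable π) :
    Measurable fun z : (X × Y) × A => smooth c.base c.bandwidth (π z.1.1) z.2 := by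
  have := hf.isProb
  exact (measurable_smooth_policy hπ).comp (measurable_fst.fst.prodMk measurable_snd)

theorem integrable_smooth_mul_loss (hf : Fits c D α) (hπ : Measurable π) :
    Integrable (fun z : (X × Y) × A => smooth c.base c.bandwidth (π z.1.1) z.2 *
      D.loss z.1.2 z.2) (D.law.prod c.base) := by
  have := hf.isProb
  have := D.isProb
  refine integrable_of_abs_le (C := c.kap * 1)
    ((measurable_smooth_sample hf hπ).mul (measurable_loss_sample D)) fun z => ?_
  rw [abs_mul]
  exact mul_le_mul (abs_smooth_le hf.bounds _ _) (abs_loss_le D _ _)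
        (abs_nonneg _) (hf.bounds.kappa_pos z.2).le

theorem smoothedLoss_eq (hf : Fits c D α) (hπ : Measurable π) :
    smoothedLoss c.base c.bandwidth D π = ∫ z, smooth c.base c.bandwidth (π z.1.1) z.2 *
      D.loss z.1.2 z.2 ∂(D.law.prod c.base) := by
  have := hf.isProb
  have := D.isProb
  rw [integral_prod _ (integrable_smooth_mul_loss hf hπ)]
  rfl

theorem smoothedLoss_nonneg (hf : Fits c D α) (hπ : Measurable π) :
    0 ≤ smoothedLoss c.base c.bandwidth D π := by
  rw [smoothedLoss_eq hf hπ]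
  exact integral_nonneg fun z => mul_nonneg (smooth_nonneg _ _ _ _) (D.loss_mem _ _).1

theorem smoothedLoss_le_one (hf : Fits c D α) (hπ : Measurable π) :
    smoothedLoss c.base c.bandwidth D π ≤ 1 := by
  have := hf.isProb
  have := D.isProb
  have hi : Integrable (fun z : (X × Y) × A => smooth c.base c.bandwidth (π z.1.1) z.2)
      (D.law.prod c.base) :=
    integrable_of_abs_le (measurable_smooth_sample hf hπ) fun z => abs_smooth_le hf.bounds _ _
  rw [smoothedLoss_eq hf hπ]
  calc _ ≤ ∫ z, smooth c.base c.bandwidth (π z.1.1) z.2 ∂(D.law.prod c.base) :=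
        integral_mono (integrable_smooth_mul_loss hf hπ) hi fun z =>
          mul_le_of_le_one_right (smooth_nonneg _ _ _ _) (D.loss_mem _ _).2
    _ = 1 := by
        rw [integral_prod _ hi]
        simp [integral_smooth hf.bounds]

/-- The estimates are unbiased. -/
theorem integral_estimate (hf : Fits c D α) (hs : Admissible c s) (hπ : Measurable π) :
    ∫ z, estimate c D s.epoch s.active π z ∂(sampleLaw c D s.epoch s.active) =
      smoothedLoss c.base c.bandwidth D π := by
  rw [integral_sampleLaw hf hs, smoothedLoss_eq hf hπ]
  refine integral_congr_ae (Filter.Eventually.of_forall fun z => ?_)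
  simp only [estimate_eq]
  rw [mul_div_cancel₀ _ (epochDensity_pos hf hs z.1.1 z.2).ne']

/-- After the change of measure the integrand is `K ℓ² · K / q ≤ κ · K / q`, so the second moment is
at most `κ` times the quantity minimized by the solver. -/
theorem integral_estimate_sq_le (hf : Fits c D α) (hs : Admissible c s) (hπ : π ∈ s.active) :
    ∫ z, estimate c D s.epoch s.active π z ^ 2 ∂(sampleLaw c D s.epoch s.active) ≤
      2 * c.kap * c.charVolume s.active := by
  have := hf.isProb
  have := D.isProb
  have hctx := hf.ctxLaw_eq
  have : IsProbabilityMeasure c.ctxLaw := by rw [hctx]; infer_instance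
  have hS : ∀ π ∈ s.active, Measurable π := fun π hπ =>
    hf.measurable_policy π (hs.active_subset hπ)
  have hvar := variance_le_of_isOptimal hf.bounds hS (hf.solver_isOptimal s.epoch s.active
    hs.one_le_epoch hs.active_subset hs.active_nonempty) (exploreProb_pos _)
    (exploreProb_le_half _) hπ
  set W : X × A → ℝ := fun p => smooth c.base c.bandwidth (π p.1) p.2 *
    (1 / c.epochDensity s.epoch s.active p.1 p.2) with hW
  have hWm : Measurable W := (measurable_smooth_policy (hS π hπ)).mul
    ((measurable_epochDensity hf hs.active_subset).const_div 1)
  have hWb : ∀ p, |W p| ≤ c.kap * (1 / exploreProb s.epoch) := fun p => by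
    have hq := epochDensity_pos hf hs p.1 p.2
    simp only [hW]
    rw [abs_mul, abs_of_pos (one_div_pos.2 hq)]
    exact mul_le_mul (abs_smooth_le hf.bounds _ _) (one_div_le_one_div_of_le (exploreProb_pos _)
      (exploreProb_le_epochDensity hf hs p.1 p.2)) (one_div_pos.2 hq).le
      (hf.bounds.kappa_pos p.2).le
  have hWz : Measurable fun z : (X × Y) × A => W (z.1.1, z.2) :=
    hWm.comp (measurable_fst.fst.prodMk measurable_snd)
  have hWi : Integrable (fun z : (X × Y) × A => W (z.1.1, z.2)) (D.law.prod c.base) :=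
    integrable_of_abs_le hWz fun z => hWb _
  have hW1 : ∫ z, W (z.1.1, z.2) ∂(D.law.prod c.base) =
      c.variance (exploreProb s.epoch) s.active (c.solver s.epoch s.active) π := by
    rw [integral_prod _ hWi]
    unfold Config.variance
    rw [hctx, Measure.fst, integral_map measurable_fst.aemeasurable]
    · rfl
    · exact (StronglyMeasurable.integral_prod_right' (f := W)
        hWm.stronglyMeasurable).aestronglyMeasurable
  rw [integral_sampleLaw hf hs]
  calc _ ≤ ∫ z, c.kap * W (z.1.1, z.2) ∂(D.law.prod c.base) := by
        refine integral_mono_of_nonneg (Filter.Eventually.of_forall fun z =>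
          mul_nonneg (epochDensity_pos hf hs z.1.1 z.2).le (sq_nonneg _))
          (hWi.const_mul _) (Filter.Eventually.of_forall fun z => ?_)
        have hq := epochDensity_pos hf hs z.1.1 z.2
        have hk0 := smooth_nonneg c.base c.bandwidth (π z.1.1) z.2
        have hk1 := smooth_le hf.bounds (π z.1.1) z.2
        have hl := D.loss_mem z.1.2 z.2
        have hl2 : D.loss z.1.2 z.2 ^ 2 ≤ 1 := pow_le_one₀ hl.1 hl.2
        simp only [estimate_eq, hW]
        have e : c.epochDensity s.epoch s.active z.1.1 z.2 *
            (smooth c.base c.bandwidth (π z.1.1) z.2 * D.loss z.1.2 z.2 /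
              c.epochDensity s.epoch s.active z.1.1 z.2) ^ 2 =
            (smooth c.base c.bandwidth (π z.1.1) z.2 * D.loss z.1.2 z.2 ^ 2) *
            (smooth c.base c.bandwidth (π z.1.1) z.2 *
              (1 / c.epochDensity s.epoch s.active z.1.1 z.2)) := by
          field_simp
        rw [e]
        refine mul_le_mul_of_nonneg_right ?_ (by positivity)
        calc _ ≤ smooth c.base c.bandwidth (π z.1.1) z.2 * 1 :=
              mul_le_mul_of_nonneg_left hl2 hk0
          _ ≤ c.kap := by rw [mul_one]; exact hk1
    _ = c.kap * c.variance (exploreProb s.epoch) s.active (c.solver s.epoch s.active) π := by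
        rw [integral_const_mul, hW1]
    _ ≤ _ := by
        obtain ⟨x₀⟩ : Nonempty X := D.law.fst.nonempty_of_neZero
        have := (hf.bounds.kappa_pos (π x₀)).le
        nlinarith

/-- The expected loss of a round, by the mixture that the action is drawn from. -/
theorem integral_loss_le (hf : Fits c D α) (hs : Admissible c s) {b : ℝ}
    (hb : ∀ π ∈ s.active, smoothedLoss c.base c.bandwidth D π ≤ b) :
    ∫ z, D.loss z.1.2 z.2 ∂(sampleLaw c D s.epoch s.active) ≤ radius s.epoch + b := by
  have := hf.isProb
  have := D.isProb
  set μ := exploreProb s.epoch with hμ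
  have hμ0 : 0 < μ := exploreProb_pos _
  have hμ1 : μ ≤ 1 / 2 := exploreProb_le_half _
  have hQ := isDistributionOn_solver hf hs
  have hS : ∀ π ∈ s.active, Measurable π := fun π hπ =>
    hf.measurable_policy π (hs.active_subset hπ)
  have hli : Integrable (fun z : (X × Y) × A => D.loss z.1.2 z.2) (D.law.prod c.base) :=
    integrable_of_abs_le (measurable_loss_sample D) fun z => abs_loss_le D _ _
  have hl1 : ∫ z, D.loss z.1.2 z.2 ∂(D.law.prod c.base) ≤ 1 := by
    calc _ ≤ ∫ _, (1 : ℝ) ∂(D.law.prod c.base) :=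
          integral_mono hli (integrable_const _) fun z => (D.loss_mem _ _).2
      _ = 1 := by simp
  rw [integral_sampleLaw hf hs]
  have e : ∀ z : (X × Y) × A, c.epochDensity s.epoch s.active z.1.1 z.2 * D.loss z.1.2 z.2 =
      μ * D.loss z.1.2 z.2 + (1 - μ) * ∑ π ∈ s.active, c.solver s.epoch s.active π *
        (smooth c.base c.bandwidth (π z.1.1) z.2 * D.loss z.1.2 z.2) := fun z => by
    unfold Config.epochDensity Config.actionDensity
    rw [add_mul, mul_assoc (1 - _), Finset.sum_mul]
    simp only [mul_assoc, hμ]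
  simp only [e]
  have hsi : ∀ π ∈ s.active, Integrable (fun z : (X × Y) × A => c.solver s.epoch s.active π *
      (smooth c.base c.bandwidth (π z.1.1) z.2 * D.loss z.1.2 z.2)) (D.law.prod c.base) :=
    fun π hπ => (integrable_smooth_mul_loss hf (hS π hπ)).const_mul _
  rw [integral_add (hli.const_mul _) ((integrable_finsetSum _ hsi).const_mul _),
    integral_const_mul, integral_const_mul, integral_finsetSum _ hsi]
  have h2 : ∑ π ∈ s.active, ∫ z, c.solver s.epoch s.active π *
      (smooth c.base c.bandwidth (π z.1.1) z.2 * D.loss z.1.2 z.2) ∂(D.law.prod c.base) ≤ b := by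
    calc _ ≤ ∑ π ∈ s.active, c.solver s.epoch s.active π * b := by
          refine Finset.sum_le_sum fun π hπ => ?_
          rw [integral_const_mul, ← smoothedLoss_eq hf (hS π hπ)]
          exact mul_le_mul_of_nonneg_left (hb π hπ) (hQ.1 π hπ)
      _ = b := by rw [← Finset.sum_mul, hQ.2, one_mul]
  have hb0 : 0 ≤ b := by
    obtain ⟨π, hπ⟩ := hs.active_nonempty
    exact (smoothedLoss_nonneg hf (hS π hπ)).trans (hb π hπ)
  have h3 : μ ≤ radius s.epoch := exploreProb_le_radius _
  have h4 := mul_le_mul_of_nonneg_left h2 (by linarith : 0 ≤ 1 - μ)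
  -- The uniform part has loss at most `1` and weight `μ ≤ r_m`; the policy part has loss at most
  -- `b` and weight `1 - μ ≤ 1`.
  nlinarith

end Moments

end

section

variable {X Y A Ω : Type*} [MeasurableSpace X] [MeasurableSpace Y] [MetricSpace A]
  [MeasurableSpace A] [BorelSpace A] [SecondCountableTopology A] [mΩ : MeasurableSpace Ω]
  {c : Config X A} {D : Problem X Y A} {α : ℝ} {s : EpochState X A} {π : X → A}
  {x : ℕ → Ω → X} {y : ℕ → Ω → Y} {a : ℕ → Ω → A} {P : Measure Ω} [IsProbabilityMeasure P]

/-! ### Concentration of the estimates -/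

theorem one_le_kap_mul_charVolume (hf : Fits c D α) (hs : Admissible c s) :
    1 ≤ c.kap * c.charVolume s.active := by
  have := hf.isProb
  have := D.isProb
  have : IsProbabilityMeasure c.ctxLaw := by rw [hf.ctxLaw_eq]; infer_instance
  exact one_le_kappa_mul_charVolume hf.bounds
    (fun π hπ => hf.measurable_policy π (hs.active_subset hπ)) hs.active_nonempty

theorem le_batchSize (c : Config X A) (s : EpochState X A) :
    320 * (c.kap * c.charVolume s.active) ≤ c.batchSize s.epoch s.active * radius s.epoch ^ 2 := by
  have h := Nat.le_ceil (320 * c.kap * c.charVolume s.active / radius s.epoch ^ 2)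
  rw [div_le_iff₀ (pow_pos (radius_pos _) 2)] at h
  rw [← mul_assoc]
  exact h

theorem batchSize_pos (hf : Fits c D α) (hs : Admissible c s) :
    0 < c.batchSize s.epoch s.active := by
  have h1 := le_batchSize c s
  have h2 := one_le_kap_mul_charVolume hf hs
  by_contra h
  have : c.batchSize s.epoch s.active = 0 := by omega
  rw [this] at h1
  norm_num at h1
  linarith

theorem map_cond_sample (hf : Fits c D α) (hr : IsRun c D P x y a) {t : ℕ}
    (ht : t < c.horizon) (hs : Admissible c s) {E : Set Ω} (hE : MeasurableSet[past x y a t] E)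
    (hEs : ∀ ω ∈ E, c.state (observations D x y a ω) t = s) (h0 : P E ≠ 0) :
    (P[|E]).map (sample x y a t) = sampleLaw c D s.epoch s.active := by
  rw [ProbabilityTheory.cond, Measure.map_smul, map_restrict_sample hf hr ht hs hE hEs, smul_smul,
    ENNReal.inv_mul_cancel h0 (measure_ne_top _ _), one_smul]

/-- The event that the earlier sample lies in `B` belongs to the past of `t'`, so it can be joined
to `E` without changing the law of the later sample. -/
theorem indepFun_cond_sample (hf : Fits c D α) (hr : IsRun c D P x y a) {t t' : ℕ}
    (htt : t < t') (ht : t' < c.horizon) (hs : Admissible c s) {E : Set Ω}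
    (hE : MeasurableSet[past x y a t'] E)
    (hEs : ∀ ω ∈ E, c.state (observations D x y a ω) t' = s) (h0 : P E ≠ 0) :
    IndepFun (sample x y a t) (sample x y a t') P[|E] := by
  have hEm : MeasurableSet E := past_le hr t' _ hE
  rw [indepFun_iff_measure_inter_preimage_eq_mul]
  intro B B' hB hB'
  have hEB : MeasurableSet[past x y a t'] (E ∩ sample x y a t ⁻¹' B) :=
    @MeasurableSet.inter _ (_) _ _ hE (measurable_past_sample htt hB)
  have h1 := congrArg (fun μ => μ B')
    (map_restrict_sample hf hr ht hs hEB fun ω hω => hEs ω hω.1)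
  have h2 := congrArg (fun μ => μ B') (map_cond_sample hf hr ht hs hE hEs h0)
  rw [Measure.map_apply (measurable_sample hr t') hB',
    Measure.restrict_apply (measurable_sample hr t' hB'), Measure.smul_apply, smul_eq_mul] at h1
  rw [Measure.map_apply (measurable_sample hr t') hB'] at h2
  rw [h2, cond_apply hEm, cond_apply hEm, mul_assoc, ← h1, ← Set.inter_assoc, Set.inter_comm]

theorem measurable_estimate_of_fits (hf : Fits c D α) (hs : Admissible c s) (hπ : π ∈ s.active) :
    Measurable (estimate c D s.epoch s.active π) := by
  have := hf.isProb
  exact measurable_estimate hf.measurable_policy hs.active_subset (hs.active_subset hπ)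

/-- Chebyshev under `P[|E]`, where the samples of the batch have the same law and are pairwise
independent. The multiplicative form covers null events and can be iterated over batches. -/
theorem measureReal_inter_batchMean_le (hf : Fits c D α) (hr : IsRun c D P x y a)
    (hs : Admissible c s) (hπ : π ∈ s.active) {i : ℕ} {E : Set Ω}
    (hi : s.start + (i + 1) * c.batchSize s.epoch s.active ≤ c.horizon)
    (hE : MeasurableSet[past x y a (s.start + i * c.batchSize s.epoch s.active)] E)
    (hEs : ∀ ω ∈ E, ∀ j < c.batchSize s.epoch s.active, c.state (observations D x y a ω)
      (s.start + i * c.batchSize s.epoch s.active + j) = s) :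
    P.real (E ∩ {ω | radius s.epoch < |c.batchMean (observations D x y a ω) s i π -
      smoothedLoss c.base c.bandwidth D π|}) ≤ P.real E * (1 / 160) := by
  by_cases h0 : P E = 0
  · rw [measureReal_def, measureReal_def, measure_mono_null Set.inter_subset_left h0, h0]
    simp
  set n := c.batchSize s.epoch s.active with hn
  set t := s.start + i * n with ht
  have hn0 : 0 < n := batchSize_pos hf hs
  have hth : ∀ j < n, t + j < c.horizon := fun j hj => by
    rw [add_mul] at hi
    omega
  have hEt : ∀ j, MeasurableSet[past x y a (t + j)] E := fun j =>
    past_mono (Nat.le_add_right t j) _ hE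
  have hEm : MeasurableSet E := past_le hr t _ hE
  have hprob : IsProbabilityMeasure P[|E] := cond_isProbabilityMeasure h0
  have hest := measurable_estimate_of_fits (π := π) hf hs hπ
  set Z : ℕ → Ω → ℝ := fun j ω => estimate c D s.epoch s.active π (sample x y a (t + j) ω) with hZ
  have hZm : ∀ j, Measurable (Z j) := fun j => hest.comp (measurable_sample hr _)
  have hZL : ∀ j, MemLp (Z j) 2 P[|E] := fun j =>
    MemLp.of_bound (hZm j).aestronglyMeasurable (c.kap / exploreProb s.epoch)
      (Filter.Eventually.of_forall fun ω => abs_estimate_le hf hs _)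
  have hmean : ∀ j < n, ∫ ω, Z j ω ∂P[|E] = smoothedLoss c.base c.bandwidth D π := by
    intro j hj
    rw [← integral_estimate hf hs (hf.measurable_policy π (hs.active_subset hπ)),
      ← map_cond_sample hf hr (hth j hj) hs (hEt j) (fun ω hω => hEs ω hω j hj) h0,
      integral_map (measurable_sample hr _).aemeasurable hest.aestronglyMeasurable]
  have hvar : ∀ j < n, variance (Z j) P[|E] ≤ 2 * c.kap * c.charVolume s.active := by
    intro j hj
    refine (variance_le_expectation_sq (hZm j).aestronglyMeasurable).trans
      (le_trans (le_of_eq ?_) (integral_estimate_sq_le hf hs hπ))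
    rw [← map_cond_sample hf hr (hth j hj) hs (hEt j) (fun ω hω => hEs ω hω j hj) h0,
      integral_map (measurable_sample hr _).aemeasurable (hest.pow_const 2).aestronglyMeasurable]
    rfl
  have hind : Set.Pairwise (Finset.range n : Set ℕ) fun j j' => IndepFun (Z j) (Z j') P[|E] := by
    have key : ∀ j j', j < j' → j' < n → IndepFun (Z j) (Z j') P[|E] := fun j j' hjj hj' =>
      (indepFun_cond_sample hf hr (Nat.add_lt_add_left hjj t) (hth j' hj') hs (hEt j')
        (fun ω hω => hEs ω hω j' hj') h0).comp hest hest
    intro j hj j' hj' hne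
    simp only [Finset.coe_range, Set.mem_Iio] at hj hj'
    rcases lt_or_gt_of_ne hne with h | h
    · exact key j j' h hj'
    · exact (key j' j h hj).symm
  have hsumL : MemLp (∑ j ∈ Finset.range n, Z j) 2 P[|E] := memLp_finsetSum' _ fun j _ => hZL j
  have hsumvar : variance (∑ j ∈ Finset.range n, Z j) P[|E] ≤
      n * (2 * c.kap * c.charVolume s.active) := by
    rw [IndepFun.variance_sum (fun j _ => hZL j) hind]
    calc _ ≤ ∑ _j ∈ Finset.range n, 2 * c.kap * c.charVolume s.active :=
          Finset.sum_le_sum fun j hj => hvar j (Finset.mem_range.1 hj)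
      _ = _ := by simp
  have hsummean : ∫ ω, (∑ j ∈ Finset.range n, Z j) ω ∂P[|E] =
      n * smoothedLoss c.base c.bandwidth D π := by
    simp only [Finset.sum_apply]
    rw [integral_finsetSum _ fun j _ => (hZL j).integrable (by norm_num)]
    rw [Finset.sum_congr rfl fun j hj => hmean j (Finset.mem_range.1 hj)]
    simp
  have hnr : (0 : ℝ) < n := by exact_mod_cast hn0
  have hrad := radius_pos s.epoch
  have hcheb := meas_ge_le_variance_div_sq hsumL (mul_pos hnr hrad)
  rw [hsummean] at hcheb
  have hsub : {ω | radius s.epoch < |c.batchMean (observations D x y a ω) s i π -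
      smoothedLoss c.base c.bandwidth D π|} ⊆
      {ω | n * radius s.epoch ≤ |(∑ j ∈ Finset.range n, Z j) ω -
        n * smoothedLoss c.base c.bandwidth D π|} := by
    intro ω hω
    simp only [Set.mem_ofPred_eq, batchMean_observations] at hω ⊢
    rw [← hn, ← ht] at hω
    have e : (∑ j ∈ Finset.range n, Z j) ω - n * smoothedLoss c.base c.bandwidth D π =
        n * ((∑ j ∈ Finset.range n, estimate c D s.epoch s.active π (sample x y a (t + j) ω)) / n -
          smoothedLoss c.base c.bandwidth D π) := by
      simp only [hZ, Finset.sum_apply]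
      field_simp
    rw [e, abs_mul, abs_of_pos hnr]
    exact mul_le_mul_of_nonneg_left hω.le hnr.le
  -- The ratio is at most `2 κ V / (n r²)`, and `n r² ≥ 320 κ V`.
  have hbound : variance (∑ j ∈ Finset.range n, Z j) P[|E] / (n * radius s.epoch) ^ 2 ≤
      1 / 160 := by
    have hle := le_batchSize c s
    rw [← hn] at hle
    rw [div_le_div_iff₀ (by positivity) (by norm_num)]
    have := mul_le_mul_of_nonneg_left hle hnr.le
    nlinarith
  have hcond : (P[|E]).real {ω | radius s.epoch <
      |c.batchMean (observations D x y a ω) s i π - smoothedLoss c.base c.bandwidth D π|} ≤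
      1 / 160 := by
    refine ENNReal.toReal_le_of_le_ofReal (by norm_num) ((measure_mono hsub).trans
      (hcheb.trans (ENNReal.ofReal_le_ofReal hbound)))
  rw [measureReal_def, cond_apply hEm, ENNReal.toReal_mul, ENNReal.toReal_inv] at hcond
  have hPE : 0 < P.real E := ENNReal.toReal_pos h0 (measure_ne_top _ _)
  rw [← measureReal_def, ← measureReal_def, inv_mul_le_iff₀ hPE] at hcond
  exact hcond

/-- Induction by adding the latest batch: failures of the earlier batches belong to its past and can
be absorbed into the conditioning event. -/
theorem measureReal_inter_batches_le (hf : Fits c D α) (hr : IsRun c D P x y a)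
    (hs : Admissible c s) (hπ : π ∈ s.active) (hlen : s.start + c.stateLength s ≤ c.horizon)
    {E : Set Ω} (hE : MeasurableSet[past x y a s.start] E)
    (hEs : ∀ ω ∈ E, c.state (observations D x y a ω) s.start = s)
    (I : Finset ℕ) (hI : ∀ i ∈ I, i < c.numBatches) :
    P.real (E ∩ ⋂ i ∈ I, {ω | radius s.epoch < |c.batchMean (observations D x y a ω) s i π -
      smoothedLoss c.base c.bandwidth D π|}) ≤ P.real E * (1 / 160) ^ I.card := by
  have := hf.isProb
  have hmul : ∀ i < c.numBatches, (i + 1) * c.batchSize s.epoch s.active ≤ c.stateLength s :=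
    fun i hi => by
      unfold Config.stateLength Config.epochLength
      rw [mul_comm (c.batchSize _ _)]
      exact Nat.mul_le_mul_right _ hi
  induction I using Finset.induction_on_max with
  | empty => simp
  | insert i I hmax ih =>
    have hik := hI i (Finset.mem_insert_self _ _)
    have h1 := ih fun j hj => hI j (Finset.mem_insert_of_mem hj)
    have hnot : i ∉ I := fun h => lt_irrefl _ (hmax i h)
    rw [Finset.set_biInter_insert, Finset.card_insert_of_notMem hnot, Set.inter_comm
      (_ : Set Ω) (⋂ j ∈ I, _), ← Set.inter_assoc, pow_succ, ← mul_assoc]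
    have hi := hmul i hik
    refine (measureReal_inter_batchMean_le hf hr hs hπ ((Nat.add_le_add_left hi _).trans hlen)
      ?_ ?_).trans (mul_le_mul_of_nonneg_right h1 (by norm_num))
    · refine @MeasurableSet.inter _ (_) _ _ (past_mono (Nat.le_add_right _ _) _ hE)
        (@Finset.measurableSet_biInter _ _ (_) _ _ fun j hj => ?_)
      have hU : MeasurableSet {u : ℝ | radius s.epoch <
          |u - smoothedLoss c.base c.bandwidth D π|} :=
        measurableSet_lt measurable_const (by fun_prop)
      exact measurableSet_past_batchMean hf.measurable_policy hs.active_subset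
        (hs.active_subset hπ)
        (Nat.add_le_add_left (Nat.mul_le_mul_right _ (hmax j hj)) _) _ hU
    · intro ω hω j hj
      have h := hEs ω hω.1
      rw [add_assoc]
      -- The state is frozen throughout the epoch.
      have h2 := c.state_add_eq (observations D x y a ω) (t := s.start) (by rw [h])
        (i * c.batchSize s.epoch s.active + j) (by
          rw [h]
          rw [add_mul] at hi
          omega)
      rw [h2, h]

/-- A wrong median requires a set of at least `k / 2` wrong batches. A union bound over at most
`2^k` such sets, each of probability at most `12^{-k}`, gives `6^{-k}`. -/
theorem measureReal_inter_lossEstimate_le (hf : Fits c D α) (hr : IsRun c D P x y a)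
    (hs : Admissible c s) (hπ : π ∈ s.active) (hlen : s.start + c.stateLength s ≤ c.horizon)
    (hk : 0 < c.numBatches) {E : Set Ω} (hE : MeasurableSet[past x y a s.start] E)
    (hEs : ∀ ω ∈ E, c.state (observations D x y a ω) s.start = s) :
    P.real (E ∩ {ω | radius s.epoch < |c.lossEstimate (observations D x y a ω) s π -
      smoothedLoss c.base c.bandwidth D π|}) ≤ P.real E * (1 / 6) ^ c.numBatches := by
  classical
  set k := c.numBatches with hkdef
  set B : ℕ → Set Ω := fun i => {ω | radius s.epoch <
    |c.batchMean (observations D x y a ω) s i π - smoothedLoss c.base c.bandwidth D π|} with hB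
  have hsub : E ∩ {ω | radius s.epoch < |c.lossEstimate (observations D x y a ω) s π -
      smoothedLoss c.base c.bandwidth D π|} ⊆
      ⋃ I ∈ (Finset.range k).powerset.filter fun I => k ≤ 2 * I.card, E ∩ ⋂ i ∈ I, B i := by
    rintro ω ⟨hωE, hω⟩
    have h := le_two_mul_card_of_lt_abs_median_sub (Set.mem_ofPred_eq ▸ hω) hk
    simp only [Set.mem_iUnion, exists_prop, Finset.mem_filter, Finset.mem_powerset]
    refine ⟨(Finset.univ.filter fun i : Fin k => ω ∈ B i).map Fin.valEmbedding, ⟨?_, ?_⟩,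
      hωE, ?_⟩
    · intro i hi
      obtain ⟨j, -, rfl⟩ := Finset.mem_map.1 hi
      exact Finset.mem_range.2 j.2
    · rw [Finset.card_map]
      exact h
    · simp only [Set.mem_iInter, Finset.mem_map, Finset.mem_filter, Finset.mem_univ, true_and]
      rintro i ⟨j, hj, rfl⟩
      exact hj
  calc _ ≤ P.real (⋃ I ∈ (Finset.range k).powerset.filter fun I => k ≤ 2 * I.card,
          E ∩ ⋂ i ∈ I, B i) := measureReal_mono hsub (measure_ne_top _ _)
    _ ≤ ∑ I ∈ (Finset.range k).powerset.filter fun I => k ≤ 2 * I.card,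
          P.real (E ∩ ⋂ i ∈ I, B i) := measureReal_biUnion_finset_le _ _
    _ ≤ ∑ I ∈ (Finset.range k).powerset.filter fun I => k ≤ 2 * I.card,
          P.real E * (1 / 12) ^ k := by
        refine Finset.sum_le_sum fun I hI => ?_
        simp only [Finset.mem_filter, Finset.mem_powerset] at hI
        refine (measureReal_inter_batches_le hf hr hs hπ hlen hE hEs I
          fun i hi => Finset.mem_range.1 (hI.1 hi)).trans
          (mul_le_mul_of_nonneg_left ?_ measureReal_nonneg)
        -- `160 ≥ 12²`, and `2 |I| ≥ k`.
        calc ((1 : ℝ) / 160) ^ I.card ≤ ((1 / 12) ^ 2) ^ I.card :=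
              pow_le_pow_left₀ (by norm_num) (by norm_num) _
          _ = (1 / 12) ^ (2 * I.card) := (pow_mul _ _ _).symm
          _ ≤ (1 / 12) ^ k := pow_le_pow_of_le_one (by norm_num) (by norm_num) hI.2
    _ ≤ 2 ^ k * (P.real E * (1 / 12) ^ k) := by
        rw [Finset.sum_const, nsmul_eq_mul]
        refine mul_le_mul_of_nonneg_right ?_ (by positivity)
        have := Finset.card_filter_le (Finset.range k).powerset fun I => k ≤ 2 * I.card
        rw [Finset.card_powerset, Finset.card_range] at this
        exact_mod_cast this
    _ = P.real E * (1 / 6) ^ k := by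
        rw [mul_left_comm, ← mul_pow]
        norm_num

/-! ### The invariants along a run -/

theorem survivors_nonempty (c : Config X A) (obs : ℕ → Round X A) (hs : s.active.Nonempty) :
    (c.survivors obs s).Nonempty := by
  classical
  obtain ⟨π, hπ, hmin⟩ := s.active.exists_min_image (c.lossEstimate obs s) hs
  exact ⟨π, Finset.mem_filter.2 ⟨hπ, fun π' hπ' => by
    have := hmin π' hπ'
    have := radius_pos s.epoch
    linarith⟩⟩

theorem admissible_state (hne : c.policies.Nonempty) (obs : ℕ → Round X A) (t : ℕ) :
    Admissible c (c.state obs t) := by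
  refine ⟨c.one_le_state_epoch obs t, c.state_active_subset obs t, ?_⟩
  induction t with
  | zero => exact hne
  | succ t ih =>
    rcases c.state_succ_cases obs t with ⟨-, h⟩ | ⟨-, h⟩ <;> rw [h]
    · exact ih
    · exact survivors_nonempty c obs ih

/-- Some estimate of an epoch that ends before the horizon is off by more than the radius. -/
def Misled (c : Config X A) (D : Problem X Y A) (obs : ℕ → Round X A) : Prop :=
  ∃ t < c.horizon, (c.state obs t).start = t ∧
    t + c.stateLength (c.state obs t) ≤ c.horizon ∧ ∃ π ∈ (c.state obs t).active,
      radius (c.state obs t).epoch <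
        |c.lossEstimate obs (c.state obs t) π - smoothedLoss c.base c.bandwidth D π|

theorem sum_measureReal_state_le (hf : Fits c D α) (hr : IsRun c D P x y a) (t : ℕ)
    (S : Finset (EpochState X A)) :
    ∑ s ∈ S, P.real {ω | c.state (observations D x y a ω) t = s} ≤ 1 := by
  have := hf.isProb
  rw [← measureReal_biUnion_finset]
  · exact measureReal_le_one
  · intro s _ s' _ hne
    refine Set.disjoint_left.2 fun ω h h' => hne ?_
    simp only [Set.mem_ofPred_eq] at h h'
    rw [← h, ← h']
  · exact fun s _ => past_le hr t _ (measurableSet_past_state_eq hf.measurable_policy t s)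

/-- Union bound over the round in which the epoch starts, its state and an active policy. States
exclude each other, so for each round their probabilities add up to at most one and their number
does not matter. -/
theorem measureReal_misled_le (hf : Fits c D α) (hr : IsRun c D P x y a)
    (hne : c.policies.Nonempty) (hk : 0 < c.numBatches) :
    P.real {ω | Misled c D (observations D x y a ω)} ≤
      c.horizon * (c.policies.card * (1 / 6) ^ c.numBatches) := by
  classical
  have := hf.isProb
  set st : ℕ → EpochState X A → Set Ω := fun t s =>
    {ω | c.state (observations D x y a ω) t = s} with hst
  set ok : ℕ → Finset (EpochState X A) := fun t => (possibleStates c t).filter fun s =>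
    s.start = t ∧ t + c.stateLength s ≤ c.horizon ∧ Admissible c s with hok
  have hsub : {ω | Misled c D (observations D x y a ω)} ⊆
      ⋃ t ∈ Finset.range c.horizon, ⋃ s ∈ ok t, ⋃ π ∈ s.active,
        st t s ∩ {ω | radius s.epoch < |c.lossEstimate (observations D x y a ω) s π -
          smoothedLoss c.base c.bandwidth D π|} := by
    rintro ω ⟨t, ht, hstart, hlen, π, hπ, hrad⟩
    simp only [Set.mem_iUnion, exists_prop]
    exact ⟨t, Finset.mem_range.2 ht, c.state (observations D x y a ω) t,
      Finset.mem_filter.2 ⟨state_mem_possibleStates c _ t, hstart, hlen,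
        admissible_state hne _ t⟩, π, hπ, rfl, hrad⟩
  have hone : ∀ t, ∀ s ∈ ok t, ∀ π ∈ s.active,
      P.real (st t s ∩ {ω | radius s.epoch < |c.lossEstimate (observations D x y a ω) s π -
          smoothedLoss c.base c.bandwidth D π|}) ≤ P.real (st t s) * (1 / 6) ^ c.numBatches := by
    intro t s hs π hπ
    obtain ⟨-, hstart, hlen, hadm⟩ := Finset.mem_filter.1 hs
    subst hstart
    exact measureReal_inter_lossEstimate_le hf hr hadm hπ hlen hk
      (measurableSet_past_state_eq hf.measurable_policy _ s) fun ω hω => hω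
  have hη : (0 : ℝ) ≤ (1 / 6) ^ c.numBatches := by positivity
  calc _ ≤ P.real (⋃ t ∈ Finset.range c.horizon, ⋃ s ∈ ok t, ⋃ π ∈ s.active,
        st t s ∩ {ω | radius s.epoch < |c.lossEstimate (observations D x y a ω) s π -
          smoothedLoss c.base c.bandwidth D π|}) := measureReal_mono hsub (measure_ne_top _ _)
    _ ≤ ∑ t ∈ Finset.range c.horizon, ∑ s ∈ ok t, ∑ π ∈ s.active,
        P.real (st t s ∩ {ω | radius s.epoch < |c.lossEstimate (observations D x y a ω) s π -
          smoothedLoss c.base c.bandwidth D π|}) :=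
        (measureReal_biUnion_finset_le _ _).trans (Finset.sum_le_sum fun t _ =>
          (measureReal_biUnion_finset_le _ _).trans (Finset.sum_le_sum fun s _ =>
            measureReal_biUnion_finset_le _ _))
    _ ≤ ∑ t ∈ Finset.range c.horizon, ∑ s ∈ ok t,
        P.real (st t s) * (c.policies.card * (1 / 6) ^ c.numBatches) := by
        refine Finset.sum_le_sum fun t _ => Finset.sum_le_sum fun s hs => ?_
        have hadm := (Finset.mem_filter.1 hs).2.2.2
        refine (Finset.sum_le_sum (hone t s hs)).trans ?_
        rw [Finset.sum_const, nsmul_eq_mul, mul_left_comm]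
        refine mul_le_mul_of_nonneg_left (mul_le_mul_of_nonneg_right ?_ hη) measureReal_nonneg
        exact_mod_cast Finset.card_le_card hadm.active_subset
    _ ≤ ∑ t ∈ Finset.range c.horizon, (c.policies.card * (1 / 6) ^ c.numBatches : ℝ) := by
        refine Finset.sum_le_sum fun t _ => ?_
        rw [← Finset.sum_mul]
        exact mul_le_of_le_one_left (by positivity) (sum_measureReal_state_le hf hr t _)
    _ = _ := by simp

end

section

variable {X Y A Ω : Type*} [MeasurableSpace X] [MeasurableSpace Y] [MetricSpace A]
  [MeasurableSpace A] [BorelSpace A] [SecondCountableTopology A] [mΩ : MeasurableSpace Ω]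
  {c : Config X A} {D : Problem X Y A} {α : ℝ} {s : EpochState X A} {π : X → A}
  {x : ℕ → Ω → X} {y : ℕ → Ω → Y} {a : ℕ → Ω → A} {P : Measure Ω} [IsProbabilityMeasure P]

/-! ### The regret -/

theorem bench_nonneg (hf : Fits c D α) (hne : c.policies.Nonempty) :
    0 ≤ bench c.base c.bandwidth D c.policies := by
  have := hf.isProb
  obtain ⟨π, hπ, he⟩ := exists_smoothedLoss_eq_bench (ν := c.base) (h := c.bandwidth) (D := D) hne
  rw [← he]
  exact smoothedLoss_nonneg hf (hf.measurable_policy π hπ)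

theorem radius_le_one (m : ℕ) : radius m ≤ 1 := pow_le_one₀ (by norm_num) (by norm_num)

/-- As long as the estimates are accurate, an optimal policy stays active, and all active policies
are nearly optimal. -/
theorem active_nearOptimal (hf : Fits c D α) (hne : c.policies.Nonempty) {obs : ℕ → Round X A}
    (hobs : ¬ Misled c D obs) {πopt : X → A} (hopt : πopt ∈ c.policies)
    (hbench : smoothedLoss c.base c.bandwidth D πopt = bench c.base c.bandwidth D c.policies)
    {t : ℕ} (ht : t < c.horizon) :
    πopt ∈ (c.state obs t).active ∧ ∀ π ∈ (c.state obs t).active,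
      smoothedLoss c.base c.bandwidth D π ≤
        bench c.base c.bandwidth D c.policies + 12 * radius (c.state obs t).epoch := by
  classical
  have := hf.isProb
  induction t with
  | zero =>
    refine ⟨hopt, fun π hπ => ?_⟩
    have h1 := smoothedLoss_le_one hf (hf.measurable_policy π hπ)
    have h2 := bench_nonneg hf hne
    -- In the first epoch the claim is trivial: `12 r_1 = 6`, while losses lie in `[0, 1]`.
    have h3 : radius (c.state obs 0).epoch = 1 / 2 := pow_one _
    rw [h3]
    linarith
  | succ t ih =>
    have ih := ih (by omega)
    rcases c.state_succ_cases obs t with ⟨-, h⟩ | ⟨hle, h⟩ <;> rw [h]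
    · exact ih
    · set s := c.state obs t with hs
      have hstart : c.state obs s.start = s := c.state_start_eq obs t
      -- The epoch has ended by round `t + 1`, which is before the horizon, so it is covered by
      -- `Misled`.
      have hacc : ∀ π ∈ s.active, |c.lossEstimate obs s π -
          smoothedLoss c.base c.bandwidth D π| ≤ radius s.epoch := by
        intro π hπ
        by_contra hcon
        refine hobs ⟨s.start, ?_, ?_, ?_, π, ?_, ?_⟩
        · exact (c.state_start_le obs t).trans_lt (by omega)
        · rw [hstart]
        · rw [hstart]; omega
        · rw [hstart]; exact hπ
        · rw [hstart]; exact not_le.1 hcon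
      have hb : ∀ π ∈ s.active, bench c.base c.bandwidth D c.policies ≤
          smoothedLoss c.base c.bandwidth D π := fun π hπ =>
        bench_le_smoothedLoss (c.state_active_subset obs t hπ)
      have ho := abs_le.1 (hacc πopt ih.1)
      have hr := radius_pos s.epoch
      -- The optimal policy loses at most `2 r_m` in the comparison of estimates, less than the
      -- threshold `3 r_m`. A survivor satisfies `λ ≤ λ* + 5 r_m`, and `5 r_m ≤ 12 r_{m+1} = 6 r_m`.
      refine ⟨Finset.mem_filter.2 ⟨ih.1, fun π hπ => ?_⟩, fun π hπ => ?_⟩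
      · have h1 := abs_le.1 (hacc π hπ)
        have h2 := hb π hπ
        linarith
      · obtain ⟨hπ, hsur⟩ := Finset.mem_filter.1 hπ
        have h1 := abs_le.1 (hacc π hπ)
        have h2 := hsur πopt ih.1
        have h3 := radius_succ s.epoch
        simp only
        linarith [radius_pos (s.epoch + 1)]

/-- The expected loss of a round that is played in state `s`. -/
def roundLoss (c : Config X A) (D : Problem X Y A) (s : EpochState X A) : ℝ :=
  ∫ z, D.loss z.1.2 z.2 ∂(sampleLaw c D s.epoch s.active)

theorem roundLoss_le_two (hf : Fits c D α) (hs : Admissible c s) : roundLoss c D s ≤ 2 := by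
  have := integral_loss_le hf hs (b := 1) fun π hπ =>
    smoothedLoss_le_one hf (hf.measurable_policy π (hs.active_subset hπ))
  have := radius_le_one s.epoch
  unfold roundLoss
  linarith

/-- Splits a random quantity over the finitely many possible states, so that each piece is treated
with a fixed state. -/
theorem sum_indicator_state (c : Config X A) (D : Problem X Y A) (t : ℕ)
    (f : EpochState X A → Ω → ℝ) (ω : Ω) :
    ∑ s ∈ possibleStates c t,
      {ω | c.state (observations D x y a ω) t = s}.indicator (f s) ω =
        f (c.state (observations D x y a ω) t) ω := by
  rw [Finset.sum_eq_single (c.state (observations D x y a ω) t)]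
  · exact Set.indicator_of_mem (by rfl) _
  · intro s _ hs
    exact Set.indicator_of_notMem (fun h => hs (by simpa using h.symm)) _
  · exact fun h => absurd (state_mem_possibleStates c _ t) h

theorem measurableSet_state (hf : Fits c D α) (hr : IsRun c D P x y a) (t : ℕ)
    (s : EpochState X A) :
    MeasurableSet {ω | c.state (observations D x y a ω) t = s} := by
  have := hf.isProb
  exact past_le hr t _ (measurableSet_past_state_eq hf.measurable_policy t s)

theorem integrable_roundLoss_state (hf : Fits c D α) (hr : IsRun c D P x y a) (t : ℕ) :
    Integrable (fun ω => roundLoss c D (c.state (observations D x y a ω) t)) P := by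
  have : (fun ω => roundLoss c D (c.state (observations D x y a ω) t)) = fun ω =>
      ∑ s ∈ possibleStates c t, {ω | c.state (observations D x y a ω) t = s}.indicator
        (fun _ => roundLoss c D s) ω := by
    ext ω
    exact (sum_indicator_state c D t (fun s _ => roundLoss c D s) ω).symm
  rw [this]
  exact integrable_finsetSum _ fun s _ =>
    (integrable_const _).indicator (measurableSet_state hf hr t s)

theorem measurable_loss_run (hr : IsRun c D P x y a) (t : ℕ) :
    Measurable fun ω => D.loss (y t ω) (a t ω) :=
  D.measurable_loss.comp ((hr.measurable_label t).prodMk (hr.measurable_action t))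

theorem integrable_loss_run (hr : IsRun c D P x y a) (t : ℕ) :
    Integrable (fun ω => D.loss (y t ω) (a t ω)) P :=
  integrable_of_abs_le (measurable_loss_run hr t) fun _ => abs_loss_le D _ _

theorem integral_loss_run (hf : Fits c D α) (hr : IsRun c D P x y a)
    (hne : c.policies.Nonempty) {t : ℕ} (ht : t < c.horizon) :
    ∫ ω, D.loss (y t ω) (a t ω) ∂P =
      ∫ ω, roundLoss c D (c.state (observations D x y a ω) t) ∂P := by
  have hms := measurableSet_state hf hr t
  have h1 : ∀ ω, D.loss (y t ω) (a t ω) =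
      ∑ s ∈ possibleStates c t, {ω | c.state (observations D x y a ω) t = s}.indicator
        (fun ω => D.loss (y t ω) (a t ω)) ω := fun ω =>
    (sum_indicator_state c D t (fun _ ω => D.loss (y t ω) (a t ω)) ω).symm
  have h2 : ∀ ω, roundLoss c D (c.state (observations D x y a ω) t) =
      ∑ s ∈ possibleStates c t, {ω | c.state (observations D x y a ω) t = s}.indicator
        (fun _ => roundLoss c D s) ω := fun ω =>
    (sum_indicator_state c D t (fun s _ => roundLoss c D s) ω).symm
  rw [integral_congr_ae (Filter.Eventually.of_forall h1),
    integral_congr_ae (Filter.Eventually.of_forall h2),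
    integral_finsetSum _ fun s _ => (integrable_loss_run hr t).indicator (hms s),
    integral_finsetSum _ fun s _ => (integrable_const _).indicator (hms s)]
  refine Finset.sum_congr rfl fun s _ => ?_
  rw [integral_indicator (hms s), integral_indicator (hms s), setIntegral_const, smul_eq_mul]
  -- A possible state that is never reached need not be admissible, but its event is empty.
  by_cases hemp : ∃ ω, c.state (observations D x y a ω) t = s
  · obtain ⟨ω₀, hω₀⟩ := hemp
    have hadm : Admissible c s := hω₀ ▸ admissible_state hne _ t
    have := hf.isProb
    have hmap := map_restrict_sample hf hr ht hadm
      (measurableSet_past_state_eq hf.measurable_policy t s) fun ω hω => hω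
    have h3 := integral_map (μ := P.restrict {ω | c.state (observations D x y a ω) t = s})
      (measurable_sample hr t).aemeasurable
      (f := fun z : (X × Y) × A => D.loss z.1.2 z.2) (measurable_loss_sample D).aestronglyMeasurable
    rw [hmap, integral_smul_measure] at h3
    exact h3.symm
  · have : {ω | c.state (observations D x y a ω) t = s} = ∅ := by
      ext ω
      simpa using fun h => hemp ⟨ω, h⟩
    rw [this]
    simp

/-- Since `κ V / r² ≥ 1`, rounding up the batch size turns `320` into `321`; then the volume is
replaced by the packing number. -/
theorem stateLength_le (hf : Fits c D α) (hs : Admissible c s) {ε : ℝ} (hε : 0 ≤ ε)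
    (hact : ∀ π ∈ s.active, π ∈ nearOptimal c.base c.bandwidth D c.policies ε) :
    (c.stateLength s : ℝ) ≤ 321 * c.numBatches * α *
      expectedPacking c.base c.bandwidth D c.policies ε c.bandwidth / radius s.epoch ^ 2 := by
  have := hf.isProb
  have hr := radius_pos s.epoch
  have hr1 : radius s.epoch ^ 2 ≤ 1 := pow_le_one₀ hr.le (radius_le_one _)
  have h1 := one_le_kap_mul_charVolume hf hs
  have h2 := kappa_mul_charVolume_le hf.ctxLaw_eq hf.bounds hf.measurable_policy
    (hs.active_nonempty.mono hs.active_subset) hε hact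
  have h3 : (c.batchSize s.epoch s.active : ℝ) <
      320 * c.kap * c.charVolume s.active / radius s.epoch ^ 2 + 1 :=
    Nat.ceil_lt_add_one (by
      rw [mul_assoc]
      have := pow_pos hr 2
      positivity)
  have h4 : (1 : ℝ) ≤ c.kap * c.charVolume s.active / radius s.epoch ^ 2 := by
    rw [le_div_iff₀ (pow_pos hr 2)]
    linarith
  have h5 : (c.batchSize s.epoch s.active : ℝ) ≤ 321 * (α *
      expectedPacking c.base c.bandwidth D c.policies ε c.bandwidth / radius s.epoch ^ 2) := by
    calc (c.batchSize s.epoch s.active : ℝ)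
        ≤ 321 * (c.kap * c.charVolume s.active / radius s.epoch ^ 2) := by
          rw [mul_assoc, mul_div_assoc] at h3
          linarith
      _ ≤ _ := by gcongr
  have : (c.stateLength s : ℝ) = c.batchSize s.epoch s.active * c.numBatches := by
    unfold Config.stateLength Config.epochLength
    push_cast
    ring
  rw [this]
  calc _ ≤ 321 * (α * expectedPacking c.base c.bandwidth D c.policies ε c.bandwidth /
        radius s.epoch ^ 2) * c.numBatches := mul_le_mul_of_nonneg_right h5 (Nat.cast_nonneg _)
    _ = _ := by ring

theorem stateLength_pos (hf : Fits c D α) (hk : 0 < c.numBatches) (hs : Admissible c s) :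
    1 ≤ c.stateLength s :=
  Nat.mul_pos (batchSize_pos hf hs) hk

/-- If the estimates are accurate, then the conditional regret is controlled by the lengths of the
epochs of large radius. -/
theorem sum_roundLoss_le (hf : Fits c D α) (hne : c.policies.Nonempty) (hk : 0 < c.numBatches)
    {obs : ℕ → Round X A} (hobs : ¬ Misled c D obs) {M : ℕ} {ε : ℝ} (hε0 : 0 ≤ ε)
    (hε : ∀ m, M < m → radius m ≤ ε) :
    ∑ t ∈ Finset.range c.horizon, roundLoss c D (c.state obs t) ≤
      c.horizon * bench c.base c.bandwidth D c.policies + 13 * (c.horizon * ε +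
        ∑ m ∈ Finset.Icc 1 M, 321 * c.numBatches * α *
          (expectedPacking c.base c.bandwidth D c.policies (12 * radius m) c.bandwidth /
            radius m)) := by
  have := hf.isProb
  obtain ⟨πopt, hopt, hbench⟩ :=
    exists_smoothedLoss_eq_bench (ν := c.base) (h := c.bandwidth) (D := D) hne
  have hact := fun t (ht : t < c.horizon) =>
    (active_nearOptimal hf hne hobs hopt hbench ht).2
  have hadm := fun t => admissible_state hne obs t
  have hα : 0 ≤ α := by
    obtain ⟨x₀⟩ : Nonempty X := by
      have := D.isProb
      exact D.law.fst.nonempty_of_neZero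
    exact zero_le_one.trans (hf.bounds.one_le_alpha (πopt x₀))
  set b : ℕ → ℝ := fun m => 321 * c.numBatches * α *
    expectedPacking c.base c.bandwidth D c.policies (12 * radius m) c.bandwidth /
      radius m ^ 2 with hb
  have hb0 : ∀ m, 0 ≤ b m := fun m => by
    have h1 := radius_pos m
    have h2 : 0 ≤ expectedPacking c.base c.bandwidth D c.policies (12 * radius m) c.bandwidth :=
      zero_le_one.trans (one_le_expectedPacking hf.measurable_policy hf.bounds.radius_pos hne
        (by linarith))
    positivity
  have hsum := c.sum_radius_le obs (T := c.horizon) (M := M) hb0 hε0 hε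
    (fun t _ => stateLength_pos hf hk (hadm t)) fun t ht =>
      stateLength_le hf (hadm t) (by have := radius_pos (c.state obs t).epoch; linarith)
        fun π hπ => ⟨c.state_active_subset obs t hπ, hact t ht π hπ⟩
  -- `12 r_m` from the suboptimality of active policies and `r_m` from exploration.
  have hround : ∀ t ∈ Finset.range c.horizon, roundLoss c D (c.state obs t) ≤
      bench c.base c.bandwidth D c.policies + 13 * radius (c.state obs t).epoch := fun t ht => by
    have := integral_loss_le hf (hadm t) (hact t (Finset.mem_range.1 ht))
    unfold roundLoss
    linarith
  calc _ ≤ ∑ t ∈ Finset.range c.horizon, (bench c.base c.bandwidth D c.policies +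
        13 * radius (c.state obs t).epoch) := Finset.sum_le_sum hround
    _ = c.horizon * bench c.base c.bandwidth D c.policies +
        13 * ∑ t ∈ Finset.range c.horizon, radius (c.state obs t).epoch := by
        rw [Finset.sum_add_distrib, Finset.mul_sum]
        simp
    _ ≤ _ := by
        refine add_le_add le_rfl (mul_le_mul_of_nonneg_left (hsum.trans (le_of_eq ?_))
          (by norm_num))
        congr 1
        refine Finset.sum_congr rfl fun m _ => ?_
        have := (radius_pos m).ne'
        simp only [hb]
        field_simp

theorem regret_le_horizon (hf : Fits c D α) (hr : IsRun c D P x y a)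
    (hne : c.policies.Nonempty) :
    regret c.base c.bandwidth D c.policies c.horizon P y a ≤ c.horizon := by
  have h1 : ∫ ω, ∑ t ∈ Finset.range c.horizon, D.loss (y t ω) (a t ω) ∂P ≤ c.horizon := by
    calc _ ≤ ∫ _, (c.horizon : ℝ) ∂P := by
          refine integral_mono (integrable_finsetSum _ fun t _ => integrable_loss_run hr t)
            (integrable_const _) fun ω => ?_
          refine (Finset.sum_le_sum fun t _ => (D.loss_mem (y t ω) (a t ω)).2).trans ?_
          simp
      _ = _ := by simp
  have h2 := mul_nonneg (Nat.cast_nonneg (α := ℝ) c.horizon) (bench_nonneg hf hne)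
  unfold regret
  linarith

/-- Expected losses are replaced by conditional ones given the state, which are bounded pathwise
when the estimates are accurate; otherwise each is at most `2`. -/
theorem regret_le (hf : Fits c D α) (hr : IsRun c D P x y a) (hne : c.policies.Nonempty)
    (hk : 0 < c.numBatches) {M : ℕ} {ε : ℝ} (hε0 : 0 ≤ ε) (hε : ∀ m, M < m → radius m ≤ ε) :
    regret c.base c.bandwidth D c.policies c.horizon P y a ≤
      13 * (c.horizon * ε + ∑ m ∈ Finset.Icc 1 M, 321 * c.numBatches * α *
        (expectedPacking c.base c.bandwidth D c.policies (12 * radius m) c.bandwidth /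
          radius m)) +
      2 * c.horizon * (c.horizon * (c.policies.card * (1 / 6) ^ c.numBatches)) := by
  set R := 13 * (c.horizon * ε + ∑ m ∈ Finset.Icc 1 M, 321 * c.numBatches * α *
    (expectedPacking c.base c.bandwidth D c.policies (12 * radius m) c.bandwidth /
      radius m)) with hR
  -- A measurable hull of the same probability, so measurability of the bad event itself is not
  -- needed.
  set Bad := toMeasurable P {ω | Misled c D (observations D x y a ω)} with hBad
  have hBm : MeasurableSet Bad := measurableSet_toMeasurable _ _
  have hα : 0 ≤ R := by
    have := hf.isProb
    obtain ⟨x₀⟩ : Nonempty X := by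
      have := D.isProb
      exact D.law.fst.nonempty_of_neZero
    obtain ⟨π, -⟩ := hne
    have hα := zero_le_one.trans (hf.bounds.one_le_alpha (π x₀))
    have : ∀ m, 0 ≤ expectedPacking c.base c.bandwidth D c.policies (12 * radius m) c.bandwidth :=
      fun m => integral_nonneg fun _ => Nat.cast_nonneg _
    have hrad := fun m => (radius_pos m).le
    have : 0 ≤ ∑ m ∈ Finset.Icc 1 M, 321 * c.numBatches * α *
        (expectedPacking c.base c.bandwidth D c.policies (12 * radius m) c.bandwidth /
          radius m) := Finset.sum_nonneg fun m _ => by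
      have := this m
      have := hrad m
      positivity
    positivity
  have hb0 := bench_nonneg hf hne
  have hBP : P.real Bad ≤ c.horizon * (c.policies.card * (1 / 6) ^ c.numBatches) := by
    have := measureReal_misled_le hf hr hne hk
    rwa [measureReal_def, ← measure_toMeasurable] at this
  have hpt : ∀ ω, ∑ t ∈ Finset.range c.horizon,
      roundLoss c D (c.state (observations D x y a ω) t) ≤
      c.horizon * bench c.base c.bandwidth D c.policies + R +
        Bad.indicator (fun _ => 2 * (c.horizon : ℝ)) ω := by
    intro ω
    by_cases hω : Misled c D (observations D x y a ω)
    · rw [Set.indicator_of_mem (subset_toMeasurable P _ hω)]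
      have : ∑ t ∈ Finset.range c.horizon, roundLoss c D (c.state (observations D x y a ω) t) ≤
          2 * c.horizon := by
        refine (Finset.sum_le_sum fun t _ =>
          roundLoss_le_two hf (admissible_state hne _ t)).trans ?_
        simp [mul_comm]
      have := mul_nonneg (Nat.cast_nonneg (α := ℝ) c.horizon) hb0
      linarith
    · have h1 := sum_roundLoss_le hf hne hk hω hε0 hε
      have h2 : 0 ≤ Bad.indicator (fun _ => 2 * (c.horizon : ℝ)) ω :=
        Set.indicator_nonneg (fun _ _ => by positivity) _
      linarith
  have hmain : ∫ ω, ∑ t ∈ Finset.range c.horizon, D.loss (y t ω) (a t ω) ∂P ≤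
      c.horizon * bench c.base c.bandwidth D c.policies + R + 2 * c.horizon * P.real Bad := by
    calc _ = ∫ ω, ∑ t ∈ Finset.range c.horizon,
          roundLoss c D (c.state (observations D x y a ω) t) ∂P := by
          rw [integral_finsetSum _ fun t _ => integrable_loss_run hr t,
            integral_finsetSum _ fun t _ => integrable_roundLoss_state hf hr t]
          exact Finset.sum_congr rfl fun t ht =>
            integral_loss_run hf hr hne (Finset.mem_range.1 ht)
      _ ≤ ∫ ω, (c.horizon * bench c.base c.bandwidth D c.policies + R +
          Bad.indicator (fun _ => 2 * (c.horizon : ℝ)) ω) ∂P :=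
          integral_mono (integrable_finsetSum _ fun t _ => integrable_roundLoss_state hf hr t)
            ((integrable_const _).add ((integrable_const _).indicator hBm)) hpt
      _ = _ := by
          rw [integral_add (integrable_const _) ((integrable_const _).indicator hBm),
            integral_indicator hBm, setIntegral_const]
          simp only [integral_const, probReal_univ, smul_eq_mul, one_mul]
          ring
  have := mul_le_mul_of_nonneg_left hBP (by positivity : (0 : ℝ) ≤ 2 * c.horizon)
  unfold regret
  linarith

end

section

/-! ### Summation over the epochs -/

theorem sum_Icc_two_pow_le (n : ℕ) : ∑ m ∈ Finset.Icc 1 n, (2 : ℝ) ^ m ≤ 2 * 2 ^ n := by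
  induction n with
  | zero => simp
  | succ n ih =>
    rw [Finset.sum_Icc_succ_top (by omega), pow_succ]
    linarith

theorem sum_Icc_add_le {f : ℕ → ℝ} {θ : ℝ} (n j : ℕ) (hf : ∀ m ∈ Finset.Icc 1 (n + j), f m ≤ θ) :
    ∑ m ∈ Finset.Icc 1 (n + j), f m ≤ ∑ m ∈ Finset.Icc 1 n, f m + j * θ := by
  induction j with
  | zero => simp
  | succ j ih =>
    have h1 := ih fun m hm => hf m (by simp only [Finset.mem_Icc] at hm ⊢; omega)
    have h2 := hf (n + j + 1) (by simp only [Finset.mem_Icc]; omega)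
    rw [← add_assoc, Finset.sum_Icc_succ_top (by omega)]
    push_cast
    linarith

/-- A family that is bounded by `θ` and by `p 2 ^ m` has few terms of size `θ`. -/
theorem sum_Icc_le_of_le_mul_two_pow {f : ℕ → ℝ} {θ p : ℝ} {M j : ℕ}
    (hθ : ∀ m ∈ Finset.Icc 1 M, f m ≤ θ) (hp : ∀ m ∈ Finset.Icc 1 M, f m ≤ p * 2 ^ m)
    (hM : 2 ^ M ≤ θ) (hj : p ≤ 2 ^ j) :
    ∑ m ∈ Finset.Icc 1 M, f m ≤ (2 + j) * θ := by
  have hθ0 : 0 < θ := (by positivity : (0 : ℝ) < 2 ^ M).trans_le hM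
  rcases le_total j M with h | h
  -- All but the last `j` terms form a geometric sum of size at most `2 · 2^j · 2^n = 2 · 2^M ≤ 2
  -- θ`.
  · obtain ⟨n, rfl⟩ := Nat.exists_eq_add_of_le' h
    have h1 : ∑ m ∈ Finset.Icc 1 n, f m ≤ 2 * θ := by
      calc _ ≤ ∑ m ∈ Finset.Icc 1 n, p * 2 ^ m := Finset.sum_le_sum fun m hm =>
            hp m (by simp only [Finset.mem_Icc] at hm ⊢; omega)
        _ = p * ∑ m ∈ Finset.Icc 1 n, 2 ^ m := (Finset.mul_sum _ _ _).symm
        _ ≤ 2 ^ j * (2 * 2 ^ n) := mul_le_mul hj (sum_Icc_two_pow_le n)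
            (Finset.sum_nonneg fun _ _ => by positivity) (by positivity)
        _ = 2 * 2 ^ (n + j) := by rw [pow_add]; ring
        _ ≤ 2 * θ := by linarith
    have h2 := sum_Icc_add_le n j hθ
    linarith
  · calc _ ≤ ∑ _m ∈ Finset.Icc 1 M, θ := Finset.sum_le_sum hθ
      _ = M * θ := by simp
      _ ≤ (2 + j) * θ := by
          have : (M : ℝ) ≤ j := by exact_mod_cast h
          exact mul_le_mul_of_nonneg_right (by linarith) hθ0.le

/-- The `log T` in the number of batches is absorbed by the other terms. -/
theorem batches_mul_sum_le {f : ℕ → ℝ} {θ ε k T : ℝ} {M p : ℕ} {L : ℝ}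
    (hT : 2 ≤ T) (hp1 : 1 ≤ p) (hL : Real.log p ≤ L) (hL0 : 1 / 3 ≤ L)
    (hk : k ≤ 15 * (Real.log T + L)) (hε0 : 0 < ε) (hε : ε ≤ 1 / 2)
    (hM : 2 ^ M ≤ 1 / ε) (hθε : 1 / ε ≤ θ) (hf0 : ∀ m ∈ Finset.Icc 1 M, 0 ≤ f m)
    (hθ : ∀ m ∈ Finset.Icc 1 M, f m ≤ θ) (hp : ∀ m ∈ Finset.Icc 1 M, f m ≤ p * 2 ^ m) :
    k * ∑ m ∈ Finset.Icc 1 M, f m ≤ 500 * (T * ε + θ * L * Real.log (1 / ε)) := by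
  set S := ∑ m ∈ Finset.Icc 1 M, f m with hS
  set τ := Real.log T with hτ
  set l := Real.log (1 / ε) with hl
  have hlog2 : (1 : ℝ) / 2 ≤ Real.log 2 := by have := Real.log_two_gt_d9; linarith
  have hτ0 : 1 / 2 ≤ τ := hlog2.trans (Real.log_le_log (by norm_num) hT)
  have hS0 : 0 ≤ S := Finset.sum_nonneg hf0
  have h2ε : 2 ≤ 1 / ε := by rw [le_div_iff₀ hε0]; linarith
  have hl0 : 1 / 2 ≤ l := hlog2.trans (Real.log_le_log (by norm_num) h2ε)
  have hθ0 : 0 < θ := by linarith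
  have hTε : 0 ≤ T * ε := by positivity
  have hMl : (M : ℝ) ≤ 2 * l := by
    have := Real.log_le_log (by positivity) hM
    rw [Real.log_pow] at this
    nlinarith [Nat.cast_nonneg (α := ℝ) M]
  have hS1 : S ≤ 2 * l * θ := by
    calc S ≤ ∑ _m ∈ Finset.Icc 1 M, θ := Finset.sum_le_sum hθ
      _ = M * θ := by simp
      _ ≤ _ := mul_le_mul_of_nonneg_right hMl hθ0.le
  have hprod : 0 ≤ θ * L * l := by positivity
  -- If `log T` is of order `L`, then so is `k`, and the number of terms is at most `2 log (1/ε)`.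
  rcases le_or_gt τ (10 * L) with hτL | hτL
  · have hk' : k ≤ 165 * L := by linarith
    calc k * S ≤ (165 * L) * (2 * l * θ) := mul_le_mul hk' hS1 hS0 (by linarith)
      _ = 330 * (θ * L * l) := by ring
      _ ≤ _ := by linarith
  have hk' : k ≤ 17 * τ := by linarith
  -- From here on `L < τ / 10`, whence `p ≤ T^{1/10}` and `k ≤ 16.5 τ`.
  rcases le_or_gt l (2 / 5 * τ) with hlτ | hlτ
  · have hS2 : S ≤ 2 * (p * (1 / ε)) := by
      calc S ≤ ∑ m ∈ Finset.Icc 1 M, (p : ℝ) * 2 ^ m := Finset.sum_le_sum hp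
        _ = p * ∑ m ∈ Finset.Icc 1 M, 2 ^ m := (Finset.mul_sum _ _ _).symm
        _ ≤ p * (2 * 2 ^ M) := mul_le_mul_of_nonneg_left (sum_Icc_two_pow_le M) (by positivity)
        _ ≤ p * (2 * (1 / ε)) := by gcongr
        _ = _ := by ring
    have hp0 : (0 : ℝ) < p := by exact_mod_cast hp1
    have hpe : (p : ℝ) ≤ Real.exp (τ / 10) := by
      rw [← Real.exp_log hp0]
      exact Real.exp_le_exp.2 (by linarith)
    have hεe : 1 / ε ≤ Real.exp (2 / 5 * τ) := by
      rw [← Real.exp_log (by positivity : 0 < 1 / ε)]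
      exact Real.exp_le_exp.2 hlτ
    have hτe : τ ≤ 10 * Real.exp (τ / 10) := by
      have := Real.add_one_le_exp (τ / 10)
      linarith
    have hTe : T = Real.exp τ := (Real.exp_log (by linarith)).symm
    -- The exponents add up to one: `τ ≤ 10 T^{1/10}`, `p ≤ T^{1/10}`, and two factors `1/ε ≤
    -- T^{2/5}`. Hence the geometric bound on the sum is below `T ε`.
    have key : τ * p * (1 / ε) * (1 / ε) ≤ 10 * T := by
      calc τ * p * (1 / ε) * (1 / ε)
          ≤ (10 * Real.exp (τ / 10)) * Real.exp (τ / 10) * Real.exp (2 / 5 * τ) *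
            Real.exp (2 / 5 * τ) := by gcongr
        _ = 10 * T := by
            rw [hTe, mul_assoc, mul_assoc, mul_assoc, ← Real.exp_add, ← Real.exp_add,
              ← Real.exp_add]
            congr 2
            ring
    have key2 : τ * p * (1 / ε) ≤ 10 * (T * ε) := by
      have := mul_le_mul_of_nonneg_right key hε0.le
      rw [mul_assoc _ (1 / ε) ε, one_div_mul_cancel hε0.ne', mul_one] at this
      linarith
    calc k * S ≤ (17 * τ) * (2 * (p * (1 / ε))) := mul_le_mul hk' hS2 hS0 (by linarith)
      _ = 34 * (τ * p * (1 / ε)) := by ring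
      _ ≤ _ := by linarith
  -- Now `τ < (5/2) log (1/ε)`, so `k` supplies the factor `log (1/ε)`. Only about `log₂ p` terms
  -- are of size `θ`, so the sum supplies `L`.
  · have hclog : (p : ℝ) ≤ 2 ^ Nat.clog 2 p := by
      exact_mod_cast Nat.le_pow_clog (by norm_num) p
    have hS3 : S ≤ (2 + Nat.clog 2 p) * θ :=
      sum_Icc_le_of_le_mul_two_pow hθ hp (hM.trans hθε) hclog
    have hj : (Nat.clog 2 p : ℝ) ≤ 1 + 2 * L := by
      rcases Nat.lt_or_ge p 2 with h | h
      · rw [Nat.clog_of_right_le_one (by omega)]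
        push_cast
        linarith
      · have h1 := Nat.pow_pred_clog_lt_self (b := 2) (by norm_num) h
        have h2 : (2 : ℝ) ^ (Nat.clog 2 p).pred ≤ p := by exact_mod_cast h1.le
        have h3 := Real.log_le_log (by positivity) h2
        rw [Real.log_pow] at h3
        have h4 : (Nat.clog 2 p : ℝ) ≤ (Nat.clog 2 p).pred + 1 := by
          rw [Nat.pred_eq_sub_one]
          exact_mod_cast (by omega : Nat.clog 2 p ≤ Nat.clog 2 p - 1 + 1)
        have h5 := mul_le_mul_of_nonneg_left hlog2
          (Nat.cast_nonneg (α := ℝ) (Nat.clog 2 p).pred)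
        linarith
    -- `3 + 2 L ≤ 11 L`, because `L ≥ 1/3`.
    have hS4 : S ≤ 11 * L * θ := hS3.trans (mul_le_mul_of_nonneg_right (by linarith) hθ0.le)
    calc k * S ≤ (17 * (5 / 2 * l)) * (11 * L * θ) :=
          mul_le_mul (by linarith) hS4 hS0 (by linarith)
      _ = 467.5 * (θ * L * l) := by ring
      _ ≤ _ := by linarith

/-- Integrality creates a gap above `1`: `T = 2` forces `p ≥ 2`, and `T ≥ 3` gives `log₂ T ≥ 3/2`
since `2^{3/2} = √8 ≤ 3`. So `L` is bounded away from zero and can absorb constants. -/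
theorem three_halves_le_card_mul_logb {p T : ℕ} (h : 1 < (p : ℝ) * Real.logb 2 T) :
    2 ≤ T ∧ 1 ≤ p ∧ 1 ≤ Real.logb 2 T ∧ 3 / 2 ≤ (p : ℝ) * Real.logb 2 T := by
  have hT : 2 ≤ T := by
    by_contra hT
    have : T = 0 ∨ T = 1 := by omega
    rcases this with rfl | rfl <;> norm_num at h
  have hp : 1 ≤ p := by
    by_contra hp
    have : p = 0 := by omega
    rw [this] at h
    norm_num at h
  have hp' : (1 : ℝ) ≤ p := by exact_mod_cast hp
  have hT' : (2 : ℝ) ≤ T := by exact_mod_cast hT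
  have hlog : 1 ≤ Real.logb 2 T := by
    rw [Real.le_logb_iff_rpow_le (by norm_num) (by linarith)]
    simpa using hT'
  refine ⟨hT, hp, hlog, ?_⟩
  rcases hT.eq_or_lt with h2 | h3
  · have e : Real.logb 2 (T : ℝ) = 1 := by
      rw [← h2]
      exact Real.logb_self_eq_one (by norm_num)
    rw [e, mul_one] at h ⊢
    have : 1 < p := by exact_mod_cast h
    have : (2 : ℝ) ≤ p := by exact_mod_cast this
    linarith
  · have h3' : (3 : ℝ) ≤ T := by exact_mod_cast h3
    have : 3 / 2 ≤ Real.logb 2 (T : ℝ) := by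
      rw [Real.le_logb_iff_rpow_le (by norm_num) (by linarith)]
      refine le_trans ?_ h3'
      have h8 : ((2 : ℝ) ^ (3 / 2 : ℝ)) ^ 2 = 8 := by
        rw [← Real.rpow_natCast, ← Real.rpow_mul (by norm_num)]
        norm_num
      exact le_of_sq_le_sq (by rw [h8]; norm_num) (by norm_num)
    nlinarith

/-! ### From the sum over epochs to the rate -/

variable {X Y A Ω : Type*} [MeasurableSpace X] [MeasurableSpace Y] [MetricSpace A]
  [MeasurableSpace A] [BorelSpace A] [SecondCountableTopology A] [mΩ : MeasurableSpace Ω]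
  {c : Config X A} {D : Problem X Y A} {α : ℝ}
  {x : ℕ → Ω → X} {y : ℕ → Ω → Y} {a : ℕ → Ω → A} {P : Measure Ω} [IsProbabilityMeasure P]

theorem regret_le_mul_of_pos (hf : Fits c D α) (hr : IsRun c D P x y a)
    (hcT : 1 < (c.policies.card : ℝ) * Real.logb 2 (c.horizon : ℝ)) {ε : ℝ} (hε0 : 0 < ε)
    (hε1 : ε ≤ 1) :
    regret c.base c.bandwidth D c.policies c.horizon P y a ≤
      3000000 * α * (c.horizon * ε + smoothingCoeff c.base c.bandwidth D c.policies ε *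
        Real.log (c.policies.card * Real.logb 2 (c.horizon : ℝ)) * Real.log (1 / ε)) := by
  have := hf.isProb
  obtain ⟨hT, hp, hlogb, hN⟩ := three_halves_le_card_mul_logb hcT
  set p := c.policies.card with hpdef
  set N := (p : ℝ) * Real.logb 2 (c.horizon : ℝ) with hNdef
  set L := Real.log N with hLdef
  set T : ℝ := (c.horizon : ℝ) with hTdef
  set θ := smoothingCoeff c.base c.bandwidth D c.policies ε with hθdef
  have hT' : (2 : ℝ) ≤ T := by
    rw [hTdef]
    exact_mod_cast hT
  have hp' : (1 : ℝ) ≤ p := by exact_mod_cast hp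
  have hne : c.policies.Nonempty := Finset.card_pos.1 hp
  have hh := hf.bounds.radius_pos
  have hα : 1 ≤ α := by
    obtain ⟨x₀⟩ : Nonempty X := by
      have := D.isProb
      exact D.law.fst.nonempty_of_neZero
    obtain ⟨π, -⟩ := hne
    exact hf.bounds.one_le_alpha (π x₀)
  have hL0 : 1 / 3 ≤ L := by
    have h1 := Real.one_sub_inv_le_log_of_pos (by linarith : 0 < N)
    have h2 : N⁻¹ ≤ (3 / 2)⁻¹ := inv_anti₀ (by norm_num) hN
    norm_num at h2
    linarith
  -- The packing number of a nonempty set is at least one; take the term at `ε` in the supremum.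
  have hθε : 1 / ε ≤ θ := by
    refine le_trans ?_ (expectedPacking_div_le_smoothingCoeff hf.measurable_policy hh hε0 le_rfl)
    gcongr
    exact one_le_expectedPacking hf.measurable_policy hh hne (by linarith)
  have hθ0 : 0 < θ := (one_div_pos.2 hε0).trans_le hθε
  -- For `ε > 1/2` the trivial bound `T ≤ 2 T ε` suffices, and otherwise `log (1/ε)` is bounded
  -- below.
  rcases lt_or_ge (1 / 2) ε with hhalf | hhalf
  · have h1 := regret_le_horizon hf hr hne
    have h2 : 0 ≤ Real.log (1 / ε) := Real.log_nonneg ((one_le_div hε0).2 hε1)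
    have h3 : 0 ≤ θ * L * Real.log (1 / ε) := by positivity
    have h4 : T ≤ 2 * (T * ε) := by nlinarith
    have h5 : 0 ≤ T * ε + θ * L * Real.log (1 / ε) := by positivity
    calc _ ≤ T := h1
      _ ≤ 3000000 * 1 * (T * ε + θ * L * Real.log (1 / ε)) := by nlinarith
      _ ≤ _ := by gcongr
  · have h2ε : 2 ≤ 1 / ε := by rw [le_div_iff₀ hε0]; linarith
    -- `M` is the last epoch with radius at least `ε`: `2^M ≤ 1/ε < 2^{M+1}`.
    obtain ⟨M, hM1, hM2⟩ := exists_nat_pow_near (by linarith : 1 ≤ 1 / ε) (by norm_num : (1 : ℝ) < 2)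
    have hradius : ∀ m, radius m = 1 / 2 ^ m := fun m => by
      unfold radius
      rw [div_pow, one_pow]
    have hlarge : ∀ m ∈ Finset.Icc 1 M, ε ≤ radius m := fun m hm => by
      have h1 : (2 : ℝ) ^ m ≤ 2 ^ M := pow_le_pow_right₀ (by norm_num) (Finset.mem_Icc.1 hm).2
      rw [hradius, le_div_iff₀ (by positivity), mul_comm, ← le_div_iff₀ hε0]
      exact h1.trans hM1
    have hsmall : ∀ m, M < m → radius m ≤ ε := fun m hm => by
      have h1 : (2 : ℝ) ^ (M + 1) ≤ 2 ^ m := pow_le_pow_right₀ (by norm_num) hm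
      rw [hradius, div_le_iff₀ (by positivity), mul_comm, ← div_le_iff₀ hε0]
      exact hM2.le.trans h1
    have hlogTN : Real.log (T * p * Real.logb 2 T) = Real.log T + L := by
      rw [mul_assoc, Real.log_mul (by linarith) (by linarith)]
    have hlog2 : (1 : ℝ) / 2 ≤ Real.log 2 := by have := Real.log_two_gt_d9; linarith
    have hτ0 : 1 / 2 ≤ Real.log T := hlog2.trans (Real.log_le_log (by norm_num) hT')
    have hkeq : (c.numBatches : ℝ) = 5 * (⌈Real.log T + L⌉₊ : ℝ) := by
      unfold Config.numBatches
      rw [← hlogTN]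
      push_cast
      rfl
    have hk5 : 5 * (Real.log T + L) ≤ c.numBatches := by
      rw [hkeq]
      have := Nat.le_ceil (Real.log T + L)
      linarith
    have hk15 : (c.numBatches : ℝ) ≤ 15 * (Real.log T + L) := by
      rw [hkeq]
      have := Nat.ceil_lt_add_one (by linarith : 0 ≤ Real.log T + L)
      linarith
    have hk : 0 < c.numBatches := by
      have : (0 : ℝ) < c.numBatches := by linarith
      exact_mod_cast this
    have hreg := regret_le hf hr hne hk hε0.le hsmall
    -- `6^{-k} ≤ exp(-5 (log T + L))` outweighs the three factors `T`, `T` and `p`, each at most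
    -- `exp(log T + L)`.
    have hbad : 2 * T * (T * (p * (1 / 6) ^ c.numBatches)) ≤ 2 := by
      have h1 : ((1 : ℝ) / 6) ^ c.numBatches ≤ Real.exp (-(5 * (Real.log T + L))) := by
        calc ((1 : ℝ) / 6) ^ c.numBatches ≤ (Real.exp (-1)) ^ c.numBatches := by
              refine pow_le_pow_left₀ (by norm_num) ?_ _
              rw [Real.exp_neg, ← one_div]
              refine one_div_le_one_div_of_le (Real.exp_pos _) ?_
              have := Real.exp_one_lt_d9
              linarith
          _ = Real.exp (-(c.numBatches : ℝ)) := by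
              rw [← Real.exp_nat_mul]
              congr 1
              ring
          _ ≤ _ := Real.exp_le_exp.2 (by linarith)
      have h2 : T ≤ Real.exp (Real.log T + L) := by
        rw [← Real.exp_log (by linarith : 0 < T)]
        exact Real.exp_le_exp.2 (by rw [Real.log_exp]; linarith)
      have h3 : (p : ℝ) ≤ Real.exp (Real.log T + L) := by
        calc (p : ℝ) ≤ N := le_mul_of_one_le_right (by linarith) hlogb
          _ = Real.exp L := (Real.exp_log (by linarith)).symm
          _ ≤ _ := Real.exp_le_exp.2 (by linarith)
      calc 2 * T * (T * (p * (1 / 6) ^ c.numBatches))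
          ≤ 2 * Real.exp (Real.log T + L) * (Real.exp (Real.log T + L) *
            (Real.exp (Real.log T + L) * Real.exp (-(5 * (Real.log T + L))))) := by gcongr
        _ = 2 * Real.exp (-(2 * (Real.log T + L))) := by
            rw [mul_assoc, ← Real.exp_add, ← Real.exp_add, ← Real.exp_add]
            congr 2
            ring
        _ ≤ 2 * 1 := by
            gcongr
            exact Real.exp_le_one_iff.2 (by linarith)
        _ = 2 := by norm_num
    have hkS := batches_mul_sum_le (f := fun m => expectedPacking c.base c.bandwidth D c.policies
        (12 * radius m) c.bandwidth / radius m) (θ := θ) (M := M) (p := p) (L := L)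
        (k := c.numBatches) hT' hp
      (Real.log_le_log (by linarith) (le_mul_of_one_le_right (by linarith) hlogb)) hL0
      hk15 hε0 hhalf hM1 hθε
      (fun m _ => div_nonneg (integral_nonneg fun _ => Nat.cast_nonneg _) (radius_pos m).le)
      (fun m hm => expectedPacking_div_le_smoothingCoeff hf.measurable_policy hh hε0 (hlarge m hm))
      (fun m _ => by
        rw [hradius, div_le_iff₀ (by positivity), mul_assoc, mul_one_div_cancel (by positivity),
          mul_one]
        exact expectedPacking_le_card hf.measurable_policy hh _)
    rw [← Finset.mul_sum] at hreg
    set S := ∑ m ∈ Finset.Icc 1 M, expectedPacking c.base c.bandwidth D c.policies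
        (12 * radius m) c.bandwidth / radius m with hS
    set l := Real.log (1 / ε) with hl
    have hl0 : 1 / 2 ≤ l := hlog2.trans (Real.log_le_log (by norm_num) h2ε)
    have hone : 1 / 3 ≤ θ * L * l := by
      calc (1 : ℝ) / 3 = 2 * (1 / 3) * (1 / 2) := by norm_num
        _ ≤ θ * L * l := by gcongr; linarith
    have hTε : 0 ≤ T * ε := by positivity
    have hR : 0 ≤ T * ε + θ * L * l := by linarith
    -- `2086500 = 13 · 321 · 500`. The other terms are `13 T ε` and the `2` from the bad event; the
    -- latter is at most six times the right side, which is at least `1/3`. Together they give the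
    -- `19` in `h2`.
    have h1 : 13 * (321 * c.numBatches * α * S) ≤ 2086500 * α * (T * ε + θ * L * l) := by
      have := mul_le_mul_of_nonneg_left hkS (by positivity : 0 ≤ 13 * 321 * α)
      calc _ = 13 * 321 * α * (c.numBatches * S) := by ring
        _ ≤ 13 * 321 * α * (500 * (T * ε + θ * L * l)) := this
        _ = _ := by ring
    have h2 : 19 * (T * ε + θ * L * l) ≤ 19 * α * (T * ε + θ * L * l) := by
      have := mul_le_mul_of_nonneg_right hα hR
      linarith
    have h3 : 0 ≤ α * (T * ε + θ * L * l) := by positivity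
    linarith

theorem regret_le_mul_rate (hf : Fits c D α) (hr : IsRun c D P x y a)
    (hcT : 1 < (c.policies.card : ℝ) * Real.logb 2 (c.horizon : ℝ)) {C : ℝ}
    (hC : 3000000 * α ≤ C) (hC0 : 0 < C) :
    regret c.base c.bandwidth D c.policies c.horizon P y a ≤
      C * rate c.base c.bandwidth D c.policies c.horizon := by
  have : Nonempty (Set.Ioc (0 : ℝ) 1) := ⟨⟨1, by norm_num⟩⟩
  rw [← div_le_iff₀' hC0]
  refine le_ciInf fun ε => ?_
  rw [div_le_iff₀' hC0]
  have := hf.isProb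
  obtain ⟨hT, hp, hlogb, hN⟩ := three_halves_le_card_mul_logb hcT
  refine (regret_le_mul_of_pos hf hr hcT ε.2.1 ε.2.2).trans (mul_le_mul_of_nonneg_right hC ?_)
  have hθ : 0 ≤ smoothingCoeff c.base c.bandwidth D c.policies ε := by
    refine Real.iSup_nonneg fun e => div_nonneg (integral_nonneg fun _ => Nat.cast_nonneg _) ?_
    exact ε.2.1.le.trans e.2
  have h1 : 0 ≤ Real.log (1 / (ε : ℝ)) := Real.log_nonneg ((one_le_div ε.2.1).2 ε.2.2)
  have h2 : 0 ≤ Real.log (c.policies.card * Real.logb 2 (c.horizon : ℝ)) :=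
    Real.log_nonneg (by linarith)
  have h3 := ε.2.1.le
  positivity

/-! ### Action spaces -/

section Spaces

/-- A disjoint family of balls of positive volume in a finite measure space is countable. By
Vitali's lemma a maximal such family of radius `ε / 5`, enlarged five times, covers the space. -/
theorem secondCountableTopology_of_volume_pos {A : Type*} [MetricSpace A] [MeasurableSpace A]
    [BorelSpace A] {ν : Measure A} [IsFiniteMeasure ν]
    (h : ∀ (a : A) (r : ℝ), 0 < r → 0 < ν.real (Metric.closedBall a r)) :
    SecondCountableTopology A := by
  refine Metric.secondCountable_of_almost_dense_set fun ε hε => ?_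
  obtain ⟨u, -, hdisj, hcov⟩ := Vitali.exists_disjoint_subfamily_covering_enlargement_closedBall
    (Set.univ : Set A) id (fun _ => ε / 5) (ε / 5)
    (fun _ _ => le_rfl) 5 (by norm_num)
  refine ⟨u, ?_, fun a => ?_⟩
  · have h1 := Measure.countable_meas_pos_of_disjoint_iUnion (μ := ν)
      (As := fun a : u => Metric.closedBall (a : A) (ε / 5))
      (fun a => Metric.isClosed_closedBall.measurableSet)
      fun a b hab => hdisj a.2 b.2 fun h => hab (Subtype.ext h)
    have h2 : {a : u | 0 < ν (Metric.closedBall (a : A) (ε / 5))} = Set.univ :=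
      Set.eq_univ_of_forall fun a => (ENNReal.toReal_pos_iff.1 (h a (ε / 5) (by positivity))).1
    rw [h2, Set.countable_univ_iff] at h1
    exact Set.countable_coe_iff.1 h1
  · obtain ⟨b, hb, hsub⟩ := hcov a (Set.mem_univ a)
    refine ⟨b, hb, ?_⟩
    have := hsub (Metric.mem_closedBall_self (by positivity))
    rw [Metric.mem_closedBall] at this
    rwa [mul_div_cancel₀ ε (by norm_num)] at this

/-- Uniformity bounds every density by `α / ν(B(a, 2h))`. This makes the supremum `κ_h` a genuine
one, so that it dominates `1 / ν(B(a, h))`, and also bounds it from above. -/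
theorem ballBounds_kappa {A : Type*} [MetricSpace A] [MeasurableSpace A] {ν : Measure A}
    {α h : ℝ} (hpos : ∀ (a : A) (r : ℝ), 0 < r → 0 < ν.real (Metric.closedBall a r))
    (hα : HasUniformBalls ν α) (hh : 0 < h) : BallBounds ν h (kappa ν h) α := by
  have hle : ∀ a b b' : A, |smooth ν h b b'| ≤ α / ν.real (Metric.closedBall a (2 * h)) := by
    intro a b b'
    have h1 := hpos b h hh
    have h2 := hpos a (2 * h) (by linarith)
    have h3 := hα a b h hh
    have h4 : (ν.real (Metric.closedBall b h))⁻¹ ≤ α / ν.real (Metric.closedBall a (2 * h)) := by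
      rw [← one_div, div_le_div_iff₀ h1 h2]
      linarith
    rw [abs_of_nonneg (smooth_nonneg _ _ _ _)]
    exact Set.indicator_le' (fun _ _ => h4) (fun _ _ => (inv_pos.2 h1).le.trans h4) _
  refine ⟨hh, fun a => ?_, fun a => ?_⟩
  · have h1 := hpos a h hh
    rw [← inv_le_iff_one_le_mul₀ h1]
    have h2 : |smooth ν h a a| ≤ kappa ν h :=
      le_ciSup (f := fun p : A × A => |smooth ν h p.1 p.2|)
        ⟨_, Set.forall_mem_range.2 fun p => hle a p.1 p.2⟩ (a, a)
    rw [smooth, Set.indicator_of_mem (Metric.mem_closedBall_self hh.le),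
      abs_of_pos (inv_pos.2 h1)] at h2
    exact h2
  · have : Nonempty (A × A) := ⟨(a, a)⟩
    rw [← le_div_iff₀ (hpos a (2 * h) (by linarith))]
    exact ciSup_le fun p => hle a p.1 p.2

/-- A ball is shortest at an endpoint, where it still has length `min h 1`; with radius `2 h` its
length is at most `min (4 h) 1 ≤ 4 min h 1`. -/
theorem ballBounds_unitInterval {h : ℝ} (hh : 0 < h) :
    BallBounds (volume : Measure unitInterval) h (1 / min h 1) 4 := by
  have hvol : ∀ (a : unitInterval) (r : ℝ), volume.real (Metric.closedBall a r) =
      (volume : Measure ℝ).real (Set.Icc (max 0 ((a : ℝ) - r)) (min 1 ((a : ℝ) + r))) := by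
    intro a r
    rw [measureReal_def, measureReal_def, unitInterval.volume_apply]
    congr 2
    ext u
    simp only [Set.mem_image, Metric.mem_closedBall, Set.mem_Icc, Subtype.dist_eq, Real.dist_eq,
      abs_le, max_le_iff, le_min_iff]
    constructor
    · rintro ⟨v, ⟨h1, h2⟩, rfl⟩
      exact ⟨⟨v.2.1, by linarith⟩, v.2.2, by linarith⟩
    · rintro ⟨⟨h1, h2⟩, h3, h4⟩
      exact ⟨⟨u, h1, h3⟩, ⟨by simp only; linarith, by simp only; linarith⟩, rfl⟩
  have hm : 0 < min h 1 := lt_min hh one_pos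
  have hmh := min_le_left h 1
  have hm1 := min_le_right h 1
  refine ⟨hh, fun a => ?_, fun a => ?_⟩
  · have h0 := a.2.1
    have h1 := a.2.2
    rw [hvol, measureReal_def, Real.volume_Icc, one_div, ← div_eq_inv_mul, one_le_div hm]
    refine (le_trans ?_ (le_max_left _ 0)).trans_eq ENNReal.toReal_ofReal'.symm
    rcases max_cases 0 ((a : ℝ) - h) with h2 | h2 <;>
      rcases min_cases 1 ((a : ℝ) + h) with h3 | h3 <;> linarith
  · have h1 : volume.real (Metric.closedBall a (2 * h)) ≤ 1 := measureReal_le_one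
    have h2 : volume.real (Metric.closedBall a (2 * h)) ≤ 4 * h := by
      rw [hvol, measureReal_def, Real.volume_Icc, ENNReal.toReal_ofReal']
      refine max_le ?_ (by linarith)
      have := le_max_right 0 ((a : ℝ) - 2 * h)
      have := min_le_right 1 ((a : ℝ) + 2 * h)
      linarith
    rw [one_div, ← div_eq_inv_mul, div_le_iff₀ hm]
    rcases min_cases h 1 with h3 | h3 <;> linarith

end Spaces

end

end

end SmoothBandit

/-! ### The theorem for both kinds of action space -/

theorem theorem1 :
    -- General form: doubling action spaces with uniform ball volumes.
    (∀ α : ℝ, ∃ C : ℝ, 0 < C ∧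
      ∀ (A : Type*) [MetricSpace A] [MeasurableSpace A] [BorelSpace A]
        (ν : Measure A) [IsProbabilityMeasure ν] (d : ℝ),
        SmoothBandit.IsDoublingSpace ν d → SmoothBandit.HasUniformBalls ν α →
      ∀ (X Y : Type*) [MeasurableSpace X] [MeasurableSpace Y]
        (D : SmoothBandit.Problem X Y A) (Pol : Finset (X → A)),
        (∀ π ∈ Pol, Measurable π) →
      ∀ (h : ℝ), 0 < h →
      ∀ (T : ℕ), 1 < (Pol.card : ℝ) * Real.logb 2 (T : ℝ) →
      ∀ (solver : ℕ → Finset (X → A) → (X → A) → ℝ) (c : SmoothBandit.Config X A),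
        c = { base := ν, ctxLaw := D.law.fst, bandwidth := h, kap := SmoothBandit.kappa ν h,
              horizon := T, policies := Pol, solver := solver } →
        c.SolverIsOptimal →
      ∀ (Ω : Type*) [MeasurableSpace Ω] (P : Measure Ω) [IsProbabilityMeasure P]
        (x : ℕ → Ω → X) (y : ℕ → Ω → Y) (a : ℕ → Ω → A),
        SmoothBandit.IsRun c D P x y a →
        SmoothBandit.regret ν h D Pol T P y a ≤ C * SmoothBandit.rate ν h D Pol T) ∧
    -- The unit interval with Lebesgue measure; here `κ_h = 1 / min {h, 1}`.
    (∃ C : ℝ, 0 < C ∧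
      ∀ (X Y : Type*) [MeasurableSpace X] [MeasurableSpace Y]
        (D : SmoothBandit.Problem X Y unitInterval) (Pol : Finset (X → unitInterval)),
        (∀ π ∈ Pol, Measurable π) →
      ∀ (h : ℝ), 0 < h →
      ∀ (T : ℕ), 1 < (Pol.card : ℝ) * Real.logb 2 (T : ℝ) →
      ∀ (solver : ℕ → Finset (X → unitInterval) → (X → unitInterval) → ℝ)
        (c : SmoothBandit.Config X unitInterval),
        c = { base := volume, ctxLaw := D.law.fst, bandwidth := h, kap := 1 / min h 1,
              horizon := T, policies := Pol, solver := solver } →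
        c.SolverIsOptimal →
      ∀ (Ω : Type*) [MeasurableSpace Ω] (P : Measure Ω) [IsProbabilityMeasure P]
        (x : ℕ → Ω → X) (y : ℕ → Ω → Y) (a : ℕ → Ω → unitInterval),
        SmoothBandit.IsRun c D P x y a →
        SmoothBandit.regret volume h D Pol T P y a ≤ C * SmoothBandit.rate volume h D Pol T) := by
  -- The constant is chosen before the space and must be positive for every real `α`, hence `max α
  -- 1`; on the interval `α = 4`.
  refine ⟨fun α => ⟨3000000 * max α 1, by positivity, ?_⟩, 3000000 * 4, by norm_num, ?_⟩
  · intro A _ _ _ ν _ d hd hα X Y _ _ D Pol hPol h hh T hT solver c hc hsol Ω _ P _ x y a hr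
    have hpos : ∀ (a : A) (r : ℝ), 0 < r → 0 < ν.real (Metric.closedBall a r) := fun a r h0 => by
      have := hd.pos a (r / 2) (by linarith)
      rwa [mul_div_cancel₀ r (by norm_num)] at this
    have := SmoothBandit.secondCountableTopology_of_volume_pos hpos
    subst hc
    exact SmoothBandit.regret_le_mul_rate
      ⟨inferInstance, rfl, SmoothBandit.ballBounds_kappa hpos hα hh, hPol, hsol⟩ hr hT
      (mul_le_mul_of_nonneg_left (le_max_left _ _) (by norm_num)) (by positivity)
  · intro X Y _ _ D Pol hPol h hh T hT solver c hc hsol Ω _ P _ x y a hr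
    subst hc
    exact SmoothBandit.regret_le_mul_rate
      ⟨inferInstance, rfl, SmoothBandit.ballBounds_unitInterval hh, hPol, hsol⟩ hr hT
      le_rfl (by norm_num)
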